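/- Let $p>0$, $T>0$, $J(u)=u(1-u)$, let $u\in L^\infty([0,T]\times[0,1])$ and $v_\pm\in L^\infty([0,T])$ take values in $[0,1]$. A pair $(F,Q)$ of $C^2$ functions on $[0,1]$ is called a Lax entropy flux pair if $Q'(w)=(1-2w)F'(w)$ and $F''(w)\ge 0$ for all $w\in[0,1]$. A pair $(\mathcal F,\mathcal Q)$ of continuous functions on $[0,1]^2$ is called a boundary entropy flux pair if, for each $v\in[0,1]$, $(\mathcal F,\mathcal Q)(\cdot,v)$ is a Lax entropy flux pair and $\mathcal F(v,v)=\partial_w\mathcal F(w,v)|_{w=v}=\mathcal Q(v,v)=0$. Assume that for every Lax entropy flux pair $(F,Q)$, $$\partial_t[F(u)]+p\,\partial_x[Q(u)]\le 0\quad\text{in the sense of distributions on }(0,T)\times(0,1).$$ Then $u$ has strong boundary traces: there are $u_\pm\in L^\infty([0,T])$ such that $$\operatorname*{ess\,lim}_{x\to0+}\int_0^T|u(t,x)-u_-(t)|\,dt=0,\qquad \operatorname*{ess\,lim}_{x\to1-}\int_0^T|u(t,x)-u_+(t)|\,dt=0 .$$ Moreover, for these traces the following two conditions are equivalent. (a)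 For every boundary entropy flux pair $(\mathcal F,\mathcal Q)$ and every $\phi\in C([0,T])$ with $\phi\ge0$, the essential limits below exist and $$\operatorname*{ess\,lim}_{x\to0+}\int_0^T\phi(t)\,\mathcal Q\big(u(t,x),v_-(t)\big)\,dt\le 0,\qquad \operatorname*{ess\,lim}_{x\to1-}\int_0^T\phi(t)\,\mathcal Q\big(u(t,x),v_+(t)\big)\,dt\ge 0 .$$ (b) For almost every $t\in[0,T]$, $$u_-(t)\in\{v_-(t)\}\cup\big[1-\min\{\tfrac12,v_-(t)\},\,1\big],\qquad u_+(t)\in\big[0,\,1-\max\{\tfrac12,v_+(t)\}\big]\cup\{v_+(t)\}.$$ -/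

import Mathlib

open MeasureTheory Filter Set
open scoped Topology ContDiff

/-- `(F, Q)` is a Lax entropy flux pair on `[0,1]` for the flux `J u = u * (1 - u)`.
Derivatives are one-sided at the end points; values outside `[0,1]` are irrelevant. -/
structure IsLaxPair (F Q : ℝ → ℝ) : Prop where
  contDiffOn_entropy : ContDiffOn ℝ 2 F (Icc 0 1)
  contDiffOn_flux : ContDiffOn ℝ 2 Q (Icc 0 1)
  deriv_flux : ∀ u ∈ Icc (0 : ℝ) 1,
    derivWithin Q (Icc 0 1) u = (1 - 2 * u) * derivWithin F (Icc 0 1) u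
  convex : ∀ u ∈ Icc (0 : ℝ) 1, 0 ≤ iteratedDerivWithin 2 F (Icc 0 1) u

/-- `(F, Q)` is a boundary entropy flux pair on `[0,1]²`; the first argument is the state `u`,
the second one the boundary datum `v`. Joint continuity makes the integrals of
`Q (u (t, x)) (v t)` meaningful. -/
structure IsBoundaryPair (F Q : ℝ → ℝ → ℝ) : Prop where
  continuousOn_entropy : ContinuousOn (Function.uncurry F) (Icc 0 1 ×ˢ Icc 0 1)
  continuousOn_flux : ContinuousOn (Function.uncurry Q) (Icc 0 1 ×ˢ Icc 0 1)
  lax : ∀ v ∈ Icc (0 : ℝ) 1, IsLaxPair (fun u => F u v) (fun u => Q u v)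
  entropy_diag : ∀ v ∈ Icc (0 : ℝ) 1, F v v = 0
  deriv_entropy_diag : ∀ v ∈ Icc (0 : ℝ) 1, derivWithin (fun u => F u v) (Icc 0 1) v = 0
  flux_diag : ∀ v ∈ Icc (0 : ℝ) 1, Q v v = 0

/-- The entropy inequality `∂ₜ F(u) + p ∂ₓ Q(u) ≤ 0` in the sense of distributions on
`(0,T) × (0,1)`, for every Lax entropy flux pair. Points of the plane are `z = (t, x)`. -/
def EntropyInequality (p T : ℝ) (u : ℝ → ℝ → ℝ) : Prop :=
  ∀ F Q : ℝ → ℝ, IsLaxPair F Q →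
    ∀ θ : ℝ × ℝ → ℝ, ContDiff ℝ ∞ θ → HasCompactSupport θ →
      tsupport θ ⊆ Ioo 0 T ×ˢ Ioo 0 1 → (∀ z, 0 ≤ θ z) →
        0 ≤ ∫ z in Ioo 0 T ×ˢ Ioo 0 1,
          (F (u z.1 z.2) * fderiv ℝ θ z (1, 0) + p * (Q (u z.1 z.2) * fderiv ℝ θ z (0, 1)))

/-- `L` is the essential limit of `g x` as `x → 0+`. -/
def EssLimZero (g : ℝ → ℝ) (L : ℝ) : Prop :=
  Tendsto g (𝓝[>] (0 : ℝ) ⊓ ae volume) (𝓝 L)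

/-- `L` is the essential limit of `g x` as `x → 1-`. -/
def EssLimOne (g : ℝ → ℝ) (L : ℝ) : Prop :=
  Tendsto g (𝓝[<] (1 : ℝ) ⊓ ae volume) (𝓝 L)

/-- `w ∈ L^∞([0,T])` is the strong (`L¹`) trace of `u` at `x = 0`. -/
def IsTraceZero (T : ℝ) (u : ℝ → ℝ → ℝ) (w : ℝ → ℝ) : Prop :=
  MemLp w ⊤ (volume.restrict (Icc 0 T)) ∧
    EssLimZero (fun x => ∫ t in Icc 0 T, |u t x - w t|) 0

/-- `w ∈ L^∞([0,T])` is the strong (`L¹`) trace of `u` at `x = 1`. -/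
def IsTraceOne (T : ℝ) (u : ℝ → ℝ → ℝ) (w : ℝ → ℝ) : Prop :=
  MemLp w ⊤ (volume.restrict (Icc 0 T)) ∧
    EssLimOne (fun x => ∫ t in Icc 0 T, |u t x - w t|) 0

/-- Otto's boundary conditions on `[0,T]` with data `vm` at `x = 0` and `vp` at `x = 1`: the
essential limits exist and have the required signs. -/
def OttoBoundaryCondition (T : ℝ) (u : ℝ → ℝ → ℝ) (vm vp : ℝ → ℝ) : Prop :=
  ∀ F Q : ℝ → ℝ → ℝ, IsBoundaryPair F Q →
    ∀ φ : ℝ → ℝ, ContinuousOn φ (Icc 0 T) → (∀ t ∈ Icc 0 T, 0 ≤ φ t) →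
      (∃ L, EssLimZero (fun x => ∫ t in Icc 0 T, φ t * Q (u t x) (vm t)) L ∧ L ≤ 0) ∧
      (∃ L, EssLimOne (fun x => ∫ t in Icc 0 T, φ t * Q (u t x) (vp t)) L ∧ 0 ≤ L)

/-! Reflection. The map u(t,x) ↦ 1 - u(t,1-x) preserves the entropy inequality and exchanges the two
ends of the interval (`EntropyInequality.reflect`, `isTraceOne_iff`, `ottoBoundaryCondition_iff`),
so all the work is done at x = 0.

Weak traces. Tested against φ(t) ≥ 0, the flux Q(u(·,x)) of a convex entropy is nonincreasing in x
up to a Lipschitz term, hence has an essential limit as x → 0+. Since the speed 1 - 2w vanishes at a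
single state, fluxes and constants are uniformly dense among polynomials, so every power u^i has a
weak trace m_i (`IsEntropySolution.exists_isWeakTrace`). Write q for the functional with moments
m_i(t). If m_2 = m_1² almost everywhere, then ∫|u - m_1|² → 0 and the trace is strong
(`IsEntropySolution.exists_strongTrace`). It remains to show that q has no variance.

Blow-up. With a boundary term added, the entropy inequality holds for tests that do not vanish at x
= 0 (`boundaryForm_nonneg`), and the dissipation of every entropy is dominated by that of w²
(`abs_boundaryForm_le`). The dissipation in a layer of height r tends to zero with r, so at almost
every t₀, along suitable scales, the dissipation near (t₀,0) is negligible after rescaling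
(`exists_scales`). If t₀ is also a Lebesgue point of all m_i, the rescaled functions U_n satisfy in
the limit every entropy equality on the half plane, with the constants q(Q) as boundary fluxes
(`IsZoomPoint.isBlowUp`).

Rigidity. If F ≈ cQ for an entropy F with flux Q, then Q(U_n) nearly solves a linear transport
equation with constant boundary data, so it is weakly close to a constant. By
`exists_flux_decomposition` every polynomial is a sum of such fluxes up to small errors, hence
h(U_n) converges weakly to q(h) for all h (`IsBlowUp.tendsto_integral_eval`). The conservation law
supplies a potential W_n with ∂_y W_n = U_n - q(X), which tends to zero uniformly on bounded sets.
Multiplying the entropy inequality for w² by W_n gives, in the limit, one inequality between the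
moments of q. Together with positivity of the fourth central moment it forces q(X²) = q(X)²
(`IsBlowUp.map_X_sq`).

Boundary conditions. With a strong trace w, the integrals in (a) converge to those of φ Q(w,v), so
(a) says that Q(w(t),v(t)) ≤ 0 for all boundary pairs. Two integrations give Q(w,v) = ∫_v^w
F''(s)(J(w) - J(s)) ds with J(s) = s(1-s). Varying F'' over countably many tents yields the
admissible set (`mem_of_forall_kernelFlux_nonpos`); the converse is a monotonicity argument
(`IsBoundaryPair.flux_nonpos`). -/

/-! ### Line integrals and the dual transport problem on the half plane. -/

/-- The open upper half plane `{(s, y) | 0 < y}`. -/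
def halfPlane : Set (ℝ × ℝ) := {z | 0 < z.2}

lemma measurableSet_halfPlane : MeasurableSet halfPlane :=
  measurableSet_lt measurable_const measurable_snd

/-- A bounded measurable function times a continuous compactly supported one is integrable. -/
lemma integrable_bdd_mul {α : Type*} [TopologicalSpace α] [MeasurableSpace α]
    [OpensMeasurableSpace α] {μ : Measure α} [IsFiniteMeasureOnCompacts μ]
    {f g : α → ℝ} {M : ℝ}
    (hf : AEStronglyMeasurable f μ) (hM : ∀ z, |f z| ≤ M) (hg : Continuous g)
    (hgc : HasCompactSupport g) : Integrable (fun z => f z * g z) μ :=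
  (hg.integrable_of_hasCompactSupport hgc).bdd_mul hf (Eventually.of_forall hM)

lemma HasCompactSupport.fderiv_apply_const {θ : ℝ × ℝ → ℝ} (hc : HasCompactSupport θ)
    (v : ℝ × ℝ) : HasCompactSupport fun z => fderiv ℝ θ z v :=
  hc.fderiv_apply (𝕜 := ℝ) v

lemma ContDiff.continuous_fderiv_apply_const {θ : ℝ × ℝ → ℝ} (hs : ContDiff ℝ ∞ θ)
    (v : ℝ × ℝ) : Continuous fun z => fderiv ℝ θ z v :=
  (hs.continuous_fderiv (by simp)).clm_apply continuous_const

/-- Differentiation under a line integral. -/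
lemma hasFDerivAt_lineIntegral {E : Type*} [NormedAddCommGroup E] [NormedSpace ℝ E]
    {g : ℝ × ℝ → E} (hg : ContDiff ℝ 1 g) (hc : HasCompactSupport g) (v : ℝ × ℝ) (Y : ℝ)
    (z : ℝ × ℝ) :
    HasFDerivAt (fun z => ∫ τ in (0 : ℝ)..Y, g (z + τ • v))
      (∫ τ in (0 : ℝ)..Y, fderiv ℝ g (z + τ • v)) z := by
  have hcont : Continuous (fderiv ℝ g) := hg.continuous_fderiv (by simp)
  obtain ⟨C, hC⟩ := hcont.bounded_above_of_compact_support (hc.fderiv (𝕜 := ℝ))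
  refine (intervalIntegral.hasFDerivAt_integral_of_dominated_of_fderiv_le
    (F := fun z τ => g (z + τ • v)) (F' := fun z τ => fderiv ℝ g (z + τ • v))
    (bound := fun _ => C) (s := univ) univ_mem ?_ ?_ ?_ ?_ ?_ ?_)
  · exact Eventually.of_forall fun x =>
      (hg.continuous.comp (by fun_prop)).aestronglyMeasurable
  · exact (hg.continuous.comp (by fun_prop)).intervalIntegrable _ _
  · exact (hcont.comp (by fun_prop)).aestronglyMeasurable
  · exact Eventually.of_forall fun τ _ x _ => hC _
  · exact intervalIntegrable_const
  · refine Eventually.of_forall fun τ _ x _ => ?_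
    have h := (hg.differentiable (by simp) (x + τ • v)).hasFDerivAt
    exact h.comp x ((hasFDerivAt_id x).add_const (τ • v))

/-- Differentiation commutes with the line integral, and `fderiv ℝ g` takes values in another normed
space. The target `E` is therefore quantified inside the induction on the order of smoothness. -/
lemma contDiff_lineIntegral_nat (n : ℕ) : ∀ {E : Type} [NormedAddCommGroup E] [NormedSpace ℝ E]
    {g : ℝ × ℝ → E} (_ : ContDiff ℝ n g) (_ : HasCompactSupport g) (v : ℝ × ℝ) (Y : ℝ),
    ContDiff ℝ n (fun z => ∫ τ in (0 : ℝ)..Y, g (z + τ • v)) := by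
  induction n with
  | zero =>
    intro E _ _ g hg hc v Y
    simp only [Nat.cast_zero, contDiff_zero] at hg ⊢
    exact intervalIntegral.continuous_parametric_intervalIntegral_of_continuous'
      (f := fun z τ => g (z + τ • v)) (by exact hg.comp (by fun_prop)) 0 Y
  | succ n ih =>
    intro E _ _ g hg hc v Y
    have h1 : ContDiff ℝ 1 g := hg.of_le (by norm_cast; omega)
    have hd := hasFDerivAt_lineIntegral h1 hc v Y
    push_cast at hg ⊢
    rw [contDiff_succ_iff_fderiv] at hg ⊢
    refine ⟨fun z => (hd z).differentiableAt, by simp, ?_⟩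
    rw [show fderiv ℝ (fun z => ∫ τ in (0 : ℝ)..Y, g (z + τ • v)) =
      fun z => ∫ τ in (0 : ℝ)..Y, fderiv ℝ g (z + τ • v) from funext fun z => (hd z).fderiv]
    exact ih hg.2.2 (hc.fderiv (𝕜 := ℝ)) v Y

lemma contDiff_lineIntegral {g : ℝ × ℝ → ℝ} (hg : ContDiff ℝ ∞ g) (hc : HasCompactSupport g)
    (v : ℝ × ℝ) (Y : ℝ) : ContDiff ℝ ∞ (fun z => ∫ τ in (0 : ℝ)..Y, g (z + τ • v)) :=
  contDiff_infty.2 fun n => contDiff_lineIntegral_nat n (hg.of_le (by exact_mod_cast le_top)) hc v Y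

lemma hasCompactSupport_lineIntegral {g : ℝ × ℝ → ℝ} (hc : HasCompactSupport g)
    (v : ℝ × ℝ) (Y : ℝ) : HasCompactSupport (fun z => ∫ τ in (0 : ℝ)..Y, g (z + τ • v)) := by
  have hK : IsCompact ((fun x : (ℝ × ℝ) × ℝ => x.1 - x.2 • v) '' (tsupport g ×ˢ uIcc 0 Y)) :=
    (hc.isCompact.prod isCompact_uIcc).image (by fun_prop)
  refine HasCompactSupport.intro hK fun z hz => ?_
  refine intervalIntegral.integral_zero_ae (Eventually.of_forall fun τ hτ => ?_)
  by_contra h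
  refine hz ⟨(z + τ • v, τ), ⟨subset_tsupport _ h, uIoc_subset_uIcc hτ⟩, by simp⟩

lemma restrict_halfPlane :
    (volume : Measure (ℝ × ℝ)).restrict halfPlane = volume.prod (volume.restrict (Ioi (0 : ℝ))) := by
  have : halfPlane = univ ×ˢ Ioi (0 : ℝ) := by ext z; simp [halfPlane]
  rw [this, Measure.volume_eq_prod, ← Measure.prod_restrict, Measure.restrict_univ]

/-- Integration over the half plane by horizontal slices. -/
lemma setIntegral_halfPlane {f : ℝ × ℝ → ℝ} (hf : IntegrableOn f halfPlane) :
    ∫ z in halfPlane, f z = ∫ y in Ioi (0 : ℝ), ∫ s, f (s, y) := by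
  rw [IntegrableOn, restrict_halfPlane] at hf
  rw [restrict_halfPlane, integral_prod_symm _ hf]

lemma integrable_prod_Ioc_of_continuous {α : Type*} [TopologicalSpace α] [T2Space α]
    [SecondCountableTopology α]
    [MeasurableSpace α] [OpensMeasurableSpace α] {μ : Measure α} [SFinite μ]
    [IsFiniteMeasureOnCompacts μ] {f : α × ℝ → ℝ} {K : Set α} {Y : ℝ} (hf : Continuous f)
    (hK : IsCompact K) (h0 : ∀ z τ, z ∉ K → τ ∈ Ioc 0 Y → f (z, τ) = 0) :
    Integrable f (μ.prod (volume.restrict (Ioc 0 Y))) := by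
  rw [← Measure.restrict_univ (μ := μ), Measure.prod_restrict]
  have h1 : IntegrableOn f (K ×ˢ Icc 0 Y) (μ.prod volume) :=
    hf.continuousOn.integrableOn_compact (hK.prod isCompact_Icc)
  refine h1.of_forall_sdiff_eq_zero (MeasurableSet.univ.prod measurableSet_Ioc) ?_
  rintro ⟨z, τ⟩ ⟨⟨-, hτ⟩, hn⟩
  exact h0 z τ (fun hz => hn ⟨hz, Ioc_subset_Icc_self hτ⟩) hτ

/-- Solving the backward transport equation in the half plane, with an `L¹` bound that does not
depend on the slope `c`. -/
lemma exists_dual_transport {θ : ℝ × ℝ → ℝ} (hs : ContDiff ℝ ∞ θ) (hc : HasCompactSupport θ) :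
    ∃ B : ℝ, 0 ≤ B ∧ ∀ c : ℝ, ∃ Θ : ℝ × ℝ → ℝ, ContDiff ℝ ∞ Θ ∧ HasCompactSupport Θ ∧
      (∀ z ∈ halfPlane, fderiv ℝ Θ z (0, 1) = θ z - c * fderiv ℝ Θ z (1, 0)) ∧
      (∫ s, Θ (s, 0) = -∫ z in halfPlane, θ z) ∧
      ∫ z in halfPlane, |fderiv ℝ Θ z (1, 0)| ≤ B := by
  obtain ⟨Y, hY0, hY⟩ : ∃ Y : ℝ, 0 < Y ∧ ∀ z, Y ≤ z.2 → θ z = 0 := by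
    obtain ⟨R, hR⟩ := hc.isCompact.isBounded.subset_closedBall (0 : ℝ × ℝ)
    refine ⟨|R| + 1, by positivity, fun z hz => ?_⟩
    by_contra h
    have h1 := hR (subset_tsupport _ h)
    rw [mem_closedBall_zero_iff] at h1
    have h2 := (norm_snd_le z).trans h1
    rw [Real.norm_eq_abs] at h2
    linarith [le_abs_self z.2, le_abs_self R]
  set g : ℝ × ℝ → ℝ := fun z => fderiv ℝ θ z (1, 0) with hg
  have hgcont : Continuous g := hs.continuous_fderiv_apply_const _
  have hgc : HasCompactSupport g := hc.fderiv_apply_const _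
  -- The bound is fixed before the slope: the dual solution averages translates of θ over a
  -- parameter interval of length Y, and translation preserves the L¹ norm of ∂_s θ whatever the
  -- direction.
  refine ⟨Y * ∫ z, |g z|, by positivity, fun c => ?_⟩
  set v : ℝ × ℝ := (c, 1) with hv
  have hD : ∀ z, HasFDerivAt (fun z => -∫ τ in (0 : ℝ)..Y, θ (z + τ • v))
      (-∫ τ in (0 : ℝ)..Y, fderiv ℝ θ (z + τ • v)) z := fun z =>
    (hasFDerivAt_lineIntegral (hs.of_le (by norm_cast)) hc v Y z).neg
  have hDv : ∀ z w, fderiv ℝ (fun z => -∫ τ in (0 : ℝ)..Y, θ (z + τ • v)) z w =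
      -∫ τ in (0 : ℝ)..Y, fderiv ℝ θ (z + τ • v) w := by
    intro z w
    rw [(hD z).fderiv]
    rw [_root_.neg_apply, ContinuousLinearMap.intervalIntegral_apply]
    exact ((hs.continuous_fderiv (by simp)).comp (by fun_prop)).intervalIntegrable _ _
  -- Integration along the characteristic direction (c, 1). The derivative in that direction
  -- telescopes to θ(z), because θ vanishes at heights above Y.
  refine ⟨fun z => -∫ τ in (0 : ℝ)..Y, θ (z + τ • v), (contDiff_lineIntegral hs hc v Y).neg,
    (hasCompactSupport_lineIntegral hc v Y).neg, ?_, ?_, ?_⟩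
  · intro z hz
    have h1 : fderiv ℝ (fun z => -∫ τ in (0 : ℝ)..Y, θ (z + τ • v)) z v = θ z := by
      rw [hDv, intervalIntegral.integral_eq_sub_of_hasDerivAt (f := fun τ => θ (z + τ • v))]
      · rw [hY (z + Y • v)]
        · simp
        · have : 0 < z.2 := hz
          simp [hv]; linarith
      · intro τ _
        have h := (hs.differentiable (by simp) (z + τ • v)).hasFDerivAt
        have h2 : HasDerivAt (fun τ : ℝ => z + τ • v) v τ := by
          simpa using ((hasDerivAt_id τ).smul_const v).const_add z
        exact h.comp_hasDerivAt τ h2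
      · exact (((hs.continuous_fderiv (by simp)).comp (by fun_prop)).clm_apply
          continuous_const).intervalIntegrable _ _
    have h2 : v = (0, 1) + c • ((1, 0) : ℝ × ℝ) := by simp [hv]
    rw [h2, map_add, map_smul, ← h2, smul_eq_mul] at h1
    linarith
  · rw [integral_neg]
    congr 1
    have hint : Integrable (fun x : ℝ × ℝ => θ ((x.1, 0) + x.2 • v))
        (volume.prod (volume.restrict (Ioc 0 Y))) := by
      obtain ⟨R, hR⟩ := (hc.isCompact.isBounded).subset_closedBall (0 : ℝ × ℝ)
      refine integrable_prod_Ioc_of_continuous (K := Icc (-(R + |c| * Y)) (R + |c| * Y))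
        (hs.continuous.comp (by fun_prop)) isCompact_Icc ?_
      intro s τ hsK hτ
      by_contra h
      have h1 := hR (subset_tsupport _ h)
      rw [mem_closedBall_zero_iff] at h1
      have h2 := (norm_fst_le _).trans h1
      rw [Real.norm_eq_abs, abs_le] at h2
      simp [hv] at h2
      have h3 : |τ * c| ≤ |c| * Y := by
        rw [abs_mul, mul_comm, abs_of_pos hτ.1]; gcongr; exact hτ.2
      rw [abs_le] at h3
      exact hsK ⟨by linarith, by linarith⟩
    simp_rw [intervalIntegral.integral_of_le hY0.le]
    -- On the axis, the characteristic with parameter τ reaches height τ exactly. Swapping integrals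
    -- and translating each horizontal slice removes the slope and leaves the integral of θ over the
    -- half plane.
    rw [integral_integral_swap (f := fun s τ => θ ((s, 0) + τ • v)) hint,
      setIntegral_halfPlane (hs.continuous.integrable_of_hasCompactSupport hc).integrableOn]
    rw [← Ioc_union_Ioi_eq_Ioi hY0.le, setIntegral_union (by
      rw [Set.disjoint_left]; rintro x ⟨_, h⟩ h'; exact not_lt.2 h h') measurableSet_Ioi,
      setIntegral_eq_zero_of_forall_eq_zero (t := Ioi Y), add_zero]
    · refine integral_congr_ae (Eventually.of_forall fun τ => ?_)
      simp only [hv, Prod.smul_mk, smul_eq_mul, mul_one, Prod.mk_add_mk, zero_add]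
      exact integral_add_right_eq_self (fun s => θ (s, τ)) (τ * c)
    · intro y hy
      simp [hY (_, y) (le_of_lt hy)]
    · have := (hs.continuous.integrable_of_hasCompactSupport (μ := volume.prod volume) hc)
      exact this.integral_prod_right.integrableOn
    · have := (hs.continuous.integrable_of_hasCompactSupport (μ := volume.prod volume) hc)
      exact this.integral_prod_right.integrableOn
  · have hint : Integrable (fun x : (ℝ × ℝ) × ℝ => |g (x.1 + x.2 • v)|)
        (volume.prod (volume.restrict (Ioc 0 Y))) := by
      refine integrable_prod_Ioc_of_continuous
        (K := ((fun x : (ℝ × ℝ) × ℝ => x.1 - x.2 • v) '' (tsupport g ×ˢ Icc 0 Y)))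
        (hgcont.abs.comp (by fun_prop)) ((hgc.isCompact.prod isCompact_Icc).image (by fun_prop)) ?_
      intro z τ hz hτ
      by_contra h
      exact hz ⟨(z + τ • v, τ), ⟨subset_tsupport _ (by simpa using h), Ioc_subset_Icc_self hτ⟩,
        by simp⟩
    calc ∫ z in halfPlane, |fderiv ℝ (fun z => -∫ τ in (0 : ℝ)..Y, θ (z + τ • v)) z (1, 0)|
        ≤ ∫ z, |fderiv ℝ (fun z => -∫ τ in (0 : ℝ)..Y, θ (z + τ • v)) z (1, 0)| := by
          refine setIntegral_le_integral ?_ (Eventually.of_forall fun _ => abs_nonneg _)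
          have h1 := (contDiff_lineIntegral hs hc v Y).neg
          have h2 := (hasCompactSupport_lineIntegral hc v Y).neg
          exact ((h1.continuous_fderiv_apply_const _).integrable_of_hasCompactSupport
            (h2.fderiv_apply_const _)).abs
      _ ≤ ∫ z, ∫ τ in Ioc 0 Y, |g (z + τ • v)| := by
          refine integral_mono_of_nonneg (Eventually.of_forall fun _ => abs_nonneg _)
            hint.integral_prod_left (Eventually.of_forall fun z => ?_)
          simp only [hDv, abs_neg]
          rw [intervalIntegral.integral_of_le hY0.le]
          exact abs_integral_le_integral_abs
      _ = ∫ τ in Ioc 0 Y, ∫ z, |g (z + τ • v)| := integral_integral_swap hint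
      _ = ∫ τ in Ioc 0 Y, ∫ z, |g z| := by
          refine integral_congr_ae (Eventually.of_forall fun τ => ?_)
          exact integral_add_right_eq_self (fun z => |g z|) (τ • v)
      _ = Y * ∫ z, |g z| := by simp [hY0.le]

/-! ### Decomposing polynomials into nearly linear entropy fluxes. -/

open Polynomial in
lemma Polynomial.exists_primitive (b : ℝ[X]) : ∃ P : ℝ[X], derivative P = b ∧ P.eval 0 = 0 := by
  induction b using Polynomial.induction_on' with
  | add p q hp hq =>
    obtain ⟨P, hP, hP0⟩ := hp
    obtain ⟨Q, hQ, hQ0⟩ := hq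
    exact ⟨P + Q, by simp [hP, hQ], by simp [hP0, hQ0]⟩
  | monomial n a =>
    refine ⟨monomial (n + 1) (a / (n + 1)), ?_, by simp⟩
    rw [derivative_monomial]
    congr 1
    push_cast
    field_simp

open Polynomial in
lemma Polynomial.abs_eval_sub_eval_zero_le (P : ℝ[X]) {g : ℝ → ℝ} (hg : Continuous g)
    (h : ∀ k ∈ Icc (0 : ℝ) 1, |(derivative P).eval k| ≤ g k) {w : ℝ} (hw : w ∈ Icc (0 : ℝ) 1) :
    |P.eval w - P.eval 0| ≤ ∫ k in (0 : ℝ)..1, g k := by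
  have h1 : P.eval w - P.eval 0 = ∫ k in (0 : ℝ)..w, (derivative P).eval k := by
    rw [intervalIntegral.integral_eq_sub_of_hasDerivAt (f := fun k => P.eval k)]
    · exact fun k _ => P.hasDerivAt k
    · exact (derivative P).continuous.intervalIntegrable _ _
  rw [h1]
  have hg0 : ∀ k ∈ Icc (0 : ℝ) 1, 0 ≤ g k := fun k hk => (abs_nonneg _).trans (h k hk)
  calc |∫ k in (0 : ℝ)..w, (derivative P).eval k|
      ≤ ∫ k in (0 : ℝ)..w, |(derivative P).eval k| :=
        intervalIntegral.abs_integral_le_integral_abs hw.1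
    _ ≤ ∫ k in (0 : ℝ)..w, g k := by
        refine intervalIntegral.integral_mono_on hw.1 ?_ (hg.intervalIntegrable _ _) ?_
        · exact (derivative P).continuous.abs.intervalIntegrable _ _
        · exact fun k hk => h k ⟨hk.1, hk.2.trans hw.2⟩
    _ ≤ ∫ k in (0 : ℝ)..1, g k := by
        rw [← intervalIntegral.integral_add_adjacent_intervals (b := w) (c := 1)
          (hg.intervalIntegrable _ _) (hg.intervalIntegrable _ _)]
        have := intervalIntegral.integral_nonneg (f := g) (μ := volume) hw.2
          (fun k hk => hg0 k ⟨hw.1.trans hk.1, hk.2⟩)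
        linarith

/-- Dominated convergence: the integrand is at most 1 and tends to 0 except at k = 1/2, the only
state of zero characteristic speed. This is why the degeneracy of the flux there costs nothing in
the uniform norm after integration. -/
lemma exists_regularization_small {η : ℝ} (hη : 0 < η) :
    ∃ κ : ℝ, 0 < κ ∧ ∫ k in (0 : ℝ)..1, κ / ((1 - 2 * k) ^ 2 + κ) ≤ η := by
  have h : Tendsto (fun n : ℕ => ∫ k in (0 : ℝ)..1,
      (1 / ((n : ℝ) + 1)) / ((1 - 2 * k) ^ 2 + 1 / ((n : ℝ) + 1))) atTop
      (𝓝 (∫ k in (0 : ℝ)..1, (0 : ℝ))) := by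
    refine intervalIntegral.tendsto_integral_filter_of_dominated_convergence (fun _ => 1) ?_ ?_
      intervalIntegrable_const ?_
    · refine Eventually.of_forall fun n => Measurable.aestronglyMeasurable ?_
      fun_prop
    · refine Eventually.of_forall fun n => Eventually.of_forall fun k _ => ?_
      have : (0 : ℝ) < 1 / ((n : ℝ) + 1) := by positivity
      rw [Real.norm_eq_abs, abs_of_nonneg (by positivity), div_le_one (by positivity)]
      nlinarith [sq_nonneg (1 - 2 * k)]
    · have h0 : ∀ᵐ k : ℝ, k ≠ 1 / 2 := by simp [ae_iff]
      filter_upwards [h0] with k hk _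
      have h1 : Tendsto (fun n : ℕ => 1 / ((n : ℝ) + 1)) atTop (𝓝 0) :=
        tendsto_one_div_add_atTop_nhds_zero_nat
      have h2 : (1 - 2 * k) ^ 2 + 0 ≠ 0 := by
        have : 1 - 2 * k ≠ 0 := fun h => hk (by linarith)
        positivity
      have h3 := h1.div (h1.const_add ((1 - 2 * k) ^ 2)) h2
      rw [zero_div] at h3
      exact h3
  rw [intervalIntegral.integral_zero] at h
  obtain ⟨n, hn⟩ := (h.eventually_lt_const hη).exists
  exact ⟨1 / ((n : ℝ) + 1), by positivity, hn.le⟩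

open Polynomial unitInterval in
/-- Every polynomial is, up to a constant and a small uniform error on `[0,1]`, a sum of entropy
fluxes `Q j` each of which is nearly proportional to its entropy `F j`. -/
lemma exists_flux_decomposition (h : ℝ[X]) {η : ℝ} (hη : 0 < η) :
    ∃ (m : ℕ) (F Q : Fin m → ℝ[X]) (c δ : Fin m → ℝ),
      (∀ j, derivative (Q j) = (1 - 2 * X) * derivative (F j)) ∧
      (∀ w ∈ Icc (0 : ℝ) 1, |h.eval w - h.eval 0 - ∑ j, (Q j).eval w| ≤ η) ∧
      (∀ j, ∀ w ∈ Icc (0 : ℝ) 1, |(F j).eval w - c j * (Q j).eval w| ≤ δ j) ∧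
      ∑ j, δ j ≤ η := by
  obtain ⟨M, hM0, hM⟩ : ∃ M : ℝ, 0 < M ∧ ∀ k ∈ Icc (0 : ℝ) 1, |(derivative h).eval k| ≤ M := by
    obtain ⟨M, hM⟩ := isCompact_Icc.exists_bound_of_continuousOn
      (s := Icc (0 : ℝ) 1) (derivative h).continuous.continuousOn
    exact ⟨|M| + 1, by positivity, fun k hk => (hM k hk).trans (by linarith [le_abs_self M])⟩
  obtain ⟨κ, hκ0, hκ⟩ := exists_regularization_small (η := η / 2 / M) (by positivity)
  -- A regularised quotient h'/(1-2k): multiplying it back by 1 - 2k recovers h' up to the error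
  -- h'κ/((1-2k)²+κ), whose integral is small.
  set β : ℝ → ℝ := fun k => (derivative h).eval k * (1 - 2 * k) / ((1 - 2 * k) ^ 2 + κ) with hβ
  have hden : ∀ k : ℝ, (1 - 2 * k) ^ 2 + κ ≠ 0 := fun k => by positivity
  have hβc : Continuous β :=
    ((derivative h).continuous.mul (by fun_prop)).div (by fun_prop) hden
  set βc : C(I, ℝ) := ⟨fun k => β k, by fun_prop⟩ with hβcdef
  -- Chosen so that (2M/κ)(2τ) = η in the last estimate.
  set τ : ℝ := η * κ / (4 * M) with hτ
  have hτ0 : 0 < τ := by positivity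
  obtain ⟨N, hN0, hNapp, hNτ⟩ : ∃ N : ℕ, N ≠ 0 ∧
      ‖bernsteinApproximation N βc - βc‖ < η / 2 ∧ 1 / (N : ℝ) ≤ τ ^ 2 := by
    have h1 := (tendsto_iff_norm_sub_tendsto_zero.1 (bernsteinApproximation_uniform βc))
    have h2 : Tendsto (fun n : ℕ => 1 / (n : ℝ)) atTop (𝓝 0) :=
      tendsto_one_div_atTop_nhds_zero_nat
    obtain ⟨N, hN⟩ := ((eventually_ne_atTop 0).and
      ((h1.eventually_lt_const (half_pos hη)).and
        (h2.eventually_le_const (pow_pos hτ0 2)))).exists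
    exact ⟨N, hN.1, hN.2.1, hN.2.2⟩
  set zj : Fin (N + 1) → ℝ := fun j => (bernstein.z j : ℝ) with hzj
  set b : Fin (N + 1) → ℝ[X] := fun j => bernsteinPolynomial ℝ N j with hb
  have hbev : ∀ j (k : I), (b j).eval (k : ℝ) = bernstein N j k := fun j k => rfl
  have hb0 : ∀ j, ∀ k ∈ Icc (0 : ℝ) 1, 0 ≤ (b j).eval k := fun j k hk => by
    rw [hbev j ⟨k, hk⟩]; exact bernstein_nonneg
  choose F hF hF0 using fun j => Polynomial.exists_primitive (C (β (zj j)) * b j)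
  choose Q hQ hQ0 using fun j => Polynomial.exists_primitive ((1 - 2 * X) * (C (β (zj j)) * b j))
  -- F_j' = β(z_j) b_j concentrates near the Bernstein node z_j, where F_j' and Q_j' differ by the
  -- factor 1 - 2z_j. At a node equal to 1/2 the slope is 0 by convention, which is harmless since β
  -- vanishes there.
  refine ⟨N + 1, F, Q, fun j => 1 / (1 - 2 * zj j),
    fun j => ∫ k in (0 : ℝ)..1, 2 * M / κ * (|k - zj j| * (b j).eval k), ?_, ?_, ?_, ?_⟩
  · intro j; rw [hQ, hF]
  · intro w hw
    have hP := Polynomial.abs_eval_sub_eval_zero_le (h - ∑ j, Q j)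
      (g := fun k => M * (κ / ((1 - 2 * k) ^ 2 + κ)) + η / 2) (by
        refine (continuous_const.mul (continuous_const.div (by fun_prop) hden)).add
          continuous_const) ?_ hw
    · have e1 : (h - ∑ j, Q j).eval w - (h - ∑ j, Q j).eval 0 =
          h.eval w - h.eval 0 - ∑ j, (Q j).eval w := by
        simp [eval_finsetSum, hQ0]; ring
      rw [e1] at hP
      refine hP.trans ?_
      rw [intervalIntegral.integral_add, intervalIntegral.integral_const_mul]
      · have := mul_le_mul_of_nonneg_left hκ hM0.le
        have e : M * (η / 2 / M) = η / 2 := by field_simp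
        simp only [intervalIntegral.integral_const, sub_zero, smul_eq_mul, one_mul]
        linarith
      · exact (continuous_const.mul (continuous_const.div (by fun_prop) hden)).intervalIntegrable
          _ _
      · exact intervalIntegrable_const
    · intro k hk
      have hB := (ContinuousMap.norm_coe_le_norm (bernsteinApproximation N βc - βc) ⟨k, hk⟩).trans
        hNapp.le
      rw [ContinuousMap.sub_apply, bernsteinApproximation.apply, Real.norm_eq_abs] at hB
      have e2 : (derivative (h - ∑ j, Q j)).eval k =
          (derivative h).eval k * (κ / ((1 - 2 * k) ^ 2 + κ)) -
          (1 - 2 * k) * (∑ j : Fin (N + 1), bernstein N j ⟨k, hk⟩ • βc (bernstein.z j) - βc ⟨k, hk⟩) := by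
        have : (1 - 2 * k) * βc ⟨k, hk⟩ = (derivative h).eval k -
            (derivative h).eval k * (κ / ((1 - 2 * k) ^ 2 + κ)) := by
          simp only [hβcdef, hβ, ContinuousMap.coe_mk]
          have := hden k
          field_simp
          ring
        rw [mul_sub, this]
        simp only [derivative_sub, derivative_sum, hQ, eval_sub, eval_finsetSum, eval_mul, eval_C,
          eval_one, eval_ofNat, eval_X, Finset.mul_sum, smul_eq_mul]
        have : ∀ j : Fin (N + 1), (1 - 2 * k) * (β (zj j) * (b j).eval k) =
            (1 - 2 * k) * (bernstein N j ⟨k, hk⟩ * βc (bernstein.z j)) := fun j => by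
          rw [← hbev j ⟨k, hk⟩]
          simp only [hβcdef, ContinuousMap.coe_mk, hzj]; ring
        simp_rw [this]
        ring
      rw [e2]
      refine (abs_sub _ _).trans (add_le_add ?_ ?_)
      · rw [abs_mul, abs_of_nonneg (a := κ / ((1 - 2 * k) ^ 2 + κ)) (by positivity)]
        exact mul_le_mul_of_nonneg_right (hM k hk) (by positivity)
      · rw [abs_mul]
        have : |1 - 2 * k| ≤ 1 := by rw [abs_le]; constructor <;> linarith [hk.1, hk.2]
        calc _ ≤ 1 * (η / 2) := mul_le_mul this hB (abs_nonneg _) zero_le_one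
          _ = _ := one_mul _
  · intro j w hw
    have hP := Polynomial.abs_eval_sub_eval_zero_le (F j - C (1 / (1 - 2 * zj j)) * Q j)
      (g := fun k => 2 * M / κ * (|k - zj j| * (b j).eval k)) (by
        have := (b j).continuous
        fun_prop) ?_ hw
    · simpa [hF0, hQ0] using hP
    · intro k hk
      have e1 : (derivative (F j - C (1 / (1 - 2 * zj j)) * Q j)).eval k =
          β (zj j) * (1 - (1 - 2 * k) / (1 - 2 * zj j)) * (b j).eval k := by
        simp [hF, hQ]; ring
      rw [e1, abs_mul, abs_of_nonneg (hb0 j k hk), ← mul_assoc]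
      refine mul_le_mul_of_nonneg_right ?_ (hb0 j k hk)
      by_cases ha : 1 - 2 * zj j = 0
      · have : β (zj j) = 0 := by simp [hβ, ha]
        rw [this, zero_mul, abs_zero]; positivity
      · have e2 : β (zj j) * (1 - (1 - 2 * k) / (1 - 2 * zj j)) =
            (derivative h).eval (zj j) / ((1 - 2 * zj j) ^ 2 + κ) * (2 * (k - zj j)) := by
          simp only [hβ]
          have := hden (zj j)
          field_simp
          ring
        rw [e2, abs_mul, abs_div, abs_mul, abs_two, abs_of_nonneg (a := _ + κ) (by positivity)]
        have h1 : |(derivative h).eval (zj j)| / ((1 - 2 * zj j) ^ 2 + κ) ≤ M / κ := by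
          gcongr
          · exact hM _ (bernstein.z j).2
          · nlinarith [sq_nonneg (1 - 2 * zj j)]
        calc _ ≤ M / κ * (2 * |k - zj j|) := by gcongr
          _ = _ := by ring
  · have hcont : ∀ j, Continuous fun k : ℝ => 2 * M / κ * (|k - zj j| * (b j).eval k) := fun j => by
      have := (b j).continuous
      fun_prop
    rw [← intervalIntegral.integral_finsetSum fun j _ => (hcont j).intervalIntegrable _ _]
    have hpt : ∀ k ∈ Icc (0 : ℝ) 1, ∑ j, 2 * M / κ * (|k - zj j| * (b j).eval k) ≤ η := by
      intro k hk
      have hvar := bernstein.variance hN0 ⟨k, hk⟩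
      have hprob := bernstein.probability N ⟨k, hk⟩
      have hsum : ∑ j, |k - zj j| * (b j).eval k ≤ 2 * τ := by
        -- The first absolute moment of the Bernstein weights is bounded through their variance
        -- k(1-k)/N ≤ τ², using |a| ≤ τ + a²/τ.
        have h1 : ∀ j, |k - zj j| * (b j).eval k ≤
            τ * bernstein N j ⟨k, hk⟩ + 1 / τ * ((k - zj j) ^ 2 * bernstein N j ⟨k, hk⟩) := by
          intro j
          rw [hbev j ⟨k, hk⟩]
          have h0 : 0 ≤ bernstein N j ⟨k, hk⟩ := bernstein_nonneg
          have : |k - zj j| ≤ τ + 1 / τ * (k - zj j) ^ 2 := by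
            rw [← sq_abs (k - zj j)]
            have : 0 ≤ (1 / τ) * ((|k - zj j| - τ / 2) ^ 2 + 3 / 4 * τ ^ 2) := by positivity
            have e : (1 / τ) * ((|k - zj j| - τ / 2) ^ 2 + 3 / 4 * τ ^ 2) =
                τ + 1 / τ * |k - zj j| ^ 2 - |k - zj j| := by field_simp; ring
            linarith
          calc _ ≤ (τ + 1 / τ * (k - zj j) ^ 2) * bernstein N j ⟨k, hk⟩ := by gcongr
            _ = _ := by ring
        refine (Finset.sum_le_sum fun j _ => h1 j).trans ?_
        rw [Finset.sum_add_distrib, ← Finset.mul_sum, ← Finset.mul_sum, hprob]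
        have hv2 : ∑ j : Fin (N + 1), (k - zj j) ^ 2 * bernstein N j ⟨k, hk⟩ = k * (1 - k) / N :=
          hvar
        rw [hv2]
        have h3 : k * (1 - k) / N ≤ τ ^ 2 := by
          refine le_trans ?_ hNτ
          gcongr
          nlinarith [hk.1, hk.2]
        have h4 : 1 / τ * (k * (1 - k) / N) ≤ 1 / τ * τ ^ 2 := by gcongr
        have h5 : 1 / τ * τ ^ 2 = τ := by field_simp
        linarith
      rw [← Finset.mul_sum]
      calc _ ≤ 2 * M / κ * (2 * τ) := by gcongr
        _ = η := by rw [hτ]; field_simp; ring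
    calc _ ≤ ∫ k in (0 : ℝ)..1, η := by
          refine intervalIntegral.integral_mono_on zero_le_one ?_ intervalIntegrable_const hpt
          exact (continuous_finsetSum _ fun j _ => hcont j).intervalIntegrable _ _
      _ = η := by simp

/-! ### Blow-up sequences and the constancy of their Young measure. -/

open Polynomial in
/-- A sequence of functions on the half plane obtained by zooming in at a boundary point at which
the entropy dissipation vanishes and the weak boundary traces of all the moments have Lebesgue
points. The linear functional `q` gives the values of these traces, and `j n` is the boundary trace
of the flux `U n * (1 - U n)`. -/
structure IsBlowUp (p : ℝ) (U : ℕ → ℝ × ℝ → ℝ) (j : ℕ → ℝ → ℝ) (q : ℝ[X] →ₗ[ℝ] ℝ) : Prop where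
  measurable : ∀ n, Measurable (U n)
  mem_Icc : ∀ n z, U n z ∈ Icc (0 : ℝ) 1
  measurable_flux : ∀ n, Measurable (j n)
  abs_flux_le : ∀ n s, |j n s| ≤ 1
  map_one : q 1 = 1
  abs_map_le : ∀ (h : ℝ[X]) (M : ℝ), (∀ w ∈ Icc (0 : ℝ) 1, |h.eval w| ≤ M) → |q h| ≤ M
  tendsto_flux : ∀ R : ℝ,
    Tendsto (fun n => ∫ s in Icc (-R) R, |j n s - q (X - X ^ 2)|) atTop (𝓝 0)
  transport : ∀ F Q : ℝ[X], derivative Q = (1 - 2 * X) * derivative F →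
    ∀ θ : ℝ × ℝ → ℝ, ContDiff ℝ ∞ θ → HasCompactSupport θ →
      Tendsto (fun n => ∫ z in halfPlane, (F.eval (U n z) * fderiv ℝ θ z (1, 0) +
        p * (Q.eval (U n z) * fderiv ℝ θ z (0, 1)))) atTop (𝓝 (-(p * (q Q * ∫ s, θ (s, 0)))))
  conservation : ∀ K : Set (ℝ × ℝ), IsCompact K → ∀ᶠ n in atTop,
    ∀ θ : ℝ × ℝ → ℝ, ContDiff ℝ ∞ θ → HasCompactSupport θ → tsupport θ ⊆ K →
      ∫ z in halfPlane, (U n z * fderiv ℝ θ z (1, 0) +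
        p * ((U n z - U n z ^ 2) * fderiv ℝ θ z (0, 1))) = -(p * ∫ s, j n s * θ (s, 0))
  entropy : ∀ K : Set (ℝ × ℝ), IsCompact K → K ⊆ halfPlane → ∀ᶠ n in atTop,
    ∀ θ : ℝ × ℝ → ℝ, ContDiff ℝ ∞ θ → HasCompactSupport θ → tsupport θ ⊆ K → (∀ z, 0 ≤ θ z) →
      0 ≤ ∫ z in halfPlane, (U n z ^ 2 * fderiv ℝ θ z (1, 0) +
        p * ((U n z ^ 2 - 4 / 3 * U n z ^ 3) * fderiv ℝ θ z (0, 1)))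

open Polynomial in
lemma Polynomial.exists_abs_eval_le (h : ℝ[X]) :
    ∃ M : ℝ, 0 ≤ M ∧ ∀ w ∈ Icc (0 : ℝ) 1, |h.eval w| ≤ M := by
  obtain ⟨M, hM⟩ := isCompact_Icc.exists_bound_of_continuousOn
    (s := Icc (0 : ℝ) 1) h.continuous.continuousOn
  exact ⟨|M|, abs_nonneg M, fun k hk => (hM k hk).trans (le_abs_self M)⟩

open Polynomial in
lemma Polynomial.integrable_eval_mul {μ : Measure (ℝ × ℝ)} [IsFiniteMeasureOnCompacts μ]
    (h : ℝ[X]) {u : ℝ × ℝ → ℝ} (hu : Measurable u)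
    (hu01 : ∀ z, u z ∈ Icc (0 : ℝ) 1) {g : ℝ × ℝ → ℝ} (hg : Continuous g)
    (hgc : HasCompactSupport g) : Integrable (fun z => h.eval (u z) * g z) μ := by
  obtain ⟨M, -, hM⟩ := h.exists_abs_eval_le
  exact integrable_bdd_mul (h.continuous.measurable.comp hu).aestronglyMeasurable
    (fun z => hM _ (hu01 z)) hg hgc

lemma abs_setIntegral_mul_le {s : Set (ℝ × ℝ)} {f g : ℝ × ℝ → ℝ} {M : ℝ}
    (hM : ∀ z, |f z| ≤ M) (hg : IntegrableOn g s) :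
    |∫ z in s, f z * g z| ≤ M * ∫ z in s, |g z| := by
  rw [← integral_const_mul]
  refine abs_integral_le_integral_abs.trans (integral_mono_of_nonneg
    (Eventually.of_forall fun _ => abs_nonneg _) (hg.abs.const_mul M)
    (Eventually.of_forall fun z => ?_))
  simp only [abs_mul]
  exact mul_le_mul_of_nonneg_right (hM z) (abs_nonneg _)

lemma eventually_abs_sub_le {ι : Type*} {l : Filter ι} {f : ι → ℝ} {a ε : ℝ}
    (h : Tendsto f l (𝓝 a)) (hε : 0 < ε) : ∀ᶠ i in l, |f i - a| ≤ ε :=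
  (Metric.tendsto_nhds.1 h ε hε).mono fun i hi => by rw [Real.dist_eq] at hi; exact hi.le

namespace IsBlowUp

open Polynomial

variable {p : ℝ} {U : ℕ → ℝ × ℝ → ℝ} {j : ℕ → ℝ → ℝ} {q : ℝ[X] →ₗ[ℝ] ℝ}

/-- Test the limiting transport relation with the dual solution Θ. Inserting the equation for ∂_y Θ
turns the flux term into p∫Qθ and leaves F - cQ against ∂_s Θ. That remainder is at most δB, with B
independent of the slope. -/
lemma eventually_flux_error (H : IsBlowUp p U j q) (hp : 0 < p) {F Q : ℝ[X]} {c δ B : ℝ}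
    (hFQ : derivative Q = (1 - 2 * X) * derivative F) {θ Θ : ℝ × ℝ → ℝ}
    (hθ : ContDiff ℝ ∞ θ) (hθc : HasCompactSupport θ)
    (hδ : ∀ w ∈ Icc (0 : ℝ) 1, |F.eval w - c * Q.eval w| ≤ δ)
    (hΘ : ContDiff ℝ ∞ Θ) (hΘc : HasCompactSupport Θ)
    (hΘeq : ∀ z ∈ halfPlane, fderiv ℝ Θ z (0, 1) = θ z - c / p * fderiv ℝ Θ z (1, 0))
    (hΘ0 : ∫ s, Θ (s, 0) = -∫ z in halfPlane, θ z)
    (hB : ∫ z in halfPlane, |fderiv ℝ Θ z (1, 0)| ≤ B) {ε : ℝ} (hε : 0 < ε) :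
    ∀ᶠ n in atTop, |(∫ z in halfPlane, Q.eval (U n z) * θ z) - q Q * ∫ z in halfPlane, θ z| ≤
      ε + 1 / p * (δ * B) := by
  have hδ0 : 0 ≤ δ := (abs_nonneg _).trans (hδ 0 (by simp))
  have ht := H.transport F Q hFQ Θ hΘ hΘc
  filter_upwards [eventually_abs_sub_le ht (ε := p * ε) (by positivity)] with n hn
  have hi1 : IntegrableOn (fun z => Q.eval (U n z) * θ z) halfPlane :=
    Q.integrable_eval_mul (H.measurable n) (H.mem_Icc n) hθ.continuous hθc
  have hi2 : IntegrableOn (fun z => (F - C c * Q).eval (U n z) * fderiv ℝ Θ z (1, 0)) halfPlane :=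
    (F - C c * Q).integrable_eval_mul (H.measurable n) (H.mem_Icc n)
      (hΘ.continuous_fderiv_apply_const _) (hΘc.fderiv_apply_const _)
  have e : ∫ z in halfPlane, (F.eval (U n z) * fderiv ℝ Θ z (1, 0) +
      p * (Q.eval (U n z) * fderiv ℝ Θ z (0, 1))) =
      p * (∫ z in halfPlane, Q.eval (U n z) * θ z) +
        ∫ z in halfPlane, (F - C c * Q).eval (U n z) * fderiv ℝ Θ z (1, 0) := by
    rw [← integral_const_mul, ← integral_add (hi1.const_mul p) hi2]
    refine setIntegral_congr_fun measurableSet_halfPlane fun z hz => ?_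
    simp only [hΘeq z hz, eval_sub, eval_mul, eval_C]
    field_simp
    ring
  have h2 : |∫ z in halfPlane, (F - C c * Q).eval (U n z) * fderiv ℝ Θ z (1, 0)| ≤ δ * B := by
    refine (abs_setIntegral_mul_le (M := δ) (fun z => ?_) ?_).trans
      (mul_le_mul_of_nonneg_left hB hδ0)
    · simpa using hδ _ (H.mem_Icc n z)
    · exact ((hΘ.continuous_fderiv_apply_const _).integrable_of_hasCompactSupport
        (hΘc.fderiv_apply_const _)).integrableOn
  rw [e, hΘ0] at hn
  set A := ∫ z in halfPlane, Q.eval (U n z) * θ z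
  set D := ∫ z in halfPlane, (F - C c * Q).eval (U n z) * fderiv ℝ Θ z (1, 0)
  set I0 := ∫ z in halfPlane, θ z
  have h3 : p * |A - q Q * I0| ≤ p * ε + δ * B := by
    rw [← abs_of_pos hp, ← abs_mul, abs_of_pos hp]
    have : p * (A - q Q * I0) = (p * A + D - -(p * (q Q * -I0))) - D := by ring
    rw [this]
    exact (abs_sub _ _).trans (add_le_add hn h2)
  have h4 : |A - q Q * I0| ≤ (p * ε + δ * B) / p := by rw [le_div_iff₀ hp]; linarith
  refine h4.trans (le_of_eq ?_)
  field_simp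

/-- The blow-up sequence converges, as a Young measure, to the constant one given by `q`. -/
theorem tendsto_integral_eval (H : IsBlowUp p U j q) (hp : 0 < p) (h : ℝ[X]) {θ : ℝ × ℝ → ℝ}
    (hθ : ContDiff ℝ ∞ θ) (hθc : HasCompactSupport θ) :
    Tendsto (fun n => ∫ z in halfPlane, h.eval (U n z) * θ z) atTop
      (𝓝 (q h * ∫ z in halfPlane, θ z)) := by
  obtain ⟨B, hB0, hB⟩ := exists_dual_transport hθ hθc
  set A := ∫ z in halfPlane, |θ z| with hA
  have hA0 : 0 ≤ A := integral_nonneg fun _ => abs_nonneg _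
  rw [Metric.tendsto_nhds]
  intro ε hε
  -- The denominator collects the three errors: the polynomial remainder P, its image under q, and
  -- the sum of the transport errors. Each of the m fluxes receives the share η/(m+1).
  set η := ε / (2 * A + 1 + 1 / p * B + 1) with hη
  have hη0 : 0 < η := by positivity
  obtain ⟨m, F, Q, c, δ, hFQ, happ, hδ, hδsum⟩ := exists_flux_decomposition h hη0
  have hev : ∀ i ∈ (Finset.univ : Finset (Fin m)), ∀ᶠ n in atTop,
      |(∫ z in halfPlane, (Q i).eval (U n z) * θ z) - q (Q i) * ∫ z in halfPlane, θ z| ≤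
      η / (m + 1) + 1 / p * (δ i * B) := by
    intro i _
    obtain ⟨Θ, h1, h2, h3, h4, h5⟩ := hB (c i / p)
    exact H.eventually_flux_error hp (hFQ i) hθ hθc (hδ i) h1 h2 h3 h4 h5 (by positivity)
  filter_upwards [(Filter.eventually_all_finset _).2 hev] with n hn
  set P : ℝ[X] := h - C (h.eval 0) - ∑ i, Q i with hP
  have hPle : ∀ w ∈ Icc (0 : ℝ) 1, |P.eval w| ≤ η := by
    intro w hw
    simpa [hP, eval_finsetSum] using happ w hw
  have hqP : |q P| ≤ η := H.abs_map_le P η hPle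
  have hint : ∀ R : ℝ[X], IntegrableOn (fun z => R.eval (U n z) * θ z) halfPlane := fun R =>
    R.integrable_eval_mul (H.measurable n) (H.mem_Icc n) hθ.continuous hθc
  have e1 : ∫ z in halfPlane, h.eval (U n z) * θ z =
      (∫ z in halfPlane, P.eval (U n z) * θ z) + h.eval 0 * (∫ z in halfPlane, θ z) +
        ∑ i, ∫ z in halfPlane, (Q i).eval (U n z) * θ z := by
    rw [← integral_finsetSum _ fun i _ => hint (Q i), ← integral_const_mul, ← integral_add,
      ← integral_add]
    · refine integral_congr_ae (Eventually.of_forall fun z => ?_)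
      simp only [hP, eval_sub, eval_C, eval_finsetSum, Finset.sum_mul, sub_mul]
      ring
    · exact (hint P).add (by simpa using hint (C (h.eval 0)))
    · exact integrable_finsetSum _ fun i _ => hint (Q i)
    · exact hint P
    · have := hint (C (h.eval 0))
      simp only [eval_C] at this
      exact this
  -- The same decomposition is applied to the functional, so the two sides can be compared flux by
  -- flux; the constant term cancels because q(1) = 1.
  have e2 : q h = q P + h.eval 0 + ∑ i, q (Q i) := by
    have : h = P + h.eval 0 • (1 : ℝ[X]) + ∑ i, Q i := by
      rw [hP, smul_eq_C_mul, mul_one]; ring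
    conv_lhs => rw [this]
    rw [map_add, map_add, map_smul, H.map_one, map_sum, smul_eq_mul, mul_one]
  rw [Real.dist_eq, e1, e2]
  set I0 := ∫ z in halfPlane, θ z with hI0
  have hI0A : |I0| ≤ A := abs_integral_le_integral_abs
  have e3 : (∫ z in halfPlane, P.eval (U n z) * θ z) + h.eval 0 * I0 +
      ∑ i, (∫ z in halfPlane, (Q i).eval (U n z) * θ z) -
      (q P + h.eval 0 + ∑ i, q (Q i)) * I0 =
      (∫ z in halfPlane, P.eval (U n z) * θ z) - q P * I0 +
      ∑ i, ((∫ z in halfPlane, (Q i).eval (U n z) * θ z) - q (Q i) * I0) := by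
    rw [Finset.sum_sub_distrib, ← Finset.sum_mul]; ring
  rw [e3]
  have b1 : |∫ z in halfPlane, P.eval (U n z) * θ z| ≤ η * A :=
    abs_setIntegral_mul_le (fun z => hPle _ (H.mem_Icc n z))
      (hθ.continuous.integrable_of_hasCompactSupport hθc).integrableOn
  have b2 : |q P * I0| ≤ η * A := by rw [abs_mul]; gcongr
  have b3 : |∑ i, ((∫ z in halfPlane, (Q i).eval (U n z) * θ z) - q (Q i) * I0)| ≤
      η + 1 / p * (η * B) := by
    refine (Finset.abs_sum_le_sum_abs _ _).trans
      ((Finset.sum_le_sum fun i hi => hn i hi).trans ?_)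
    rw [Finset.sum_add_distrib, ← Finset.mul_sum, ← Finset.sum_mul]
    have : (∑ _i : Fin m, η / ((m : ℝ) + 1)) ≤ η := by
      rw [Finset.sum_const, Finset.card_univ, Fintype.card_fin, nsmul_eq_mul, mul_div_assoc',
        div_le_iff₀ (by positivity)]
      nlinarith
    gcongr
  have b4 := abs_add_le ((∫ z in halfPlane, P.eval (U n z) * θ z) - q P * I0)
    (∑ i, ((∫ z in halfPlane, (Q i).eval (U n z) * θ z) - q (Q i) * I0))
  have b5 := abs_sub (∫ z in halfPlane, P.eval (U n z) * θ z) (q P * I0)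
  have b6 : η * (2 * A + 1 + 1 / p * B + 1) = ε := by rw [hη]; field_simp
  have b7 : 1 / p * (η * B) = η * (1 / p * B) := by ring
  nlinarith

end IsBlowUp

/-! ### Vertical primitives, mollification and weak derivatives. -/

/-- The vertical primitive of `α`, vanishing on and below the axis `y = 0`. -/
noncomputable def verticalPrimitive (α : ℝ × ℝ → ℝ) (z : ℝ × ℝ) : ℝ :=
  ∫ ξ in Ioc 0 z.2, α (z.1, ξ)

lemma measurable_verticalPrimitive {α : ℝ × ℝ → ℝ} (hα : Measurable α) :
    Measurable (verticalPrimitive α) := by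
  have h : verticalPrimitive α = fun z => ∫ ξ, {x : (ℝ × ℝ) × ℝ | x.2 ∈ Ioc 0 x.1.2}.indicator
      (fun x => α (x.1.1, x.2)) (z, ξ) := by
    funext z
    rw [verticalPrimitive, ← integral_indicator measurableSet_Ioc]
    rfl
  rw [h]
  have hS : MeasurableSet {x : (ℝ × ℝ) × ℝ | x.2 ∈ Ioc 0 x.1.2} :=
    (measurableSet_lt measurable_const measurable_snd).inter
      (measurableSet_le measurable_snd (measurable_snd.comp measurable_fst))
  have hm : Measurable ({x : (ℝ × ℝ) × ℝ | x.2 ∈ Ioc 0 x.1.2}.indicator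
      (fun x => α (x.1.1, x.2))) :=
    (hα.comp ((measurable_fst.comp measurable_fst).prodMk measurable_snd)).indicator hS
  exact (hm.stronglyMeasurable.integral_prod_right').measurable

lemma abs_verticalPrimitive_le {α : ℝ × ℝ → ℝ} (hα1 : ∀ z, |α z| ≤ 1) (z : ℝ × ℝ) :
    |verticalPrimitive α z| ≤ |z.2| := by
  have h := norm_setIntegral_le_of_norm_le_const (μ := volume) (s := Ioc 0 z.2)
    (f := fun ξ => α (z.1, ξ)) (C := 1) (by simp) (fun ξ _ => hα1 _)
  refine (Real.norm_eq_abs (verticalPrimitive α z) ▸ h).trans ?_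
  simp only [measureReal_def, Real.volume_Ioc, sub_zero, one_mul]
  rcases le_total 0 z.2 with h0 | h0
  · rw [ENNReal.toReal_ofReal h0]; exact le_abs_self _
  · rw [ENNReal.ofReal_of_nonpos h0]; simp

lemma locallyIntegrable_verticalPrimitive {α : ℝ × ℝ → ℝ} (hα : Measurable α)
    (hα1 : ∀ z, |α z| ≤ 1) : LocallyIntegrable (verticalPrimitive α) := by
  refine (continuous_snd.abs.locallyIntegrable (μ := volume)).mono
    (measurable_verticalPrimitive hα).aestronglyMeasurable (Eventually.of_forall fun z => ?_)
  simpa using abs_verticalPrimitive_le hα1 z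

/-- Pairing the vertical primitive with a test function, by exchanging the integrals. -/
lemma integral_verticalPrimitive_mul {α : ℝ × ℝ → ℝ} (hα : Measurable α) (hα1 : ∀ z, |α z| ≤ 1)
    {g : ℝ × ℝ → ℝ} (hg : Continuous g) (hgc : HasCompactSupport g) {Y : ℝ} (hY0 : 0 < Y)
    (hY : ∀ z : ℝ × ℝ, Y ≤ z.2 → g z = 0) :
    ∫ z, verticalPrimitive α z * g z =
      ∫ z in halfPlane, α z * ∫ τ in (0 : ℝ)..Y, g (z + τ • ((0, 1) : ℝ × ℝ)) := by
  set e : ℝ × ℝ := (0, 1) with he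
  set f : ℝ × ℝ → ℝ := halfPlane.indicator α with hf
  have hfm : Measurable f := hα.indicator measurableSet_halfPlane
  have hf1 : ∀ z, |f z| ≤ 1 := fun z => by
    by_cases h : z ∈ halfPlane
    · simp [hf, h, hα1]
    · simp [hf, h]
  -- Extending α by zero below the axis makes the primitive an integral over the fixed interval (0,
  -- Y] wherever g is nonzero. Fubini and a translation then move the shift onto g.
  have hint1 : Integrable (fun x : (ℝ × ℝ) × ℝ => f (x.1 - x.2 • e) * g x.1)
      (volume.prod (volume.restrict (Ioc 0 Y))) := by
    refine Integrable.bdd_mul (c := 1) ?_ ?_ (Eventually.of_forall fun x => hf1 _)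
    · exact (hg.integrable_of_hasCompactSupport hgc).comp_fst _
    · exact (hfm.comp (by fun_prop)).aestronglyMeasurable
  have hint2 : Integrable (fun x : (ℝ × ℝ) × ℝ => f x.1 * g (x.1 + x.2 • e))
      (volume.prod (volume.restrict (Ioc 0 Y))) := by
    refine Integrable.bdd_mul (c := 1) ?_ ?_ (Eventually.of_forall fun x => hf1 _)
    · refine integrable_prod_Ioc_of_continuous (f := fun x : (ℝ × ℝ) × ℝ => g (x.1 + x.2 • e))
        (K := ((fun x : (ℝ × ℝ) × ℝ => x.1 - x.2 • e) '' (tsupport g ×ˢ Icc 0 Y)))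
        (hg.comp (by fun_prop)) ((hgc.isCompact.prod isCompact_Icc).image (by fun_prop)) ?_
      intro z τ hz hτ
      by_contra h
      exact hz ⟨(z + τ • e, τ), ⟨subset_tsupport _ (by simpa using h), Ioc_subset_Icc_self hτ⟩,
        by simp⟩
    · exact (hfm.comp measurable_fst).aestronglyMeasurable
  have hW : ∀ z, verticalPrimitive α z * g z = ∫ τ in Ioc 0 Y, f (z - τ • e) * g z := by
    intro z
    rw [integral_mul_const]
    by_cases hz : Y ≤ z.2
    · simp [hY z hz]
    push Not at hz
    congr 1
    rw [verticalPrimitive]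
    rcases le_total z.2 0 with h0 | h0
    · rw [Ioc_eq_empty (by linarith), setIntegral_empty,
        setIntegral_eq_zero_of_forall_eq_zero]
      intro τ hτ
      refine indicator_of_notMem ?_ _
      simp only [halfPlane, mem_ofPred_eq, he, Prod.snd_sub, Prod.smul_snd, smul_eq_mul, mul_one,
        not_lt]
      linarith [hτ.1]
    · have h1 : ∫ τ in Ioc 0 Y, f (z - τ • e) = ∫ τ in Ioo 0 z.2, α (z.1, z.2 - τ) := by
        rw [← integral_indicator measurableSet_Ioc, ← integral_indicator measurableSet_Ioo]
        refine integral_congr_ae (Eventually.of_forall fun τ => ?_)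
        simp only [indicator, mem_Ioc, mem_Ioo, hf, halfPlane, mem_ofPred_eq, he, Prod.snd_sub,
          Prod.smul_snd, smul_eq_mul, mul_one, sub_pos]
        by_cases h2 : 0 < τ ∧ τ < z.2
        · rw [if_pos ⟨h2.1, by linarith⟩, if_pos h2.2, if_pos h2]
          congr 1; ext <;> simp
        · rw [if_neg h2]
          split_ifs with h3 h4 <;> [exact absurd ⟨h3.1, h4⟩ h2; rfl; rfl]
      rw [h1, ← integral_Ioc_eq_integral_Ioo, ← intervalIntegral.integral_of_le h0,
        ← intervalIntegral.integral_of_le h0,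
        intervalIntegral.integral_comp_sub_left (fun ξ => α (z.1, ξ)) z.2]
      simp
  calc ∫ z, verticalPrimitive α z * g z
      = ∫ z, ∫ τ in Ioc 0 Y, f (z - τ • e) * g z := by simp_rw [hW]
    _ = ∫ τ in Ioc 0 Y, ∫ z, f (z - τ • e) * g z := integral_integral_swap hint1
    _ = ∫ τ in Ioc 0 Y, ∫ z, f z * g (z + τ • e) := by
        refine integral_congr_ae (Eventually.of_forall fun τ => ?_)
        simp only
        rw [← integral_add_right_eq_self (fun z => f (z - τ • e) * g z) (τ • e)]
        simp
    _ = ∫ z, ∫ τ in Ioc 0 Y, f z * g (z + τ • e) := (integral_integral_swap hint2).symm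
    _ = ∫ z in halfPlane, α z * ∫ τ in (0 : ℝ)..Y, g (z + τ • e) := by
        rw [← integral_indicator measurableSet_halfPlane]
        refine integral_congr_ae (Eventually.of_forall fun z => ?_)
        simp only [integral_const_mul, intervalIntegral.integral_of_le hY0.le]
        by_cases h : z ∈ halfPlane
        · simp [hf, h]
        · simp [hf, h]

lemma lineIntegral_vertical_fderiv {g : ℝ × ℝ → ℝ} (hg : ContDiff ℝ ∞ g) {Y : ℝ}
    (hY : ∀ z : ℝ × ℝ, Y ≤ z.2 → g z = 0) {z : ℝ × ℝ} (hz : z ∈ halfPlane) :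
    ∫ τ in (0 : ℝ)..Y, fderiv ℝ g (z + τ • ((0, 1) : ℝ × ℝ)) (0, 1) = -g z := by
  rw [intervalIntegral.integral_eq_sub_of_hasDerivAt (f := fun τ => g (z + τ • ((0, 1) : ℝ × ℝ)))]
  · rw [hY]
    · simp
    · have : 0 < z.2 := hz
      simp; linarith
  · intro τ _
    have h := (hg.differentiable (by simp) (z + τ • ((0, 1) : ℝ × ℝ))).hasFDerivAt
    have h2 : HasDerivAt (fun τ : ℝ => z + τ • ((0, 1) : ℝ × ℝ)) (0, 1) τ := by
      simpa using ((hasDerivAt_id τ).smul_const ((0, 1) : ℝ × ℝ)).const_add z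
    exact h.comp_hasDerivAt τ h2
  · exact (((hg.continuous_fderiv (by simp)).comp (by fun_prop)).clm_apply
      continuous_const).intervalIntegrable _ _

/-- The weak vertical derivative of the vertical primitive. -/
lemma integral_verticalPrimitive_mul_fderiv_snd {α : ℝ × ℝ → ℝ} (hα : Measurable α)
    (hα1 : ∀ z, |α z| ≤ 1) {g : ℝ × ℝ → ℝ} (hg : ContDiff ℝ ∞ g) (hgc : HasCompactSupport g) :
    ∫ z, verticalPrimitive α z * fderiv ℝ g z (0, 1) = -∫ z in halfPlane, α z * g z := by
  obtain ⟨R, hR⟩ := hgc.isCompact.isBounded.subset_closedBall (0 : ℝ × ℝ)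
  have hY : ∀ z : ℝ × ℝ, |R| + 1 ≤ z.2 → z ∉ tsupport g := fun z hz h => by
    have h1 := hR h
    rw [mem_closedBall_zero_iff] at h1
    have h2 := (norm_snd_le z).trans h1
    rw [Real.norm_eq_abs] at h2
    linarith [le_abs_self z.2, le_abs_self R]
  have hY' : ∀ z : ℝ × ℝ, |R| + 1 ≤ z.2 → fderiv ℝ g z (0, 1) = 0 := fun z hz => by
    rw [fderiv_of_notMem_tsupport (𝕜 := ℝ) (hY z hz)]
    rfl
  have hR0 : 0 < |R| + 1 := by positivity
  rw [integral_verticalPrimitive_mul hα hα1 (hg.continuous_fderiv_apply_const _)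
    (hgc.fderiv_apply_const _) hR0 hY', ← integral_neg]
  refine setIntegral_congr_fun measurableSet_halfPlane fun z hz => ?_
  rw [lineIntegral_vertical_fderiv hg
    (fun z hz => image_eq_zero_of_notMem_tsupport (hY z hz)) hz]
  ring

lemma integral_fderiv_fst_slice {k : ℝ × ℝ → ℝ} (hk : ContDiff ℝ ∞ k) (hkc : HasCompactSupport k)
    (y : ℝ) : ∫ s, fderiv ℝ k (s, y) (1, 0) = 0 := by
  have hd : ∀ s, HasDerivAt (fun s => k (s, y)) (fderiv ℝ k (s, y) (1, 0)) s := fun s => by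
    have h := (hk.differentiable (by simp) (s, y)).hasFDerivAt
    exact h.comp_hasDerivAt s ((hasDerivAt_id s).prodMk (hasDerivAt_const s y))
  have hemb : Topology.IsClosedEmbedding fun s : ℝ => (s, y) :=
    ⟨Topology.IsEmbedding.of_comp (by fun_prop) continuous_fst Topology.IsEmbedding.id, by
      have : range (fun s : ℝ => (s, y)) = {z : ℝ × ℝ | z.2 = y} := by
        ext ⟨a, b⟩; simp [eq_comm]
      rw [this]
      exact isClosed_eq continuous_snd continuous_const⟩
  have h1 : Integrable fun s => fderiv ℝ k (s, y) (1, 0) :=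
    ((hk.continuous_fderiv_apply_const _).comp (by fun_prop)).integrable_of_hasCompactSupport
      ((hkc.fderiv_apply_const _).comp_isClosedEmbedding hemb)
  have h2 : Integrable fun s => k (s, y) :=
    (hk.continuous.comp (by fun_prop)).integrable_of_hasCompactSupport
      (hkc.comp_isClosedEmbedding hemb)
  exact integral_eq_zero_of_hasDerivAt_of_integrable hd h1 h2

lemma setIntegral_halfPlane_fderiv_fst {k : ℝ × ℝ → ℝ} (hk : ContDiff ℝ ∞ k)
    (hkc : HasCompactSupport k) : ∫ z in halfPlane, fderiv ℝ k z (1, 0) = 0 := by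
  rw [setIntegral_halfPlane ((hk.continuous_fderiv_apply_const _).integrable_of_hasCompactSupport
    (hkc.fderiv_apply_const _)).integrableOn]
  simp [integral_fderiv_fst_slice hk hkc]

/-- The convolution of a bump with `f`, as an integral against a translated bump. -/
lemma convolution_bump_apply (ρ : ContDiffBump (0 : ℝ × ℝ)) (f : ℝ × ℝ → ℝ) (x : ℝ × ℝ) :
    MeasureTheory.convolution (ρ.normed volume) f (ContinuousLinearMap.lsmul ℝ ℝ) volume x =
      ∫ z, f z * ρ.normed volume (x - z) := by
  rw [convolution_eq_swap]
  refine integral_congr_ae (Eventually.of_forall fun z => ?_)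
  simp [mul_comm]

/-- Mollification by a bump function. -/
noncomputable def mollify (ρ : ContDiffBump (0 : ℝ × ℝ)) (f : ℝ × ℝ → ℝ) : ℝ × ℝ → ℝ :=
  MeasureTheory.convolution (ρ.normed volume) f (ContinuousLinearMap.lsmul ℝ ℝ) volume

lemma mollify_apply (ρ : ContDiffBump (0 : ℝ × ℝ)) (f : ℝ × ℝ → ℝ) (x : ℝ × ℝ) :
    mollify ρ f x = ∫ z, f z * ρ.normed volume (x - z) := convolution_bump_apply ρ f x

lemma contDiff_mollify (ρ : ContDiffBump (0 : ℝ × ℝ)) {f : ℝ × ℝ → ℝ} (hf : LocallyIntegrable f) :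
    ContDiff ℝ ∞ (mollify ρ f) :=
  ρ.hasCompactSupport_normed.contDiff_convolution_left _ ρ.contDiff_normed hf

lemma contDiff_bump_translate (ρ : ContDiffBump (0 : ℝ × ℝ)) (x : ℝ × ℝ) :
    ContDiff ℝ ∞ fun z => ρ.normed volume (x - z) :=
  ρ.contDiff_normed.comp (contDiff_const.sub contDiff_id)

lemma tsupport_bump_translate (ρ : ContDiffBump (0 : ℝ × ℝ)) (x : ℝ × ℝ) :
    tsupport (fun z => ρ.normed volume (x - z)) ⊆ Metric.closedBall x ρ.rOut := by
  refine closure_minimal (fun z hz => ?_) Metric.isClosed_closedBall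
  have h1 : x - z ∈ Function.support (ρ.normed volume) := hz
  rw [ρ.support_normed_eq, mem_ball_zero_iff, ← dist_eq_norm, dist_comm] at h1
  exact h1.le

lemma hasCompactSupport_bump_translate (ρ : ContDiffBump (0 : ℝ × ℝ)) (x : ℝ × ℝ) :
    HasCompactSupport fun z => ρ.normed volume (x - z) :=
  (isCompact_closedBall x ρ.rOut).of_isClosed_subset (isClosed_tsupport _)
    (tsupport_bump_translate ρ x)

lemma integral_bump_translate (ρ : ContDiffBump (0 : ℝ × ℝ)) (x : ℝ × ℝ) :
    ∫ z, ρ.normed volume (x - z) = 1 := by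
  rw [integral_sub_left_eq_self (fun z => ρ.normed volume z) volume x, ρ.integral_normed]

/-- The derivative falls on the bump. Writing it as a derivative in the integration variable, at the
cost of a sign, presents it as a weak derivative of f paired with the translated bump. -/
lemma fderiv_mollify (ρ : ContDiffBump (0 : ℝ × ℝ)) {f : ℝ × ℝ → ℝ} (hf : LocallyIntegrable f)
    (x v : ℝ × ℝ) : fderiv ℝ (mollify ρ f) x v =
      -∫ z, f z * fderiv ℝ (fun z => ρ.normed volume (x - z)) z v := by
  have hs : ContDiff ℝ 1 (ρ.normed volume) := ρ.contDiff_normed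
  have h := ρ.hasCompactSupport_normed.hasFDerivAt_convolution_left
    (ContinuousLinearMap.lsmul ℝ ℝ) hs hf x
  rw [mollify, h.fderiv, convolution_eq_swap, ContinuousLinearMap.integral_apply, ← integral_neg]
  · refine integral_congr_ae (Eventually.of_forall fun z => ?_)
    have h2 : HasFDerivAt (fun z => ρ.normed volume (x - z))
        ((fderiv ℝ (ρ.normed volume) (x - z)).comp (-ContinuousLinearMap.id ℝ (ℝ × ℝ))) z :=
      ((hs.differentiable (by simp) (x - z)).hasFDerivAt).comp z
        ((hasFDerivAt_id z).const_sub x)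
    simp only [h2.fderiv]
    simp [ContinuousLinearMap.precompL_apply, mul_comm]
  · have := (ρ.hasCompactSupport_normed.fderiv (𝕜 := ℝ)).convolutionExists_left
      ((ContinuousLinearMap.lsmul ℝ ℝ).precompL (ℝ × ℝ)) (hs.continuous_fderiv (by simp)) hf x
    rw [convolutionExistsAt_iff_integrable_swap] at this
    exact this

/-- The bump is nonnegative, has mass one and lives in a ball, so only an almost-everywhere bound of
f on that ball is needed. -/
lemma abs_mollify_le (ρ : ContDiffBump (0 : ℝ × ℝ)) {f : ℝ × ℝ → ℝ} {x : ℝ × ℝ} {M : ℝ}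
    (hM : ∀ᵐ z, z ∈ Metric.closedBall x ρ.rOut → |f z| ≤ M) : |mollify ρ f x| ≤ M := by
  rw [mollify_apply]
  have h1 : ∀ᵐ z, |f z * ρ.normed volume (x - z)| ≤ M * ρ.normed volume (x - z) := by
    filter_upwards [hM] with z hz
    rw [abs_mul, abs_of_nonneg (ρ.nonneg_normed _)]
    by_cases h : z ∈ Metric.closedBall x ρ.rOut
    · exact mul_le_mul_of_nonneg_right (hz h) (ρ.nonneg_normed _)
    · have : ρ.normed volume (x - z) = 0 :=
        image_eq_zero_of_notMem_tsupport (f := fun z => ρ.normed volume (x - z))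
          fun h' => h (tsupport_bump_translate ρ x h')
      simp [this]
  calc |∫ z, f z * ρ.normed volume (x - z)| ≤ ∫ z, |f z * ρ.normed volume (x - z)| :=
        abs_integral_le_integral_abs
    _ ≤ ∫ z, M * ρ.normed volume (x - z) :=
        integral_mono_of_nonneg (Eventually.of_forall fun _ => abs_nonneg _)
          (((contDiff_bump_translate ρ x).continuous.integrable_of_hasCompactSupport
            (hasCompactSupport_bump_translate ρ x)).const_mul M) h1
    _ = M := by rw [integral_const_mul, integral_bump_translate, mul_one]

lemma mollify_sub_const (ρ : ContDiffBump (0 : ℝ × ℝ)) {f : ℝ × ℝ → ℝ} (hf : LocallyIntegrable f)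
    (c : ℝ) (x : ℝ × ℝ) : mollify ρ (fun z => f z - c) x = mollify ρ f x - c := by
  have hi : Integrable fun z => ρ.normed volume (x - z) :=
    (contDiff_bump_translate ρ x).continuous.integrable_of_hasCompactSupport
      (hasCompactSupport_bump_translate ρ x)
  have h2 : Integrable fun z => f z * ρ.normed volume (x - z) := by
    have := hf.integrable_smul_right_of_hasCompactSupport
      (contDiff_bump_translate ρ x).continuous (hasCompactSupport_bump_translate ρ x)
    exact this
  simp_rw [mollify_apply, sub_mul]
  rw [integral_sub h2 (hi.const_mul c), integral_const_mul, integral_bump_translate, mul_one]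

/-- A sequence of bump functions shrinking to the origin. -/
noncomputable def shrinkingBump {E : Type*} [NormedAddCommGroup E] (i : ℕ) :
    ContDiffBump (0 : E) where
  rIn := 1 / (2 * ((i : ℝ) + 1))
  rOut := 1 / ((i : ℝ) + 1)
  rIn_pos := by positivity
  rIn_lt_rOut := by
    apply one_div_lt_one_div_of_lt <;> nlinarith [(Nat.cast_nonneg i : (0 : ℝ) ≤ i)]

lemma shrinkingBump_rOut_le {E : Type*} [NormedAddCommGroup E] (i : ℕ) :
    (shrinkingBump i : ContDiffBump (0 : E)).rOut ≤ 1 := by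
  simp only [shrinkingBump]
  rw [div_le_one (by positivity)]
  linarith [(Nat.cast_nonneg i : (0 : ℝ) ≤ i)]

lemma tendsto_shrinkingBump_rOut {E : Type*} [NormedAddCommGroup E] :
    Tendsto (fun i => (shrinkingBump i : ContDiffBump (0 : E)).rOut) atTop (𝓝 0) :=
  tendsto_one_div_add_atTop_nhds_zero_nat

/-- The comparable radii let the Lebesgue differentiation theorem for convolutions apply with K = 2.
-/
lemma shrinkingBump_rOut_le_two_mul {E : Type*} [NormedAddCommGroup E] (i : ℕ) :
    (shrinkingBump i : ContDiffBump (0 : E)).rOut ≤ 2 * (shrinkingBump i : ContDiffBump (0 : E)).rIn := by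
  simp only [shrinkingBump]
  apply le_of_eq
  field_simp

lemma ae_tendsto_mollify {f : ℝ × ℝ → ℝ} (hf : LocallyIntegrable f) :
    ∀ᵐ x, Tendsto (fun i => mollify (shrinkingBump i) f x) atTop (𝓝 (f x)) := by
  refine ContDiffBump.ae_convolution_tendsto_right_of_locallyIntegrable (K := 2)
    tendsto_shrinkingBump_rOut (Eventually.of_forall shrinkingBump_rOut_le_two_mul) hf

/-- The weak horizontal derivative of the vertical primitive, by the conservation law. -/
lemma integral_verticalPrimitive_mul_fderiv_fst {p c R : ℝ} {u : ℝ × ℝ → ℝ} {j : ℝ → ℝ}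
    (hu : Measurable u) (hu01 : ∀ z, u z ∈ Icc (0 : ℝ) 1) (hj : Measurable j)
    (hj1 : ∀ s, |j s| ≤ 1) (hc : c ∈ Icc (0 : ℝ) 1) (hR : 0 ≤ R)
    (hcons : ∀ θ : ℝ × ℝ → ℝ, ContDiff ℝ ∞ θ → HasCompactSupport θ →
      tsupport θ ⊆ Metric.closedBall 0 (2 * R + 1) →
      ∫ z in halfPlane, (u z * fderiv ℝ θ z (1, 0) +
        p * ((u z - u z ^ 2) * fderiv ℝ θ z (0, 1))) = -(p * ∫ s, j s * θ (s, 0)))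
    {g : ℝ × ℝ → ℝ} (hg : ContDiff ℝ ∞ g) (hgR : tsupport g ⊆ Metric.closedBall 0 R) :
    ∫ z, verticalPrimitive (fun z => u z - c) z * fderiv ℝ g z (1, 0) =
      p * ∫ z in halfPlane, (u z - u z ^ 2 - j z.1) * g z := by
  set e : ℝ × ℝ := (0, 1) with he
  have hgc : HasCompactSupport g :=
    (isCompact_closedBall _ _).of_isClosed_subset (isClosed_tsupport _) hgR
  have hY : ∀ z : ℝ × ℝ, R + 1 ≤ z.2 → z ∉ tsupport g := fun z hz h => by
    have h1 := hgR h
    rw [mem_closedBall_zero_iff] at h1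
    have h2 := (norm_snd_le z).trans h1
    rw [Real.norm_eq_abs] at h2
    linarith [le_abs_self z.2]
  have hY0 : ∀ z : ℝ × ℝ, R + 1 ≤ z.2 → g z = 0 := fun z hz =>
    image_eq_zero_of_notMem_tsupport (hY z hz)
  have hY' : ∀ z : ℝ × ℝ, R + 1 ≤ z.2 → fderiv ℝ g z (1, 0) = 0 := fun z hz => by
    rw [fderiv_of_notMem_tsupport (𝕜 := ℝ) (hY z hz)]
    rfl
  -- The conservation law is tested with an upward integral of g, so that ∂_y k = -g and ∂_s k is
  -- what Fubini produces from the vertical primitive.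
  set k : ℝ × ℝ → ℝ := fun z => ∫ τ in (0 : ℝ)..(R + 1), g (z + τ • e) with hk
  have hks : ContDiff ℝ ∞ k := contDiff_lineIntegral hg hgc e (R + 1)
  have hkc : HasCompactSupport k := hasCompactSupport_lineIntegral hgc e (R + 1)
  -- The support of g has radius R and the upward shift has length at most R + 1, whence the radius
  -- 2R + 1.
  have hkR : tsupport k ⊆ Metric.closedBall 0 (2 * R + 1) := by
    refine closure_minimal (fun z hz => ?_) Metric.isClosed_closedBall
    by_contra hz'
    refine hz (intervalIntegral.integral_zero_ae (Eventually.of_forall fun τ hτ => ?_))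
    rw [uIoc_of_le (by linarith)] at hτ
    refine image_eq_zero_of_notMem_tsupport fun h => hz' ?_
    have h1 := hgR h
    rw [mem_closedBall_zero_iff] at h1 ⊢
    have h2 : ‖τ • e‖ ≤ R + 1 := by
      rw [norm_smul, Real.norm_eq_abs, abs_of_pos hτ.1]
      simp [he, Prod.norm_def]
      exact hτ.2
    have h3 : z = (z + τ • e) - τ • e := by simp
    rw [h3]
    exact (norm_sub_le _ _).trans (by linarith)
  have hkd : ∀ z w, fderiv ℝ k z w = ∫ τ in (0 : ℝ)..(R + 1), fderiv ℝ g (z + τ • e) w := by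
    intro z w
    rw [(hasFDerivAt_lineIntegral (hg.of_le (by norm_cast)) hgc e (R + 1) z).fderiv,
      ContinuousLinearMap.intervalIntegral_apply]
    exact ((hg.continuous_fderiv (by simp)).comp (by fun_prop)).intervalIntegrable _ _
  have hα1 : ∀ z, |u z - c| ≤ 1 := fun z => by
    rw [abs_le]; constructor <;> linarith [(hu01 z).1, (hu01 z).2, hc.1, hc.2]
  have hdk : IntegrableOn (fun z => fderiv ℝ k z (1, 0)) halfPlane :=
    ((hks.continuous_fderiv_apply_const _).integrable_of_hasCompactSupport
      (hkc.fderiv_apply_const _)).integrableOn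
  have hu1 : ∀ z, |u z| ≤ 1 := fun z => by
    rw [abs_le]; constructor <;> linarith [(hu01 z).1, (hu01 z).2]
  have hJ1 : ∀ z, |u z - u z ^ 2| ≤ 1 := fun z => by
    rw [abs_le]; constructor <;> nlinarith [(hu01 z).1, (hu01 z).2]
  have hudk : IntegrableOn (fun z => u z * fderiv ℝ k z (1, 0)) halfPlane :=
    integrable_bdd_mul hu.aestronglyMeasurable hu1 (hks.continuous_fderiv_apply_const _)
      (hkc.fderiv_apply_const _)
  have hJg : IntegrableOn (fun z => (u z - u z ^ 2) * g z) halfPlane :=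
    integrable_bdd_mul (hu.sub (hu.pow_const 2)).aestronglyMeasurable hJ1 hg.continuous hgc
  have hjg : IntegrableOn (fun z : ℝ × ℝ => j z.1 * g z) halfPlane :=
    integrable_bdd_mul (hj.comp measurable_fst).aestronglyMeasurable (fun z => hj1 _)
      hg.continuous hgc
  have hcon := hcons k hks hkc hkR
  have e1 : ∫ z in halfPlane, (u z * fderiv ℝ k z (1, 0) +
        p * ((u z - u z ^ 2) * fderiv ℝ k z (0, 1))) =
      (∫ z in halfPlane, u z * fderiv ℝ k z (1, 0)) -
        p * ∫ z in halfPlane, (u z - u z ^ 2) * g z := by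
    rw [← integral_const_mul, ← integral_sub hudk (hJg.const_mul p)]
    refine setIntegral_congr_fun measurableSet_halfPlane fun z hz => ?_
    simp only [hkd z (0, 1), lineIntegral_vertical_fderiv hg hY0 hz, he]
    ring
  have e2 : ∫ s, j s * k (s, 0) = ∫ z in halfPlane, j z.1 * g z := by
    have hcut : ∀ z : ℝ × ℝ, R + 1 < z.2 → j z.1 * g z = 0 := fun z hz => by
      rw [hY0 z hz.le, mul_zero]
    have hjg' : Integrable (fun z : ℝ × ℝ => j z.1 * g z) (volume.prod volume) :=
      integrable_bdd_mul (hj.comp measurable_fst).aestronglyMeasurable (fun z => hj1 _)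
        hg.continuous hgc
    have hjg2 : Integrable (fun z : ℝ × ℝ => j z.1 * g z)
        (volume.prod (volume.restrict (Ioc 0 (R + 1)))) :=
      hjg'.mono_measure (Measure.prod_mono le_rfl Measure.restrict_le_self)
    have hset : ∫ z in halfPlane, j z.1 * g z =
        ∫ z, j z.1 * g z ∂(volume.prod (volume.restrict (Ioc 0 (R + 1)))) := by
      rw [integral_prod_symm _ hjg2, setIntegral_halfPlane hjg]
      refine (setIntegral_eq_of_subset_of_forall_sdiff_eq_zero measurableSet_Ioi
        Ioc_subset_Ioi_self fun y hy => ?_)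
      have hy' : R + 1 < y := by
        by_contra h
        exact hy.2 ⟨hy.1, not_lt.1 h⟩
      simp [hcut (_, y) hy']
    rw [hset, integral_prod _ hjg2]
    refine integral_congr_ae (Eventually.of_forall fun s => ?_)
    simp only [hk, intervalIntegral.integral_of_le (by linarith : (0 : ℝ) ≤ R + 1),
      integral_const_mul]
    simp [he]
  -- The constant c drops out because a horizontal derivative of a compactly supported function has
  -- zero integral on each slice.
  have e3 : ∫ z in halfPlane, (u z - c) * fderiv ℝ k z (1, 0) =
      ∫ z in halfPlane, u z * fderiv ℝ k z (1, 0) := by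
    simp_rw [sub_mul]
    rw [integral_sub hudk (hdk.const_mul c), integral_const_mul,
      setIntegral_halfPlane_fderiv_fst hks hkc, mul_zero, sub_zero]
  have e4 : ∫ z in halfPlane, (u z - u z ^ 2 - j z.1) * g z =
      (∫ z in halfPlane, (u z - u z ^ 2) * g z) - ∫ z in halfPlane, j z.1 * g z := by
    rw [← integral_sub hJg hjg]
    simp_rw [sub_mul]
  rw [integral_verticalPrimitive_mul (hu.sub_const c) hα1 (hg.continuous_fderiv_apply_const _)
    (hgc.fderiv_apply_const _) (by linarith : 0 < R + 1) hY', e4]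
  simp_rw [← he, ← hkd]
  rw [e3]
  rw [e1, e2] at hcon
  linarith

lemma locallyIntegrable_of_abs_le {f : ℝ × ℝ → ℝ} (hf : Measurable f) {M : ℝ}
    (hM : ∀ z, |f z| ≤ M) : LocallyIntegrable f :=
  (locallyIntegrable_const M).mono hf.aestronglyMeasurable (Eventually.of_forall fun z => by
    simpa using (hM z).trans (le_abs_self M))

lemma integral_indicator_halfPlane_mul (f g : ℝ × ℝ → ℝ) :
    ∫ z, halfPlane.indicator f z * g z = ∫ z in halfPlane, f z * g z := by
  rw [← integral_indicator measurableSet_halfPlane]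
  refine integral_congr_ae (Eventually.of_forall fun z => ?_)
  by_cases h : z ∈ halfPlane <;> simp [h]

/-! ### The potential of the fluctuations tends to zero. -/

namespace IsBlowUp

open Polynomial

variable {p : ℝ} {U : ℕ → ℝ × ℝ → ℝ} {j : ℕ → ℝ → ℝ} {q : ℝ[X] →ₗ[ℝ] ℝ}

/-- Centring h at M/2 gives a polynomial bounded by M/2 on the unit interval. The norm bound for q
then gives one-sided control. -/
lemma map_nonneg (H : IsBlowUp p U j q) (h : ℝ[X]) (h0 : ∀ w ∈ Icc (0 : ℝ) 1, 0 ≤ h.eval w) :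
    0 ≤ q h := by
  obtain ⟨M, -, hM⟩ := h.exists_abs_eval_le
  have := H.abs_map_le (h - (M / 2) • 1) (M / 2) fun w hw => by
    have h1 := h0 w hw
    have h2 := abs_le.1 (hM w hw)
    simp only [eval_sub, eval_smul, eval_one, smul_eq_mul, mul_one]
    rw [abs_le]; constructor <;> linarith
  rw [map_sub, map_smul, H.map_one, smul_eq_mul, mul_one, abs_le] at this
  linarith

lemma map_X_mem (H : IsBlowUp p U j q) : q X ∈ Icc (0 : ℝ) 1 := by
  have h1 := H.map_nonneg X fun w hw => by simpa using hw.1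
  have h2 := H.map_nonneg (1 - X) fun w hw => by simpa using hw.2
  rw [map_sub, H.map_one] at h2
  exact ⟨h1, by linarith⟩

/-- The primitive of the fluctuations of `U n` around the limiting mean value. -/
noncomputable def potential (U : ℕ → ℝ × ℝ → ℝ) (q : ℝ[X] →ₗ[ℝ] ℝ) (n : ℕ) : ℝ × ℝ → ℝ :=
  verticalPrimitive fun z => U n z - q X

lemma abs_sub_mean_le (H : IsBlowUp p U j q) (n : ℕ) (z : ℝ × ℝ) : |U n z - q X| ≤ 1 := by
  have h1 := H.map_X_mem
  have h2 := H.mem_Icc n z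
  rw [abs_le]; constructor <;> linarith [h1.1, h1.2, h2.1, h2.2]

lemma locallyIntegrable_potential (H : IsBlowUp p U j q) (n : ℕ) :
    LocallyIntegrable (potential U q n) :=
  locallyIntegrable_verticalPrimitive ((H.measurable n).sub_const _) (H.abs_sub_mean_le n)

/-- This and the next lemma identify the gradient of the mollified potential with mollified bounded
functions. The vertical derivative comes from the definition, the horizontal one from the
conservation law. -/
lemma fderiv_mollify_potential_snd (H : IsBlowUp p U j q) (n : ℕ) (ρ : ContDiffBump (0 : ℝ × ℝ))
    (x : ℝ × ℝ) : fderiv ℝ (mollify ρ (potential U q n)) x (0, 1) =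
      mollify ρ (halfPlane.indicator fun z => U n z - q X) x := by
  rw [fderiv_mollify ρ (H.locallyIntegrable_potential n), potential,
    integral_verticalPrimitive_mul_fderiv_snd ((H.measurable n).sub_const _) (H.abs_sub_mean_le n)
      (contDiff_bump_translate ρ x) (hasCompactSupport_bump_translate ρ x), neg_neg, mollify_apply,
    integral_indicator_halfPlane_mul]

lemma eventually_fderiv_mollify_potential_fst (H : IsBlowUp p U j q) (R : ℝ) :
    ∀ᶠ n in atTop, ∀ ρ : ContDiffBump (0 : ℝ × ℝ), ρ.rOut ≤ 1 → ∀ x ∈ Metric.closedBall 0 R,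
      fderiv ℝ (mollify ρ (potential U q n)) x (1, 0) =
        mollify ρ (halfPlane.indicator fun z => -(p * (U n z - U n z ^ 2 - j n z.1))) x := by
  set R' := |R| + 1 with hR'
  filter_upwards [H.conservation (Metric.closedBall 0 (2 * R' + 1)) (isCompact_closedBall _ _)]
    with n hn ρ hρ x hx
  have hsub : tsupport (fun z => ρ.normed volume (x - z)) ⊆ Metric.closedBall 0 R' := by
    refine (tsupport_bump_translate ρ x).trans (Metric.closedBall_subset_closedBall' ?_)
    rw [Metric.mem_closedBall] at hx
    linarith [le_abs_self R]
  rw [fderiv_mollify ρ (H.locallyIntegrable_potential n), potential,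
    integral_verticalPrimitive_mul_fderiv_fst (H.measurable n) (H.mem_Icc n) (H.measurable_flux n)
      (H.abs_flux_le n) H.map_X_mem (by positivity) hn (contDiff_bump_translate ρ x) hsub,
    mollify_apply, integral_indicator_halfPlane_mul, ← integral_const_mul, ← integral_neg]
  refine integral_congr_ae (Eventually.of_forall fun z => ?_)
  simp only
  ring

lemma abs_flux_sub_le (H : IsBlowUp p U j q) (hp : 0 < p) (n : ℕ) (z : ℝ × ℝ) :
    |-(p * (U n z - U n z ^ 2 - j n z.1))| ≤ 2 * p := by
  have h1 := H.mem_Icc n z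
  have h2 := abs_le.1 (H.abs_flux_le n z.1)
  rw [abs_neg, abs_mul, abs_of_pos hp, mul_comm]
  refine mul_le_mul_of_nonneg_right ?_ hp.le
  rw [abs_le]; constructor <;> nlinarith [h1.1, h1.2, h2.1, h2.2]

lemma abs_indicator_le {s : Set (ℝ × ℝ)} {f : ℝ × ℝ → ℝ} {M : ℝ} (hM : ∀ z, |f z| ≤ M)
    (z : ℝ × ℝ) : |s.indicator f z| ≤ M := by
  by_cases h : z ∈ s
  · simpa [h] using hM z
  · simpa [h] using (abs_nonneg _).trans (hM z)

/-- Both partial derivatives are mollifications of bounded functions, with bounds 2p and 1. The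
Lipschitz constant therefore depends neither on the mollifier nor on n. -/
lemma eventually_lipschitz_mollify_potential (H : IsBlowUp p U j q) (hp : 0 < p) (R : ℝ) :
    ∀ᶠ n in atTop, ∀ ρ : ContDiffBump (0 : ℝ × ℝ), ρ.rOut ≤ 1 →
      ∀ x ∈ Metric.closedBall (0 : ℝ × ℝ) R, ∀ y ∈ Metric.closedBall (0 : ℝ × ℝ) R,
      |mollify ρ (potential U q n) x - mollify ρ (potential U q n) y| ≤ (2 * p + 1) * ‖x - y‖ := by
  filter_upwards [H.eventually_fderiv_mollify_potential_fst R] with n hn ρ hρ x hx y hy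
  refine (convex_closedBall (0 : ℝ × ℝ) R).norm_image_sub_le_of_norm_fderiv_le (𝕜 := ℝ)
    (f := mollify ρ (potential U q n)) (fun z _ => ?_) (fun z hz => ?_) hy hx
  · exact (contDiff_mollify ρ (H.locallyIntegrable_potential n)).differentiable (by simp) z
  · refine ContinuousLinearMap.opNorm_le_bound _ (by positivity) fun v => ?_
    have hv : v = v.1 • ((1, 0) : ℝ × ℝ) + v.2 • ((0, 1) : ℝ × ℝ) := by ext <;> simp
    have h1 : |fderiv ℝ (mollify ρ (potential U q n)) z (1, 0)| ≤ 2 * p := by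
      rw [hn ρ hρ z hz]
      exact abs_mollify_le ρ (Eventually.of_forall fun z _ =>
        abs_indicator_le (H.abs_flux_sub_le hp n) z)
    have h2 : |fderiv ℝ (mollify ρ (potential U q n)) z (0, 1)| ≤ 1 := by
      rw [H.fderiv_mollify_potential_snd n]
      exact abs_mollify_le ρ (Eventually.of_forall fun z _ =>
        abs_indicator_le (H.abs_sub_mean_le n) z)
    have h3 := norm_fst_le v
    have h4 := norm_snd_le v
    rw [Real.norm_eq_abs] at h3 h4
    rw [hv, map_add, map_smul, map_smul, ← hv, Real.norm_eq_abs]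
    refine (abs_add_le _ _).trans ?_
    rw [smul_eq_mul, smul_eq_mul, abs_mul, abs_mul]
    have := mul_le_mul h3 h1 (abs_nonneg _) (norm_nonneg v)
    have := mul_le_mul h4 h2 (abs_nonneg _) (norm_nonneg v)
    linarith

end IsBlowUp

namespace IsBlowUp

open Polynomial

variable {p : ℝ} {U : ℕ → ℝ × ℝ → ℝ} {j : ℕ → ℝ → ℝ} {q : ℝ[X] →ₗ[ℝ] ℝ}

/-- Letting the auxiliary mollifier shrink transfers the Lipschitz estimate to almost every pair of
points. Averaging that estimate over the bump then compares the potential with its mollification. -/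
lemma eventually_abs_potential_sub_mollify_le (H : IsBlowUp p U j q) (hp : 0 < p) (R : ℝ) :
    ∀ᶠ n in atTop, ∀ ρ : ContDiffBump (0 : ℝ × ℝ), ρ.rOut ≤ 1 →
      ∀ᵐ x, x ∈ Metric.closedBall (0 : ℝ × ℝ) R →
        |potential U q n x - mollify ρ (potential U q n) x| ≤ (2 * p + 1) * ρ.rOut := by
  filter_upwards [H.eventually_lipschitz_mollify_potential hp (R + 1)] with n hn ρ hρ
  have hli := H.locallyIntegrable_potential n
  filter_upwards [ae_tendsto_mollify hli] with x hx hxR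
  have hxR1 : x ∈ Metric.closedBall (0 : ℝ × ℝ) (R + 1) :=
    Metric.closedBall_subset_closedBall (by linarith) hxR
  have hlip : ∀ᵐ z, z ∈ Metric.closedBall x ρ.rOut →
      |potential U q n z - potential U q n x| ≤ (2 * p + 1) * ρ.rOut := by
    filter_upwards [ae_tendsto_mollify hli] with z hz hzx
    have hzR : z ∈ Metric.closedBall (0 : ℝ × ℝ) (R + 1) := by
      rw [Metric.mem_closedBall] at *
      linarith [dist_triangle z x 0]
    refine le_of_tendsto (hz.sub hx).abs (Eventually.of_forall fun i => ?_)
    refine (hn (shrinkingBump i) (shrinkingBump_rOut_le i) z hzR x hxR1).trans ?_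
    rw [Metric.mem_closedBall, dist_eq_norm] at hzx
    gcongr
  have h1 := abs_mollify_le ρ hlip
  rw [mollify_sub_const ρ hli] at h1
  rwa [abs_sub_comm]

/-- For a fixed mollification the potential of the fluctuations tends to zero. -/
lemma tendsto_mollify_potential (H : IsBlowUp p U j q) (hp : 0 < p)
    (ρ : ContDiffBump (0 : ℝ × ℝ)) (x : ℝ × ℝ) :
    Tendsto (fun n => mollify ρ (potential U q n) x) atTop (𝓝 0) := by
  set g : ℝ × ℝ → ℝ := fun z => ρ.normed volume (x - z) with hg
  have hgs : ContDiff ℝ ∞ g := contDiff_bump_translate ρ x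
  have hgc : HasCompactSupport g := hasCompactSupport_bump_translate ρ x
  set Y := |x.2| + ρ.rOut + 1 with hY
  have hY0 : 0 < Y := by have := ρ.rOut_pos; positivity
  have hgY : ∀ z : ℝ × ℝ, Y ≤ z.2 → g z = 0 := fun z hz =>
    image_eq_zero_of_notMem_tsupport fun h => by
      have h1 := tsupport_bump_translate ρ x h
      rw [Metric.mem_closedBall, dist_eq_norm] at h1
      have h2 := (norm_snd_le (z - x)).trans h1
      rw [Real.norm_eq_abs, Prod.snd_sub] at h2
      linarith [le_abs_self (z.2 - x.2), le_abs_self x.2]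
  -- Fubini rewrites the mollified potential as a weak integral of U_n - q(X), and q annihilates X -
  -- q(X).
  have h := H.tendsto_integral_eval hp (X - C (q X))
    (contDiff_lineIntegral hgs hgc ((0, 1) : ℝ × ℝ) Y)
    (hasCompactSupport_lineIntegral hgc ((0, 1) : ℝ × ℝ) Y)
  have h0 : q (X - C (q X)) = 0 := by
    have : (C (q X) : ℝ[X]) = q X • 1 := by rw [smul_eq_C_mul, mul_one]
    rw [map_sub, this, map_smul, H.map_one]; simp
  rw [h0, zero_mul] at h
  refine h.congr fun n => ?_
  rw [mollify_apply, potential, integral_verticalPrimitive_mul ((H.measurable n).sub_const _)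
    (H.abs_sub_mean_le n) hgs.continuous hgc hY0 hgY]
  simp

/-- The potential of the fluctuations is uniformly small on bounded sets. -/
theorem eventually_abs_potential_le (H : IsBlowUp p U j q) (hp : 0 < p) (R : ℝ) {η : ℝ}
    (hη : 0 < η) : ∀ᶠ n in atTop, ∀ᵐ x, x ∈ Metric.closedBall (0 : ℝ × ℝ) R →
      |potential U q n x| ≤ η := by
  set L := 2 * p + 1 with hL
  have hL0 : 0 < L := by positivity
  obtain ⟨i, hi⟩ := ((tendsto_shrinkingBump_rOut (E := ℝ × ℝ)).eventually_lt_const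
    (show 0 < η / (2 * L + 1) by positivity)).exists
  set ρ : ContDiffBump (0 : ℝ × ℝ) := shrinkingBump i with hρ
  set κ := ρ.rOut with hκ
  have hκ0 : 0 < κ := ρ.rOut_pos
  have hκη : (2 * L + 1) * κ ≤ η := by
    rw [lt_div_iff₀ (by positivity)] at hi; linarith
  -- Pointwise convergence at the finitely many points of a κ-net plus equicontinuity gives uniform
  -- smallness. The choice (2L+1)κ ≤ η pays for two Lipschitz errors and one pointwise error.
  obtain ⟨t, ht, htc⟩ := (isCompact_closedBall (0 : ℝ × ℝ) R).elim_nhds_subcover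
    (fun x => Metric.ball x κ) (fun x _ => Metric.ball_mem_nhds x hκ0)
  have hev : ∀ᶠ n in atTop, ∀ x ∈ t, |mollify ρ (potential U q n) x| ≤ κ := by
    rw [Filter.eventually_all_finset]
    intro x _
    simpa using eventually_abs_sub_le (H.tendsto_mollify_potential hp ρ x) hκ0
  filter_upwards [hev, H.eventually_abs_potential_sub_mollify_le hp R,
    H.eventually_lipschitz_mollify_potential hp R] with n h1 h2 h3
  filter_upwards [h2 ρ (shrinkingBump_rOut_le i)] with x hx hxR
  obtain ⟨y, hy, hxy⟩ : ∃ y ∈ t, x ∈ Metric.ball y κ := by simpa using htc hxR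
  have h4 := h3 ρ (shrinkingBump_rOut_le i) x hxR y (ht y hy)
  have h5 := h1 y hy
  have h6 := hx hxR
  rw [Metric.mem_ball, dist_eq_norm] at hxy
  have h7 : L * ‖x - y‖ ≤ L * κ := by gcongr
  have e : potential U q n x = (potential U q n x - mollify ρ (potential U q n) x) +
    (mollify ρ (potential U q n) x - mollify ρ (potential U q n) y) +
      mollify ρ (potential U q n) y := by ring
  rw [e]
  refine (abs_add_le _ _).trans ?_
  have := abs_add_le (potential U q n x - mollify ρ (potential U q n) x)
    (mollify ρ (potential U q n) x - mollify ρ (potential U q n) y)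
  linarith

/-! ### Compensated compactness: vanishing variance. -/

/-- The product rule for the entropy flux tested against the potential of the fluctuations. -/
lemma integral_product_ge (H : IsBlowUp p U j q) (hp : 0 < p) {θ : ℝ × ℝ → ℝ}
    (hθ : ContDiff ℝ ∞ θ) (hθc : HasCompactSupport θ) (hθh : tsupport θ ⊆ halfPlane)
    (hθ0 : ∀ z, 0 ≤ θ z) {η : ℝ} (hη : 0 < η) : ∀ᶠ n in atTop,
      -(2 * η * ((∫ z in halfPlane, |fderiv ℝ θ z (1, 0)|) +
          p * ∫ z in halfPlane, |fderiv ℝ θ z (0, 1)|)) ≤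
        ∫ z in halfPlane, (U n z ^ 2 * -(p * (U n z - U n z ^ 2 - j n z.1)) +
          p * ((U n z ^ 2 - 4 / 3 * U n z ^ 3) * (U n z - q X))) * θ z := by
  obtain ⟨R, hR⟩ := hθc.isCompact.isBounded.subset_closedBall (0 : ℝ × ℝ)
  filter_upwards [H.entropy _ hθc.isCompact hθh, H.eventually_abs_potential_le hp (R + 1) hη,
    H.eventually_fderiv_mollify_potential_fst R] with n hent hpot hfst
  set W := potential U q n with hW
  set β : ℝ × ℝ → ℝ := halfPlane.indicator fun z => -(p * (U n z - U n z ^ 2 - j n z.1)) with hβ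
  set γ : ℝ × ℝ → ℝ := halfPlane.indicator fun z => U n z - q X with hγ
  set A : ℝ × ℝ → ℝ := fun z => U n z ^ 2 with hA
  set B : ℝ × ℝ → ℝ := fun z => U n z ^ 2 - 4 / 3 * U n z ^ 3 with hB
  have hUm := H.measurable n
  have hjm : Measurable fun z : ℝ × ℝ => j n z.1 := (H.measurable_flux n).comp measurable_fst
  have hAm : Measurable A := hUm.pow_const 2
  have hBm : Measurable B := (hUm.pow_const 2).sub ((hUm.pow_const 3).const_mul _)
  have hA1 : ∀ z, |A z| ≤ 1 := fun z => by
    have := H.mem_Icc n z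
    rw [abs_le]; constructor <;> simp only [hA] <;> nlinarith [this.1, this.2]
  have hB1 : ∀ z, |B z| ≤ 1 := fun z => by
    have h := H.mem_Icc n z
    have h2 : 0 ≤ U n z ^ 2 := by positivity
    have h3 : U n z ^ 2 ≤ 1 := by nlinarith [h.1, h.2]
    have e : B z = U n z ^ 2 * (1 - 4 / 3 * U n z) := by simp only [hB]; ring
    rw [e, abs_mul, abs_of_nonneg h2]
    have h4 : |1 - 4 / 3 * U n z| ≤ 1 := by
      rw [abs_le]; constructor <;> linarith [h.1, h.2]
    nlinarith [abs_nonneg (1 - 4 / 3 * U n z)]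
  have hli : LocallyIntegrable W := H.locallyIntegrable_potential n
  have hWm : Measurable W := measurable_verticalPrimitive (hUm.sub_const _)
  have hβm : Measurable β :=
    ((((hUm.sub (hUm.pow_const 2)).sub hjm).const_mul p).neg).indicator measurableSet_halfPlane
  have hγm : Measurable γ := (hUm.sub_const _).indicator measurableSet_halfPlane
  have hβ1 : ∀ z, |β z| ≤ 2 * p := abs_indicator_le (H.abs_flux_sub_le hp n)
  have hγ1 : ∀ z, |γ z| ≤ 1 := abs_indicator_le (H.abs_sub_mean_le n)
  have hβli := locallyIntegrable_of_abs_le hβm hβ1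
  have hγli := locallyIntegrable_of_abs_le hγm hγ1
  -- bounds for the mollified potential on the support of `θ`
  have hWi : ∀ i, ∀ x ∈ tsupport θ, |mollify (shrinkingBump i) W x| ≤ η := fun i x hx => by
    refine abs_mollify_le _ ?_
    filter_upwards [hpot] with z hz hzx
    refine hz ?_
    have := hR hx
    rw [Metric.mem_closedBall] at *
    linarith [dist_triangle z x 0, shrinkingBump_rOut_le (E := ℝ × ℝ) i]
  -- G has separate slots for the potential and its two weak derivatives. Each is mollified when the
  -- entropy inequality is applied, and the mollification is removed by dominated convergence.
  set G : (ℝ × ℝ → ℝ) → (ℝ × ℝ → ℝ) → (ℝ × ℝ → ℝ) → ℝ × ℝ → ℝ := fun w b c z =>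
    (A z * b z + p * (B z * c z)) * θ z +
      (w z + η) * (A z * fderiv ℝ θ z (1, 0) + p * (B z * fderiv ℝ θ z (0, 1))) with hG
  have hstep : ∀ i, 0 ≤ ∫ z in halfPlane, G (mollify (shrinkingBump i) W)
      (mollify (shrinkingBump i) β) (mollify (shrinkingBump i) γ) z := by
    intro i
    set w := mollify (shrinkingBump i) W with hw
    have hws : ContDiff ℝ ∞ w := contDiff_mollify _ hli
    -- The potential has no sign; adding η makes it nonnegative on the support of θ, and the
    -- resulting factor stays at most 2η there.
    have hTs : ContDiff ℝ ∞ fun z => (w z + η) * θ z := (hws.add contDiff_const).mul hθ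
    have hTsupp : tsupport (fun z => (w z + η) * θ z) ⊆ tsupport θ := tsupport_mul_subset_right
    have := hent (fun z => (w z + η) * θ z) hTs hθc.mul_left hTsupp (fun z => by
      by_cases hz : z ∈ tsupport θ
      · exact mul_nonneg (by linarith [(abs_le.1 (hWi i z hz)).1]) (hθ0 z)
      · simp [image_eq_zero_of_notMem_tsupport hz])
    refine this.trans_eq (integral_congr_ae (Eventually.of_forall fun z => ?_))
    have hd : ∀ v, fderiv ℝ (fun z => (w z + η) * θ z) z v =
        (w z + η) * fderiv ℝ θ z v + θ z * fderiv ℝ w z v := fun v => by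
      have h1 := ((hws.differentiable (by simp) z).hasFDerivAt.add_const η).mul
        ((hθ.differentiable (by simp) z).hasFDerivAt)
      have h2 : fderiv ℝ (fun z => (w z + η) * θ z) z = _ := h1.fderiv
      rw [h2]
      simp
    simp only [hd, hG, hA, hB]
    by_cases hz : z ∈ tsupport θ
    · rw [hfst _ (shrinkingBump_rOut_le i) z (hR hz), H.fderiv_mollify_potential_snd n]
      ring
    · rw [image_eq_zero_of_notMem_tsupport hz]
      ring
  have hdθ1 := hθ.continuous_fderiv_apply_const (1, 0)
  have hdθ2 := hθ.continuous_fderiv_apply_const (0, 1)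
  have hdc1 := hθc.fderiv_apply_const (1, 0)
  have hdc2 := hθc.fderiv_apply_const (0, 1)
  have hid1 : IntegrableOn (fun z => |fderiv ℝ θ z (1, 0)|) halfPlane :=
    (hdθ1.integrable_of_hasCompactSupport hdc1).abs.integrableOn
  have hid2 : IntegrableOn (fun z => |fderiv ℝ θ z (0, 1)|) halfPlane :=
    (hdθ2.integrable_of_hasCompactSupport hdc2).abs.integrableOn
  have hiθ : IntegrableOn (fun z => |θ z|) halfPlane :=
    (hθ.continuous.integrable_of_hasCompactSupport hθc).abs.integrableOn
  have hbb : ∀ z, ∀ b c : ℝ, |A z * b + p * (B z * c)| ≤ |b| + p * |c| := fun z b c => by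
    refine (abs_add_le _ _).trans ?_
    rw [abs_mul, abs_mul, abs_mul, abs_of_pos hp]
    have h1 := mul_le_mul_of_nonneg_right (hA1 z) (abs_nonneg b)
    have h2 := mul_le_mul_of_nonneg_right (hB1 z) (abs_nonneg c)
    have h3 := mul_le_mul_of_nonneg_left h2 hp.le
    linarith
  have hlim : Tendsto (fun i => ∫ z in halfPlane, G (mollify (shrinkingBump i) W)
      (mollify (shrinkingBump i) β) (mollify (shrinkingBump i) γ) z) atTop
      (𝓝 (∫ z in halfPlane, G W β γ z)) := by
    refine tendsto_integral_of_dominated_convergence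
      (fun z => (2 * p + p * 1) * |θ z| +
        2 * η * (|fderiv ℝ θ z (1, 0)| + p * |fderiv ℝ θ z (0, 1)|)) ?_ ?_ ?_ ?_
    · intro i
      have h1 := (contDiff_mollify (shrinkingBump i) hli).continuous.measurable
      have h2 := (contDiff_mollify (shrinkingBump i) hβli).continuous.measurable
      have h3 := (contDiff_mollify (shrinkingBump i) hγli).continuous.measurable
      have h4 := hθ.continuous.measurable
      have h5 := hdθ1.measurable
      have h6 := hdθ2.measurable
      exact ((((hAm.mul h2).add ((hBm.mul h3).const_mul p)).mul h4).add
        ((h1.add_const η).mul ((hAm.mul h5).add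
          ((hBm.mul h6).const_mul p)))).aestronglyMeasurable
    · exact (hiθ.const_mul _).add ((hid1.add (hid2.const_mul p)).const_mul _)
    · intro i
      refine Eventually.of_forall fun z => ?_
      have hb := abs_mollify_le (shrinkingBump i) (x := z) (Eventually.of_forall fun z _ => hβ1 z)
      have hc := abs_mollify_le (shrinkingBump i) (x := z) (Eventually.of_forall fun z _ => hγ1 z)
      simp only [hG]
      rw [Real.norm_eq_abs]
      refine (abs_add_le _ _).trans (add_le_add ?_ ?_)
      · rw [abs_mul]
        refine mul_le_mul_of_nonneg_right ((hbb z _ _).trans ?_) (abs_nonneg _)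
        gcongr
      · by_cases hz : z ∈ tsupport θ
        · rw [abs_mul]
          refine mul_le_mul ?_ (hbb z _ _) (abs_nonneg _) (by positivity)
          have := abs_le.1 (hWi i z hz)
          rw [abs_le]; constructor <;> linarith
        · rw [fderiv_of_notMem_tsupport (𝕜 := ℝ) hz]
          simp
    · have h1 := ae_restrict_of_ae (s := halfPlane) (ae_tendsto_mollify hli)
      have h2 := ae_restrict_of_ae (s := halfPlane) (ae_tendsto_mollify hβli)
      have h3 := ae_restrict_of_ae (s := halfPlane) (ae_tendsto_mollify hγli)
      filter_upwards [h1, h2, h3] with z h1 h2 h3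
      exact (((h2.const_mul (A z)).add ((h3.const_mul (B z)).const_mul p)).mul_const (θ z)).add
        ((h1.add_const η).mul_const _)
  have hge : 0 ≤ ∫ z in halfPlane, G W β γ z := ge_of_tendsto' hlim hstep
  have hi1 : IntegrableOn (fun z => (A z * β z + p * (B z * γ z)) * θ z) halfPlane := by
    refine integrable_bdd_mul (M := 2 * p + p * 1) ?_ (fun z => ?_) hθ.continuous hθc
    · exact ((hAm.mul hβm).add ((hBm.mul hγm).const_mul p)).aestronglyMeasurable
    · refine (hbb z _ _).trans ?_
      gcongr
      · exact hβ1 z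
      · exact hγ1 z
  have hWae : ∀ᵐ z, |(W z + η) * (A z * fderiv ℝ θ z (1, 0) + p * (B z * fderiv ℝ θ z (0, 1)))| ≤
      2 * η * (|fderiv ℝ θ z (1, 0)| + p * |fderiv ℝ θ z (0, 1)|) := by
    filter_upwards [hpot] with z hz
    by_cases hzs : z ∈ tsupport θ
    · rw [abs_mul]
      refine mul_le_mul ?_ (hbb z _ _) (abs_nonneg _) (by positivity)
      have := abs_le.1 (hz (Metric.closedBall_subset_closedBall (by linarith) (hR hzs)))
      rw [abs_le]; constructor <;> linarith
    · rw [fderiv_of_notMem_tsupport (𝕜 := ℝ) hzs]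
      simp
  have hi2 : IntegrableOn (fun z => (W z + η) * (A z * fderiv ℝ θ z (1, 0) +
      p * (B z * fderiv ℝ θ z (0, 1)))) halfPlane := by
    refine (((hid1.add (hid2.const_mul p)).const_mul (2 * η))).mono' ?_
      (ae_restrict_of_ae hWae)
    exact ((hWm.add_const η).mul ((hAm.mul hdθ1.measurable).add
      ((hBm.mul hdθ2.measurable).const_mul p))).aestronglyMeasurable
  have hsplit : ∫ z in halfPlane, G W β γ z =
      (∫ z in halfPlane, (A z * β z + p * (B z * γ z)) * θ z) +
      ∫ z in halfPlane, (W z + η) * (A z * fderiv ℝ θ z (1, 0) +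
        p * (B z * fderiv ℝ θ z (0, 1))) := integral_add hi1 hi2
  have hle : ∫ z in halfPlane, (W z + η) * (A z * fderiv ℝ θ z (1, 0) +
        p * (B z * fderiv ℝ θ z (0, 1))) ≤
      2 * η * ((∫ z in halfPlane, |fderiv ℝ θ z (1, 0)|) +
          p * ∫ z in halfPlane, |fderiv ℝ θ z (0, 1)|) := by
    rw [← integral_const_mul, ← integral_add hid1 (hid2.const_mul p), ← integral_const_mul]
    exact integral_mono_ae hi2 ((hid1.add (hid2.const_mul p)).const_mul _)
      ((ae_restrict_of_ae hWae).mono fun z hz => (le_abs_self _).trans hz)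
  have hfin : ∫ z in halfPlane, (A z * β z + p * (B z * γ z)) * θ z =
      ∫ z in halfPlane, (U n z ^ 2 * -(p * (U n z - U n z ^ 2 - j n z.1)) +
          p * ((U n z ^ 2 - 4 / 3 * U n z ^ 3) * (U n z - q X))) * θ z :=
    setIntegral_congr_fun measurableSet_halfPlane fun z hz => by
      simp only [hβ, hγ, indicator_of_mem hz, hA, hB]
  rw [← hfin]
  linarith

/-- A product of a strongly and a weakly convergent factor: the boundary flux converges in L¹ on
bounded intervals, while U_n² converges weakly by the Young measure theorem. -/
lemma tendsto_integral_flux_mul (H : IsBlowUp p U j q) (hp : 0 < p) {θ : ℝ × ℝ → ℝ}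
    (hθ : ContDiff ℝ ∞ θ) (hθc : HasCompactSupport θ) :
    Tendsto (fun n => ∫ z in halfPlane, j n z.1 * U n z ^ 2 * θ z) atTop
      (𝓝 (q (X - X ^ 2) * (q (X ^ 2) * ∫ z in halfPlane, θ z))) := by
  set cJ := q (X - X ^ 2) with hcJ
  obtain ⟨R, hR⟩ := hθc.isCompact.isBounded.subset_closedBall (0 : ℝ × ℝ)
  obtain ⟨M, hM⟩ := hθ.continuous.bounded_above_of_compact_support hθc
  have hM0 : 0 ≤ M := (norm_nonneg _).trans (hM 0)
  have h1 : Tendsto (fun n => cJ * ∫ z in halfPlane, (X ^ 2 : ℝ[X]).eval (U n z) * θ z) atTop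
      (𝓝 (cJ * (q (X ^ 2) * ∫ z in halfPlane, θ z))) :=
    (H.tendsto_integral_eval hp (X ^ 2) hθ hθc).const_mul cJ
  have h2 : Tendsto (fun n => ∫ z in halfPlane, (j n z.1 - cJ) * U n z ^ 2 * θ z) atTop (𝓝 0) := by
    have hb : ∀ n, ‖∫ z in halfPlane, (j n z.1 - cJ) * U n z ^ 2 * θ z‖ ≤
        (M * (2 * |R|)) * ∫ s in Icc (-|R|) |R|, |j n s - cJ| := by
      intro n
      have hji : IntegrableOn (fun s => |j n s - cJ|) (Icc (-|R|) |R|) := by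
        refine Measure.integrableOn_of_bounded (M := 1 + |cJ|) (by simp)
          (((H.measurable_flux n).sub_const _).abs.aestronglyMeasurable)
          (Eventually.of_forall fun s => ?_)
        rw [Real.norm_eq_abs, abs_abs]
        exact (abs_sub _ _).trans (by linarith [H.abs_flux_le n s])
      have hpi : Integrable (fun z : ℝ × ℝ => |j n z.1 - cJ|)
          ((volume.restrict (Icc (-|R|) |R|)).prod (volume.restrict (Icc (-|R|) |R|))) :=
        Integrable.comp_fst hji _
      calc ‖∫ z in halfPlane, (j n z.1 - cJ) * U n z ^ 2 * θ z‖
          ≤ ∫ z in halfPlane, M * (Icc (-|R|) |R| ×ˢ Icc (-|R|) |R|).indicator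
              (fun z : ℝ × ℝ => |j n z.1 - cJ|) z := by
            refine norm_integral_le_of_norm_le ?_ (Eventually.of_forall fun z => ?_)
            · refine Integrable.const_mul (Integrable.integrableOn ?_) M
              rw [integrable_indicator_iff (measurableSet_Icc.prod measurableSet_Icc),
                IntegrableOn, Measure.volume_eq_prod, ← Measure.prod_restrict]
              exact hpi
            · by_cases hz : z ∈ tsupport θ
              · have hzR := hR hz
                rw [mem_closedBall_zero_iff] at hzR
                have hz1 := (norm_fst_le z).trans (hzR.trans (le_abs_self R))
                have hz2 := (norm_snd_le z).trans (hzR.trans (le_abs_self R))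
                have hmem : z ∈ Icc (-|R|) |R| ×ˢ Icc (-|R|) |R| := ⟨abs_le.1 hz1, abs_le.1 hz2⟩
                rw [indicator_of_mem hmem, norm_mul, norm_mul, mul_comm M]
                have hU : ‖U n z ^ 2‖ ≤ 1 := by
                  have := H.mem_Icc n z
                  rw [Real.norm_eq_abs, abs_le]; constructor <;> nlinarith [this.1, this.2]
                have h5 : ‖j n z.1 - cJ‖ * ‖U n z ^ 2‖ ≤ |j n z.1 - cJ| := by
                  have := mul_le_mul_of_nonneg_left hU (norm_nonneg (j n z.1 - cJ))
                  simpa using this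
                exact mul_le_mul h5 (hM z) (norm_nonneg _) (abs_nonneg _)
              · rw [image_eq_zero_of_notMem_tsupport hz, mul_zero, norm_zero]
                exact mul_nonneg hM0 (indicator_nonneg (fun _ _ => abs_nonneg _) _)
        _ ≤ ∫ z, M * (Icc (-|R|) |R| ×ˢ Icc (-|R|) |R|).indicator
              (fun z : ℝ × ℝ => |j n z.1 - cJ|) z := by
            refine setIntegral_le_integral ?_ (Eventually.of_forall fun z =>
              mul_nonneg hM0 (indicator_nonneg (fun _ _ => abs_nonneg _) _))
            refine Integrable.const_mul ?_ M
            rw [integrable_indicator_iff (measurableSet_Icc.prod measurableSet_Icc),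
              IntegrableOn, Measure.volume_eq_prod, ← Measure.prod_restrict]
            exact hpi
        _ = (M * (2 * |R|)) * ∫ s in Icc (-|R|) |R|, |j n s - cJ| := by
            rw [integral_const_mul, integral_indicator (measurableSet_Icc.prod measurableSet_Icc),
              Measure.volume_eq_prod, ← Measure.prod_restrict, integral_prod _ hpi]
            simp only [integral_const, measureReal_restrict_apply_univ, Real.volume_real_Icc,
              smul_eq_mul]
            rw [integral_const_mul, max_eq_left (by linarith [abs_nonneg R])]
            ring
    refine squeeze_zero_norm hb ?_
    have h6 := (H.tendsto_flux |R|).const_mul (M * (2 * |R|))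
    rw [mul_zero] at h6
    exact h6
  have h3 := h2.add h1
  rw [zero_add] at h3
  refine h3.congr fun n => ?_
  rw [← integral_const_mul, ← integral_add]
  · refine integral_congr_ae (Eventually.of_forall fun z => ?_)
    simp only [eval_pow, eval_X]
    ring
  · refine integrable_bdd_mul (M := 1 + |cJ|) ?_ (fun z => ?_) hθ.continuous hθc
    · exact ((((H.measurable_flux n).comp measurable_fst).sub_const _).mul
        ((H.measurable n).pow_const 2)).aestronglyMeasurable
    · have hz := H.mem_Icc n z
      have hU : |U n z ^ 2| ≤ 1 := by rw [abs_le]; constructor <;> nlinarith [hz.1, hz.2]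
      rw [abs_mul]
      have h4 : |j n z.1 - cJ| ≤ 1 + |cJ| :=
        (abs_sub _ _).trans (by linarith [H.abs_flux_le n z.1])
      nlinarith [abs_nonneg (j n z.1 - cJ), abs_nonneg (U n z ^ 2)]
  · exact (((X ^ 2 : ℝ[X]).integrable_eval_mul (H.measurable n) (H.mem_Icc n) hθ.continuous
      hθc).const_mul cJ)

lemma exists_test_function_halfPlane : ∃ θ : ℝ × ℝ → ℝ, ContDiff ℝ ∞ θ ∧ HasCompactSupport θ ∧
    tsupport θ ⊆ halfPlane ∧ (∀ z, 0 ≤ θ z) ∧ ∫ z in halfPlane, θ z = 1 := by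
  let φ : ContDiffBump ((0, 2) : ℝ × ℝ) := ⟨1 / 2, 1, by norm_num, by norm_num⟩
  have hsub : tsupport (φ.normed volume) ⊆ halfPlane := by
    rw [φ.tsupport_normed_eq]
    intro z hz
    rw [Metric.mem_closedBall, dist_eq_norm] at hz
    have := (norm_snd_le (z - (0, 2))).trans hz
    rw [Real.norm_eq_abs, abs_le] at this
    simp only [φ, Prod.snd_sub] at this
    change 0 < z.2
    linarith [this.1]
  refine ⟨φ.normed volume, φ.contDiff_normed, φ.hasCompactSupport_normed, hsub, φ.nonneg_normed, ?_⟩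
  rw [setIntegral_eq_integral_of_forall_compl_eq_zero, φ.integral_normed]
  exact fun z hz => image_eq_zero_of_notMem_tsupport fun h => hz (hsub h)

/-- The limiting Young measure of a blow-up sequence is a Dirac mass. -/
theorem map_X_sq (H : IsBlowUp p U j q) (hp : 0 < p) : q (X ^ 2) = q X ^ 2 := by
  obtain ⟨θ, hθ, hθc, hθh, hθ0, hθ1⟩ := exists_test_function_halfPlane
  set m1 := q X with hm1
  set m2 := q (X ^ 2) with hm2
  set m3 := q (X ^ 3) with hm3
  set m4 := q (X ^ 4) with hm4
  -- The cubic terms U³ coming from the two products cancel, leaving jU² - U⁴/3 - m1 U² + (4/3) m1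
  -- U³, whose weak limit is known term by term.
  have hlim : Tendsto (fun n => ∫ z in halfPlane,
      (U n z ^ 2 * -(p * (U n z - U n z ^ 2 - j n z.1)) +
          p * ((U n z ^ 2 - 4 / 3 * U n z ^ 3) * (U n z - q X))) * θ z) atTop
      (𝓝 (p * ((m1 - m2) * m2 - 1 / 3 * m4 - m1 * m2 + 4 / 3 * m1 * m3))) := by
    have h1 := H.tendsto_integral_eval hp
      (-(1 / 3 : ℝ) • X ^ 4 - m1 • X ^ 2 + (4 / 3 * m1) • X ^ 3) hθ hθc
    have h2 := H.tendsto_integral_flux_mul hp hθ hθc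
    have h3 := (h2.add h1).const_mul p
    simp only [map_add, map_sub, map_smul, hθ1, mul_one, smul_eq_mul] at h3
    have e : p * ((q X - q (X ^ 2)) * q (X ^ 2) +
        (-(1 / 3) * q (X ^ 4) - m1 * q (X ^ 2) + 4 / 3 * m1 * q (X ^ 3))) =
        p * ((m1 - m2) * m2 - 1 / 3 * m4 - m1 * m2 + 4 / 3 * m1 * m3) := by
      rw [← hm1, ← hm2, ← hm3, ← hm4]; ring
    rw [e] at h3
    refine h3.congr fun n => ?_
    rw [← integral_add, ← integral_const_mul]
    · refine integral_congr_ae (Eventually.of_forall fun z => ?_)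
      simp only [eval_add, eval_sub, eval_smul, eval_pow, eval_X, smul_eq_mul]
      ring
    · refine integrable_bdd_mul (M := 1) ?_ (fun z => ?_) hθ.continuous hθc
      · exact (((H.measurable_flux n).comp measurable_fst).mul
          ((H.measurable n).pow_const 2)).aestronglyMeasurable
      · have hz := H.mem_Icc n z
        have hU : |U n z ^ 2| ≤ 1 := by rw [abs_le]; constructor <;> nlinarith [hz.1, hz.2]
        rw [abs_mul]
        nlinarith [abs_nonneg (j n z.1), abs_nonneg (U n z ^ 2), H.abs_flux_le n z.1]
    · exact Polynomial.integrable_eval_mul _ (H.measurable n) (H.mem_Icc n) hθ.continuous hθc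
  set D := (∫ z in halfPlane, |fderiv ℝ θ z (1, 0)|) +
          p * ∫ z in halfPlane, |fderiv ℝ θ z (0, 1)| with hD
  have hD0 : 0 ≤ D := by positivity
  have hge : 0 ≤ p * ((m1 - m2) * m2 - 1 / 3 * m4 - m1 * m2 + 4 / 3 * m1 * m3) := by
    refine le_of_forall_pos_le_add fun ε hε => ?_
    have hη : 0 < ε / (2 * D + 1) := by positivity
    have := ge_of_tendsto hlim (H.integral_product_ge hp hθ hθc hθh hθ0 hη)
    rw [← hD] at this
    have h5 : 2 * (ε / (2 * D + 1)) * D ≤ ε := by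
      have : 2 * (ε / (2 * D + 1)) * D = ε * (2 * D) / (2 * D + 1) := by ring
      rw [this, div_le_iff₀ (by positivity)]
      nlinarith
    linarith
  have hge' := nonneg_of_mul_nonneg_right hge hp
  have h4 := H.map_nonneg ((X - C m1) ^ 4) fun w _ => by
    simp only [eval_pow, eval_sub, eval_X, eval_C]; positivity
  have e4 : ((X - C m1) ^ 4 : ℝ[X]) = X ^ 4 - (4 * m1) • X ^ 3 + (6 * m1 ^ 2) • X ^ 2 -
      (4 * m1 ^ 3) • X + (m1 ^ 4) • 1 := by
    simp only [smul_eq_C_mul, C_mul, C_pow, map_ofNat]; ring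
  rw [e4] at h4
  simp only [map_add, map_sub, map_smul, smul_eq_mul, H.map_one, ← hm1, ← hm2, ← hm3, ← hm4] at h4
  -- The limit inequality reads -m2² - m4/3 + (4/3) m1 m3 ≥ 0. Adding one third of the fourth
  -- central moment eliminates m3 and m4 and leaves exactly -(m2 - m1²)² ≥ 0.
  have : (m2 - m1 ^ 2) ^ 2 ≤ 0 := by nlinarith
  have := pow_eq_zero_iff (two_ne_zero) |>.1 (le_antisymm this (sq_nonneg _))
  linarith

end IsBlowUp

/-! ### Essential limits at an end point. -/

/-- An interval (0, ε) is not a null set. This nontriviality is what makes essential limits unique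
and lets inequalities pass to them. -/
instance essLimZero_neBot : (𝓝[>] (0 : ℝ) ⊓ ae (volume : Measure ℝ)).NeBot := by
  rw [Filter.inf_neBot_iff]
  intro s hs t ht
  obtain ⟨ε, hε, hsub⟩ := mem_nhdsGT_iff_exists_Ioo_subset.1 hs
  by_contra h
  rw [Set.not_nonempty_iff_eq_empty] at h
  have h1 : Ioo 0 ε ⊆ tᶜ := fun x hx hxt => by
    have : x ∈ s ∩ t := ⟨hsub hx, hxt⟩
    rw [h] at this; exact this
  have h2 : volume (Ioo (0 : ℝ) ε) = 0 := measure_mono_null h1 (mem_ae_iff.1 ht)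
  have hε' : (0 : ℝ) < ε := hε
  simp [hε'.not_ge] at h2

lemma eventually_essLimZero_of_ae {P : ℝ → Prop} (h : ∀ᵐ x, x ∈ Ioo (0 : ℝ) 1 → P x) :
    ∀ᶠ x in 𝓝[>] (0 : ℝ) ⊓ ae volume, P x := by
  have h1 : ∀ᶠ x in 𝓝[>] (0 : ℝ) ⊓ ae volume, x ∈ Ioo (0 : ℝ) 1 :=
    mem_inf_of_left (Ioo_mem_nhdsGT one_pos)
  have h2 : ∀ᶠ x in 𝓝[>] (0 : ℝ) ⊓ ae volume, x ∈ Ioo (0 : ℝ) 1 → P x := mem_inf_of_right h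
  filter_upwards [h1, h2] with x h1 h2 using h2 h1

lemma EssLimZero.exists_delta {g : ℝ → ℝ} {L ε : ℝ} (h : EssLimZero g L) (hε : 0 < ε) :
    ∃ δ > 0, ∀ᵐ x, x ∈ Ioo 0 δ → |g x - L| ≤ ε := by
  have h1 := eventually_abs_sub_le h hε
  rw [Filter.eventually_inf] at h1
  obtain ⟨s, hs, t, ht, hst⟩ := h1
  obtain ⟨δ, hδ, hsub⟩ := mem_nhdsGT_iff_exists_Ioo_subset.1 hs
  refine ⟨δ, hδ, ?_⟩
  filter_upwards [ht] with x hx hxδ using hst x ⟨hsub hxδ, hx⟩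

/-- A bounded function that is almost everywhere antitone up to a Lipschitz correction has an
essential limit. -/
lemma exists_essLimZero_of_ae_antitone {G : ℝ → ℝ} {M C : ℝ} (hM : ∀ x, |G x| ≤ M) {S : Set ℝ}
    (hS : S ∈ ae (volume : Measure ℝ))
    (hG : ∀ x ∈ S ∩ Ioo 0 1, ∀ y ∈ S ∩ Ioo 0 1, x < y → -(C * (y - x)) ≤ G x - G y) :
    ∃ L, EssLimZero G L := by
  set S' := S ∩ Ioo (0 : ℝ) 1 with hS'
  have hmem : ∀ ε > 0, ε ≤ 1 → ∀ᶠ x in 𝓝[>] (0 : ℝ) ⊓ ae volume, x ∈ S' ∧ x < ε := by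
    intro ε hε hε1
    have h1 : ∀ᶠ x in 𝓝[>] (0 : ℝ) ⊓ ae volume, x ∈ Ioo (0 : ℝ) ε :=
      mem_inf_of_left (Ioo_mem_nhdsGT hε)
    have h2 : ∀ᶠ x in 𝓝[>] (0 : ℝ) ⊓ ae volume, x ∈ S := mem_inf_of_right hS
    filter_upwards [h1, h2] with x h1 h2 using ⟨⟨h2, h1.1, h1.2.trans_le hε1⟩, h1.2⟩
  set g : ℝ → ℝ := fun x => G x - C * x with hg
  have hne : (g '' S').Nonempty := by
    obtain ⟨x, hx⟩ := (hmem 1 one_pos le_rfl).exists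
    exact ⟨g x, x, hx.1, rfl⟩
  have hbdd : BddAbove (g '' S') := by
    refine ⟨M + |C|, ?_⟩
    rintro _ ⟨x, hx, rfl⟩
    have h1 := (abs_le.1 (hM x)).2
    have h2 : |C * x| ≤ |C| := by
      rw [abs_mul, abs_of_pos hx.2.1]
      exact mul_le_of_le_one_right (abs_nonneg _) hx.2.2.le
    have h3 := (abs_le.1 h2).1
    simp only [hg]; linarith
  have hlim : Tendsto g (𝓝[>] (0 : ℝ) ⊓ ae volume) (𝓝 (sSup (g '' S'))) := by
    rw [Metric.tendsto_nhds]
    intro ε hε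
    obtain ⟨_, ⟨x0, hx0, rfl⟩, hlt⟩ := exists_lt_of_lt_csSup hne (sub_lt_self _ hε)
    filter_upwards [hmem x0 hx0.2.1 hx0.2.2.le] with x hx
    have h1 : g x ≤ sSup (g '' S') := le_csSup hbdd ⟨x, hx.1, rfl⟩
    have h2 := hG x hx.1 x0 hx0 hx.2
    have h3 : g x0 ≤ g x := by simp only [hg]; linarith
    rw [Real.dist_eq, abs_lt]
    constructor <;> linarith
  refine ⟨sSup (g '' S') + C * 0, ?_⟩
  have hid : Tendsto (fun x : ℝ => x) (𝓝[>] (0 : ℝ) ⊓ ae volume) (𝓝 0) :=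
    (tendsto_id.mono_left inf_le_left).mono_right nhdsWithin_le_nhds
  refine (hlim.add (hid.const_mul C)).congr fun x => ?_
  simp [hg]

/-- Limits exist as soon as they exist up to arbitrarily small errors. -/
lemma exists_tendsto_of_forall_approx {ι : Type*} {l : Filter ι} [l.NeBot] {f : ι → ℝ}
    (h : ∀ ε > 0, ∃ (g : ι → ℝ) (b : ℝ), Tendsto g l (𝓝 b) ∧ ∀ᶠ i in l, |f i - g i| ≤ ε) :
    ∃ a, Tendsto f l (𝓝 a) := by
  apply cauchy_map_iff_exists_tendsto.1
  rw [Metric.cauchy_iff]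
  refine ⟨inferInstance, fun ε hε => ?_⟩
  obtain ⟨g, b, hg, hfg⟩ := h (ε / 5) (by positivity)
  have hev : ∀ᶠ i in l, |f i - b| ≤ 2 * (ε / 5) := by
    filter_upwards [hfg, eventually_abs_sub_le hg (show 0 < ε / 5 by positivity)] with i h1 h2
    have := abs_sub_le (f i) (g i) b
    linarith
  refine ⟨f '' {i | |f i - b| ≤ 2 * (ε / 5)}, image_mem_map hev, ?_⟩
  rintro _ ⟨i, hi, rfl⟩ _ ⟨k, hk, rfl⟩
  rw [Real.dist_eq]
  have h1 : |f i - b| ≤ 2 * (ε / 5) := hi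
  have h2 : |f k - b| ≤ 2 * (ε / 5) := hk
  have := abs_sub_le (f i) b (f k)
  rw [abs_sub_comm b (f k)] at this
  linarith

/-! ### Weak traces of entropy solutions. -/

open Polynomial in
/-- A bounded measurable function on the plane satisfying the entropy inequality on
`(0,T) × (0,1)` for polynomial entropies. -/
structure IsEntropySolution (p T : ℝ) (u : ℝ × ℝ → ℝ) : Prop where
  measurable : Measurable u
  mem_Icc : ∀ z, u z ∈ Icc (0 : ℝ) 1
  entropy : ∀ F Q : ℝ[X], derivative Q = (1 - 2 * X) * derivative F →
    (∀ w ∈ Icc (0 : ℝ) 1, 0 ≤ (derivative (derivative F)).eval w) →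
    ∀ θ : ℝ × ℝ → ℝ, ContDiff ℝ ∞ θ → HasCompactSupport θ → tsupport θ ⊆ Ioo 0 T ×ˢ Ioo 0 1 →
      (∀ z, 0 ≤ θ z) →
      0 ≤ ∫ z, (F.eval (u z) * fderiv ℝ θ z (1, 0) + p * (Q.eval (u z) * fderiv ℝ θ z (0, 1)))

lemma fderiv_mul_prod {φ χ : ℝ → ℝ} (hφ : Differentiable ℝ φ) (hχ : Differentiable ℝ χ)
    (z : ℝ × ℝ) :
    fderiv ℝ (fun z : ℝ × ℝ => φ z.1 * χ z.2) z (1, 0) = deriv φ z.1 * χ z.2 ∧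
    fderiv ℝ (fun z : ℝ × ℝ => φ z.1 * χ z.2) z (0, 1) = φ z.1 * deriv χ z.2 := by
  have h1 : HasFDerivAt (fun z : ℝ × ℝ => φ z.1) _ z :=
    (hφ z.1).hasDerivAt.hasFDerivAt.comp z hasFDerivAt_fst
  have h2 : HasFDerivAt (fun z : ℝ × ℝ => χ z.2) _ z :=
    (hχ z.2).hasDerivAt.hasFDerivAt.comp z hasFDerivAt_snd
  have h3 := (h1.mul h2).fderiv
  have h4 : fderiv ℝ (fun z : ℝ × ℝ => φ z.1 * χ z.2) z = _ := h3
  constructor <;> simp [h4, mul_comm]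

lemma hasCompactSupport_mul_prod {φ χ : ℝ → ℝ} (hφ : HasCompactSupport φ)
    (hχ : HasCompactSupport χ) : HasCompactSupport (fun z : ℝ × ℝ => φ z.1 * χ z.2) ∧
      tsupport (fun z : ℝ × ℝ => φ z.1 * χ z.2) ⊆ tsupport φ ×ˢ tsupport χ := by
  have hsub : tsupport (fun z : ℝ × ℝ => φ z.1 * χ z.2) ⊆ tsupport φ ×ˢ tsupport χ := by
    refine closure_minimal (fun z hz => ?_) ((isClosed_tsupport _).prod (isClosed_tsupport _))
    have hz' : φ z.1 * χ z.2 ≠ 0 := hz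
    exact ⟨subset_tsupport _ (left_ne_zero_of_mul hz'), subset_tsupport _ (right_ne_zero_of_mul hz')⟩
  exact ⟨(hφ.isCompact.prod hχ.isCompact).of_isClosed_subset (isClosed_tsupport _) hsub, hsub⟩

/-- A smooth step function with derivative a bump: its translates produce smooth bumps
approximating indicators of intervals. -/
lemma exists_smooth_trapezoid (ρ : ContDiffBump (0 : ℝ)) {x y : ℝ} (hxy : x < y) :
    ∃ χ : ℝ → ℝ, ContDiff ℝ ∞ χ ∧ tsupport χ ⊆ Icc (x - ρ.rOut) (y + ρ.rOut) ∧
      (∀ ξ, 0 ≤ χ ξ) ∧ (∀ ξ, χ ξ ≤ 1) ∧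
      ∀ ξ, deriv χ ξ = ρ.normed volume (x - ξ) - ρ.normed volume (y - ξ) := by
  have hc : Continuous (ρ.normed volume) := ρ.continuous_normed
  have hii : ∀ a b, IntervalIntegrable (ρ.normed volume) volume a b := fun a b =>
    hc.intervalIntegrable _ _
  set R : ℝ → ℝ := fun ξ => ∫ η in (0 : ℝ)..ξ, ρ.normed volume η with hR
  have hRd : ∀ ξ, HasDerivAt R (ρ.normed volume ξ) ξ := fun ξ => hc.integral_hasStrictDerivAt 0 ξ
    |>.hasDerivAt
  have hRs : ContDiff ℝ ∞ R := by
    rw [contDiff_infty_iff_deriv]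
    refine ⟨fun ξ => (hRd ξ).differentiableAt, ?_⟩
    rw [show deriv R = ρ.normed volume from funext fun ξ => (hRd ξ).deriv]
    exact ρ.contDiff_normed
  have hdiff : ∀ a b, R b - R a = ∫ η in a..b, ρ.normed volume η := fun a b =>
    intervalIntegral.integral_interval_sub_left (hii _ _) (hii _ _)
  have hle1 : ∀ a b, a ≤ b → R b - R a ≤ 1 := fun a b hab => by
    rw [hdiff, intervalIntegral.integral_of_le hab, ← ρ.integral_normed (μ := volume)]
    exact setIntegral_le_integral ρ.integrable_normed
      (Eventually.of_forall fun η => ρ.nonneg_normed η)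
  have hge0 : ∀ a b, a ≤ b → 0 ≤ R b - R a := fun a b hab => by
    rw [hdiff]
    exact intervalIntegral.integral_nonneg hab fun η _ => ρ.nonneg_normed η
  have hzero : ∀ a b, a ≤ b → (b ≤ -ρ.rOut ∨ ρ.rOut ≤ a) → R b - R a = 0 := by
    intro a b hab h
    rw [hdiff]
    refine intervalIntegral.integral_zero_ae (Eventually.of_forall fun η hη => ?_)
    rw [uIoc_of_le hab] at hη
    have : η ∉ Function.support (ρ.normed volume) := by
      rw [ρ.support_normed_eq, mem_ball_zero_iff, Real.norm_eq_abs, not_lt, le_abs]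
      rcases h with h | h
      · right; linarith [hη.2]
      · left; linarith [hη.1]
    simpa using this
  -- A difference of two translates of the bump's primitive. Evenness of the bump gives the
  -- derivative in the reflected form used by convolutions.
  refine ⟨fun ξ => R (ξ - x) - R (ξ - y), ?_, ?_, ?_, ?_, ?_⟩
  · exact (hRs.comp (contDiff_id.sub contDiff_const)).sub
      (hRs.comp (contDiff_id.sub contDiff_const))
  · refine closure_minimal (fun ξ hξ => ?_) isClosed_Icc
    by_contra h
    refine hξ (hzero _ _ (by linarith) ?_)
    rw [mem_Icc, not_and_or, not_le, not_le] at h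
    rcases h with h | h
    · left; linarith
    · right; linarith
  · exact fun ξ => hge0 _ _ (by linarith)
  · exact fun ξ => hle1 _ _ (by linarith)
  · intro ξ
    have h1 := (hRd (ξ - x)).comp ξ ((hasDerivAt_id ξ).sub_const x)
    have h2 := (hRd (ξ - y)).comp ξ ((hasDerivAt_id ξ).sub_const y)
    have h3 : HasDerivAt (fun ξ => R (ξ - x) - R (ξ - y)) _ ξ := h1.sub h2
    rw [h3.deriv, ← ρ.normed_neg (x - ξ), ← ρ.normed_neg (y - ξ)]
    simp

open Polynomial

lemma Polynomial.derivative_sum_pair {m : ℕ} {F Q : Fin m → ℝ[X]}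
    (h : ∀ j, derivative (Q j) = (1 - 2 * X) * derivative (F j)) :
    derivative (∑ j, Q j) = (1 - 2 * X) * derivative (∑ j, F j) := by
  simp [h, Finset.mul_sum]

/-- The reference pair with entropy w²: its second derivative is the constant 2, so multiples of it
make any polynomial entropy convex on the unit interval. -/
lemma Polynomial.derivative_square_flux :
    derivative (X ^ 2 - C (4 / 3 : ℝ) * X ^ 3 : ℝ[X]) = (1 - 2 * X) * derivative (X ^ 2) := by
  simp only [derivative_sub, derivative_mul, derivative_C, derivative_X_pow, zero_mul, zero_add,
    Nat.cast_ofNat, map_ofNat]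
  have : (C (4 / 3 : ℝ) * (3 * X ^ 2) : ℝ[X]) = 4 * X ^ 2 := by
    rw [show (3 : ℝ[X]) = C 3 from rfl, ← mul_assoc, ← C_mul]; norm_num
    rw [show (4 : ℝ[X]) = C 4 from rfl]
  norm_num [this]
  ring

namespace IsEntropySolution

variable {p T : ℝ} {u : ℝ × ℝ → ℝ}

lemma measurable_eval (H : IsEntropySolution p T u) (h : ℝ[X]) :
    Measurable fun z => h.eval (u z) := h.continuous.measurable.comp H.measurable

lemma measurable_slice (H : IsEntropySolution p T u) (h : ℝ[X]) (x : ℝ) :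
    Measurable fun t => h.eval (u (t, x)) :=
  (H.measurable_eval h).comp (measurable_id.prodMk measurable_const)

lemma integrable_slice_mul (H : IsEntropySolution p T u) (h : ℝ[X]) (x : ℝ) {μ : Measure ℝ}
    {φ : ℝ → ℝ} (hφ : Integrable φ μ) : Integrable (fun t => φ t * h.eval (u (t, x))) μ := by
  obtain ⟨M, -, hM⟩ := h.exists_abs_eval_le
  exact hφ.mul_bdd (c := M) (H.measurable_slice h x).aestronglyMeasurable
    (Eventually.of_forall fun t => hM _ (H.mem_Icc _))

lemma abs_slice_le (H : IsEntropySolution p T u) {h : ℝ[X]} {M : ℝ}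
    (hM : ∀ w ∈ Icc (0 : ℝ) 1, |h.eval w| ≤ M) (x : ℝ) {μ : Measure ℝ}
    {φ : ℝ → ℝ} (hφ : Integrable φ μ) :
    |∫ t, φ t * h.eval (u (t, x)) ∂μ| ≤ M * ∫ t, |φ t| ∂μ := by
  rw [← integral_const_mul]
  refine abs_integral_le_integral_abs.trans (integral_mono_of_nonneg
    (Eventually.of_forall fun _ => abs_nonneg _) (hφ.abs.const_mul M)
    (Eventually.of_forall fun t => ?_))
  simp only [abs_mul]
  rw [mul_comm]
  exact mul_le_mul_of_nonneg_right (hM _ (H.mem_Icc _)) (abs_nonneg _)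

lemma measurable_integral_slice (H : IsEntropySolution p T u) (h : ℝ[X]) {φ : ℝ → ℝ}
    (hφ : Measurable φ) : Measurable fun x => ∫ t, φ t * h.eval (u (t, x)) := by
  have hm : Measurable fun z : ℝ × ℝ => φ z.1 * h.eval (u z) :=
    (hφ.comp measurable_fst).mul (H.measurable_eval h)
  exact (hm.stronglyMeasurable.integral_prod_left').measurable

/-- Slices of an entropy flux have an essential limit at the boundary, convex case. -/
lemma exists_essLim_of_convex (H : IsEntropySolution p T u) (hp : 0 < p) {F Q : ℝ[X]}
    (hFQ : derivative Q = (1 - 2 * X) * derivative F)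
    (hconv : ∀ w ∈ Icc (0 : ℝ) 1, 0 ≤ (derivative (derivative F)).eval w) {φ : ℝ → ℝ}
    (hφ : ContDiff ℝ ∞ φ) (hφc : HasCompactSupport φ) (hφT : tsupport φ ⊆ Ioo 0 T)
    (hφ0 : ∀ t, 0 ≤ φ t) : ∃ L, EssLimZero (fun x => ∫ t, φ t * Q.eval (u (t, x))) L := by
  obtain ⟨MF, hMF0, hMF⟩ := F.exists_abs_eval_le
  obtain ⟨MQ, hMQ0, hMQ⟩ := Q.exists_abs_eval_le
  have hφi : Integrable φ := hφ.continuous.integrable_of_hasCompactSupport hφc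
  have hφ'c : Continuous (deriv φ) := hφ.continuous_deriv (by simp)
  have hφ'i : Integrable (deriv φ) := hφ'c.integrable_of_hasCompactSupport hφc.deriv
  set G : ℝ → ℝ := fun x => ∫ t, φ t * Q.eval (u (t, x)) with hG
  set A : ℝ → ℝ := fun x => ∫ t, deriv φ t * F.eval (u (t, x)) with hA
  set CA := MF * ∫ t, |deriv φ t| with hCA
  have hA1 : ∀ x, |A x| ≤ CA := fun x => H.abs_slice_le hMF x hφ'i
  have hG1 : ∀ x, |G x| ≤ MQ * ∫ t, |φ t| := fun x => H.abs_slice_le hMQ x hφi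
  have hCA0 : 0 ≤ CA := (abs_nonneg _).trans (hA1 0)
  have hGm : Measurable G := H.measurable_integral_slice Q hφ.continuous.measurable
  have hAm : Measurable A := H.measurable_integral_slice F hφ'c.measurable
  have hGli : LocallyIntegrable G := (locallyIntegrable_const (MQ * ∫ t, |φ t|)).mono
    hGm.aestronglyMeasurable (Eventually.of_forall fun x => by
      simpa using (hG1 x).trans (le_abs_self _))
  -- testing with products
  have hprod : ∀ χ : ℝ → ℝ, ContDiff ℝ ∞ χ → HasCompactSupport χ → tsupport χ ⊆ Ioo 0 1 →
      (∀ x, 0 ≤ χ x) → 0 ≤ (∫ x, A x * χ x) + p * ∫ x, G x * deriv χ x := by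
    intro χ hχ hχc hχ1 hχ0
    obtain ⟨hc, hsub⟩ := hasCompactSupport_mul_prod hφc hχc
    have hs : ContDiff ℝ ∞ fun z : ℝ × ℝ => φ z.1 * χ z.2 :=
      (hφ.comp contDiff_fst).mul (hχ.comp contDiff_snd)
    have h := H.entropy F Q hFQ hconv (fun z => φ z.1 * χ z.2) hs hc
      (hsub.trans (prod_mono hφT hχ1)) (fun z => mul_nonneg (hφ0 _) (hχ0 _))
    have hi1 : Integrable (fun z : ℝ × ℝ => F.eval (u z) *
        fderiv ℝ (fun z : ℝ × ℝ => φ z.1 * χ z.2) z (1, 0)) :=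
      F.integrable_eval_mul H.measurable H.mem_Icc (hs.continuous_fderiv_apply_const _)
        (hc.fderiv_apply_const _)
    have hi2 : Integrable (fun z : ℝ × ℝ => Q.eval (u z) *
        fderiv ℝ (fun z : ℝ × ℝ => φ z.1 * χ z.2) z (0, 1)) :=
      Q.integrable_eval_mul H.measurable H.mem_Icc (hs.continuous_fderiv_apply_const _)
        (hc.fderiv_apply_const _)
    rw [integral_add hi1 (hi2.const_mul p), integral_const_mul] at h
    have hd := fderiv_mul_prod (hφ.differentiable (by simp)) (hχ.differentiable (by simp))
    rw [Measure.volume_eq_prod] at h hi1 hi2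
    rw [integral_prod_symm _ hi1, integral_prod_symm _ hi2] at h
    convert h using 2
    · refine integral_congr_ae (Eventually.of_forall fun x => ?_)
      simp only [hA, (hd _).1]
      rw [← integral_mul_const]
      refine integral_congr_ae (Eventually.of_forall fun t => ?_)
      simp only
      ring
    · congr 1
      refine integral_congr_ae (Eventually.of_forall fun x => ?_)
      simp only [hG, (hd _).2]
      rw [← integral_mul_const]
      refine integral_congr_ae (Eventually.of_forall fun t => ?_)
      simp only
      ring
  -- The good heights are those where mollifications of G converge to G. Testing with a smooth
  -- trapezoid between two such heights yields the one-sided Lipschitz inequality in the limit.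
  have hS : ∀ᵐ x, Tendsto (fun i => MeasureTheory.convolution
      ((shrinkingBump i : ContDiffBump (0 : ℝ)).normed volume) G
      (ContinuousLinearMap.lsmul ℝ ℝ) volume x) atTop (𝓝 (G x)) :=
    ContDiffBump.ae_convolution_tendsto_right_of_locallyIntegrable (K := 2)
      tendsto_shrinkingBump_rOut (Eventually.of_forall shrinkingBump_rOut_le_two_mul) hGli
  refine exists_essLimZero_of_ae_antitone (C := CA / p) hG1 hS ?_
  rintro x ⟨hxS, hx⟩ y ⟨hyS, hy⟩ hxy
  have hlim := ((hxS.sub hyS).const_mul p).add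
    (((tendsto_shrinkingBump_rOut (E := ℝ)).const_mul (2 * CA)).add_const (CA * (y - x)))
  have hr : ∀ᶠ i in atTop, (shrinkingBump i : ContDiffBump (0 : ℝ)).rOut < min x (1 - y) :=
    tendsto_shrinkingBump_rOut.eventually_lt_const (lt_min hx.1 (by linarith [hy.2]))
  have hfin := ge_of_tendsto hlim (b := 0) (hr.mono fun i hi => ?_)
  · have : p * (-(CA / p * (y - x))) ≤ p * (G x - G y) := by
      have e : p * (-(CA / p * (y - x))) = -(CA * (y - x)) := by field_simp
      rw [e]; linarith
    exact le_of_mul_le_mul_left this hp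
  · set ρ : ContDiffBump (0 : ℝ) := shrinkingBump i with hρ
    have hi1 := hi.trans_le (min_le_left _ _)
    have hi2 := hi.trans_le (min_le_right _ _)
    obtain ⟨χ, hχs, hχsupp, hχ0, hχ1, hχd⟩ := exists_smooth_trapezoid ρ hxy
    have hχc : HasCompactSupport χ :=
      isCompact_Icc.of_isClosed_subset (isClosed_tsupport _) hχsupp
    have h := hprod χ hχs hχc (hχsupp.trans fun ξ hξ =>
      ⟨by linarith [hξ.1], by linarith [hξ.2]⟩) hχ0
    have hAχ : ∫ x, A x * χ x ≤ CA * (y - x + 2 * ρ.rOut) := by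
      have h1 : ∀ ξ, A ξ * χ ξ ≤ (Icc (x - ρ.rOut) (y + ρ.rOut)).indicator (fun _ => CA) ξ := by
        intro ξ
        by_cases hξ : ξ ∈ Icc (x - ρ.rOut) (y + ρ.rOut)
        · rw [indicator_of_mem hξ]
          have := (abs_le.1 (hA1 ξ)).2
          nlinarith [hχ0 ξ, hχ1 ξ]
        · rw [indicator_of_notMem hξ, image_eq_zero_of_notMem_tsupport fun h => hξ (hχsupp h)]
          simp
      calc ∫ x, A x * χ x ≤ ∫ ξ, (Icc (x - ρ.rOut) (y + ρ.rOut)).indicator (fun _ => CA) ξ := by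
            refine integral_mono ?_ ?_ h1
            · exact integrable_bdd_mul hAm.aestronglyMeasurable hA1 hχs.continuous hχc
            · rw [integrable_indicator_iff measurableSet_Icc]
              simp
        _ = CA * (y - x + 2 * ρ.rOut) := by
            rw [integral_indicator measurableSet_Icc]
            simp only [integral_const, measureReal_restrict_apply_univ, Real.volume_real_Icc,
              smul_eq_mul]
            rw [max_eq_left (by linarith [ρ.rOut_pos])]
            ring
    have hconv : ∀ a, MeasureTheory.convolution (ρ.normed volume) G
        (ContinuousLinearMap.lsmul ℝ ℝ) volume a = ∫ ξ, G ξ * ρ.normed volume (a - ξ) := fun a => by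
      rw [convolution_eq_swap]
      refine integral_congr_ae (Eventually.of_forall fun z => ?_)
      simp [mul_comm]
    have hint : ∀ a, Integrable fun ξ => G ξ * ρ.normed volume (a - ξ) := fun a =>
      ((ρ.integrable_normed (μ := volume)).comp_sub_left a).bdd_mul hGm.aestronglyMeasurable
        (Eventually.of_forall hG1)
    have hGχ : ∫ ξ, G ξ * deriv χ ξ = (∫ ξ, G ξ * ρ.normed volume (x - ξ)) -
        ∫ ξ, G ξ * ρ.normed volume (y - ξ) := by
      rw [← integral_sub (hint x) (hint y)]
      refine integral_congr_ae (Eventually.of_forall fun ξ => ?_)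
      simp only [hχd]; ring
    rw [hGχ] at h
    simp only [hconv]
    linarith

end IsEntropySolution

lemma exists_cutoff {T δ : ℝ} (hδ : 0 < δ) (hδT : 4 * δ < T) :
    ∃ Ψ : ℝ → ℝ, ContDiff ℝ ∞ Ψ ∧ HasCompactSupport Ψ ∧ tsupport Ψ ⊆ Ioo 0 T ∧
      (∀ t, 0 ≤ Ψ t) ∧ (∀ t, Ψ t ≤ 1) ∧ ∀ t ∈ Icc (2 * δ) (T - 2 * δ), Ψ t = 1 := by
  let Ψ : ContDiffBump (T / 2) := ⟨T / 2 - 2 * δ, T / 2 - δ, by linarith, by linarith⟩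
  refine ⟨Ψ, Ψ.contDiff, Ψ.hasCompactSupport, ?_, fun t => Ψ.nonneg, fun t => Ψ.le_one,
    fun t ht => Ψ.one_of_mem_closedBall ?_⟩
  · rw [Ψ.tsupport_eq, Real.closedBall_eq_Icc]
    intro t ht
    have h1 : T / 2 - (T / 2 - δ) ≤ t := ht.1
    have h2 : t ≤ T / 2 + (T / 2 - δ) := ht.2
    constructor <;> linarith
  · rw [Real.closedBall_eq_Icc]
    have h1 : Ψ.rIn = T / 2 - 2 * δ := rfl
    rw [h1]
    constructor <;> linarith [ht.1, ht.2]

/-- Density in `L¹(0,T)` of the smooth functions supported in the open interval. -/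
lemma exists_smooth_approx {T : ℝ} (hT : 0 < T) {f : ℝ → ℝ} (hf : IntegrableOn f (Icc 0 T))
    {ε : ℝ} (hε : 0 < ε) : ∃ φ : ℝ → ℝ, ContDiff ℝ ∞ φ ∧ HasCompactSupport φ ∧
      tsupport φ ⊆ Ioo 0 T ∧ ∫ t in Icc 0 T, |f t - φ t| ≤ ε := by
  have hcut : ∀ n : ℕ, ∃ Ψ : ℝ → ℝ, ContDiff ℝ ∞ Ψ ∧ HasCompactSupport Ψ ∧ tsupport Ψ ⊆ Ioo 0 T ∧
      (∀ t, 0 ≤ Ψ t) ∧ (∀ t, Ψ t ≤ 1) ∧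
      ∀ t ∈ Icc (2 * (T / 8 * (1 / ((n : ℝ) + 1)))) (T - 2 * (T / 8 * (1 / ((n : ℝ) + 1)))),
        Ψ t = 1 := fun n => by
    have h1 : 1 / ((n : ℝ) + 1) ≤ 1 := by
      rw [div_le_one (by positivity)]; linarith [(Nat.cast_nonneg n : (0 : ℝ) ≤ n)]
    refine exists_cutoff (by positivity) ?_
    have := mul_le_mul_of_nonneg_left h1 (show 0 ≤ T / 8 by positivity)
    linarith
  choose Ψ hΨs hΨc hΨT hΨ0 hΨ1 hΨ using hcut
  have hlim : Tendsto (fun n => ∫ t in Icc 0 T, |f t| * (1 - Ψ n t)) atTop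
      (𝓝 (∫ t in Icc 0 T, (0 : ℝ))) := by
    refine tendsto_integral_of_dominated_convergence (fun t => |f t|) ?_ hf.abs ?_ ?_
    · exact fun n => hf.abs.aestronglyMeasurable.mul
        (continuous_const.sub (hΨs n).continuous).aestronglyMeasurable
    · intro n
      refine Eventually.of_forall fun t => ?_
      rw [norm_mul, Real.norm_eq_abs, Real.norm_eq_abs, abs_abs,
        abs_of_nonneg (a := 1 - Ψ n t) (by linarith [hΨ1 n t])]
      exact mul_le_of_le_one_right (abs_nonneg _) (by linarith [hΨ0 n t])
    · rw [← restrict_Ioo_eq_restrict_Icc]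
      refine (ae_restrict_iff' measurableSet_Ioo).2 (Eventually.of_forall fun t ht => ?_)
      refine tendsto_const_nhds.congr' ?_
      have h1 : Tendsto (fun n : ℕ => 2 * (T / 8 * (1 / ((n : ℝ) + 1)))) atTop (𝓝 0) := by
        simpa using (tendsto_one_div_add_atTop_nhds_zero_nat.const_mul (T / 8)).const_mul 2
      filter_upwards [h1.eventually_lt_const ht.1, h1.eventually_lt_const (sub_pos.2 ht.2)]
        with n h2 h3
      rw [hΨ n t ⟨h2.le, by linarith⟩]; simp
  rw [integral_zero] at hlim
  obtain ⟨n, hn⟩ := (hlim.eventually_lt_const (half_pos hε)).exists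
  have hfi : Integrable ((Icc 0 T).indicator f) := (integrable_indicator_iff measurableSet_Icc).2 hf
  obtain ⟨g, hgc, hgs, hg⟩ := (memLp_one_iff_integrable.2 hfi).exist_eLpNorm_sub_le
    ENNReal.one_ne_top le_rfl (half_pos hε)
  have hgi : Integrable g := hgs.continuous.integrable_of_hasCompactSupport hgc
  have hfg : ∫ t in Icc 0 T, |f t - g t| ≤ ε / 2 := by
    have h1 : ∫ t, |((Icc 0 T).indicator f) t - g t| ≤ ε / 2 := by
      rw [eLpNorm_one_eq_lintegral_enorm] at hg
      have h2 := integral_norm_eq_lintegral_enorm (hfi.sub hgi).aestronglyMeasurable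
      have h3 : ∫ t, |((Icc 0 T).indicator f) t - g t| =
          (∫⁻ t, ‖((Icc 0 T).indicator f - g) t‖ₑ).toReal := h2
      rw [h3]
      exact ENNReal.toReal_le_of_le_ofReal (half_pos hε).le hg
    calc ∫ t in Icc 0 T, |f t - g t| = ∫ t in Icc 0 T, |((Icc 0 T).indicator f) t - g t| :=
          setIntegral_congr_fun measurableSet_Icc fun t ht => by simp [ht]
      _ ≤ ∫ t, |((Icc 0 T).indicator f) t - g t| :=
          setIntegral_le_integral (hfi.sub hgi).abs (Eventually.of_forall fun _ => abs_nonneg _)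
      _ ≤ ε / 2 := h1
  refine ⟨fun t => g t * Ψ n t, hgs.mul (hΨs n), (hΨc n).mul_left,
    (tsupport_mul_subset_right).trans (hΨT n), ?_⟩
  have hb : ∀ t, |f t - g t * Ψ n t| ≤ |f t| * (1 - Ψ n t) + |f t - g t| := fun t => by
    have e : f t - g t * Ψ n t = f t * (1 - Ψ n t) + (f t - g t) * Ψ n t := by ring
    rw [e]
    refine (abs_add_le _ _).trans ?_
    rw [abs_mul, abs_mul, abs_of_nonneg (hΨ0 n t),
      abs_of_nonneg (show 0 ≤ 1 - Ψ n t by linarith [hΨ1 n t])]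
    have := mul_le_of_le_one_right (abs_nonneg (f t - g t)) (hΨ1 n t)
    linarith
  have hi1 : IntegrableOn (fun t => |f t| * (1 - Ψ n t)) (Icc 0 T) := by
    refine hf.abs.mul_bdd (c := 1) (continuous_const.sub (hΨs n).continuous).aestronglyMeasurable
      (Eventually.of_forall fun t => ?_)
    rw [Real.norm_eq_abs, abs_le]; constructor <;> linarith [hΨ0 n t, hΨ1 n t]
  have hi2 : IntegrableOn (fun t => |f t - g t|) (Icc 0 T) := (hf.sub hgi.integrableOn).abs
  calc ∫ t in Icc 0 T, |f t - g t * Ψ n t|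
      ≤ ∫ t in Icc 0 T, (|f t| * (1 - Ψ n t) + |f t - g t|) :=
        integral_mono_of_nonneg (Eventually.of_forall fun _ => abs_nonneg _) (hi1.add hi2)
          (Eventually.of_forall hb)
    _ = (∫ t in Icc 0 T, |f t| * (1 - Ψ n t)) + ∫ t in Icc 0 T, |f t - g t| :=
        integral_add hi1 hi2
    _ ≤ ε := by linarith

namespace IsEntropySolution

variable {p T : ℝ} {u : ℝ × ℝ → ℝ}

/-- Convexity is not needed: F + M w² and M w² are both convex when M bounds |F''|, and subtracting
their limits leaves that of Q. -/
lemma exists_essLim_pair (H : IsEntropySolution p T u) (hp : 0 < p) {F Q : ℝ[X]}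
    (hFQ : derivative Q = (1 - 2 * X) * derivative F) {φ : ℝ → ℝ}
    (hφ : ContDiff ℝ ∞ φ) (hφc : HasCompactSupport φ) (hφT : tsupport φ ⊆ Ioo 0 T)
    (hφ0 : ∀ t, 0 ≤ φ t) : ∃ L, EssLimZero (fun x => ∫ t, φ t * Q.eval (u (t, x))) L := by
  obtain ⟨M, hM0, hM⟩ := (derivative (derivative F)).exists_abs_eval_le
  have hφi : Integrable φ := hφ.continuous.integrable_of_hasCompactSupport hφc
  have hsq := derivative_square_flux
  obtain ⟨L1, h1⟩ := H.exists_essLim_of_convex hp (F := F + C M * X ^ 2)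
    (Q := Q + C M * (X ^ 2 - C (4 / 3) * X ^ 3)) (by
      rw [derivative_add, derivative_C_mul, hsq, hFQ, derivative_add, derivative_C_mul]; ring)
    (fun w hw => by
      have := (abs_le.1 (hM w hw)).1
      simp
      linarith) hφ hφc hφT hφ0
  obtain ⟨L2, h2⟩ := H.exists_essLim_of_convex hp (F := C M * X ^ 2)
    (Q := C M * (X ^ 2 - C (4 / 3) * X ^ 3)) (by
      rw [derivative_C_mul, hsq, derivative_C_mul]; ring)
    (fun w hw => by simp; linarith) hφ hφc hφT hφ0
  refine ⟨L1 - L2, (h1.sub h2).congr fun x => ?_⟩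
  rw [← integral_sub (H.integrable_slice_mul _ x hφi) (H.integrable_slice_mul _ x hφi)]
  refine integral_congr_ae (Eventually.of_forall fun t => ?_)
  simp only [eval_add]
  ring

/-- Fluxes plus constants are uniformly dense among polynomials by `exists_flux_decomposition`, and
existence of limits survives uniform approximation. A constant added to Q leaves the pair relation
unchanged. -/
lemma exists_essLim_nonneg (H : IsEntropySolution p T u) (hp : 0 < p) (h : ℝ[X]) {φ : ℝ → ℝ}
    (hφ : ContDiff ℝ ∞ φ) (hφc : HasCompactSupport φ) (hφT : tsupport φ ⊆ Ioo 0 T)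
    (hφ0 : ∀ t, 0 ≤ φ t) : ∃ L, EssLimZero (fun x => ∫ t, φ t * h.eval (u (t, x))) L := by
  have hφi : Integrable φ := hφ.continuous.integrable_of_hasCompactSupport hφc
  have hI0 : 0 ≤ ∫ t, |φ t| := integral_nonneg fun _ => abs_nonneg _
  refine exists_tendsto_of_forall_approx fun ε hε => ?_
  obtain ⟨m, F, Q, c, δ, hFQ, happ, -, -⟩ := exists_flux_decomposition h
    (η := ε / ((∫ t, |φ t|) + 1)) (by positivity)
  obtain ⟨L, hL⟩ := H.exists_essLim_pair hp (F := ∑ j, F j) (Q := C (h.eval 0) + ∑ j, Q j)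
    (by rw [derivative_add, derivative_C, zero_add]; exact derivative_sum_pair hFQ) hφ hφc hφT hφ0
  refine ⟨_, L, hL, Eventually.of_forall fun x => ?_⟩
  rw [← integral_sub (H.integrable_slice_mul _ x hφi) (H.integrable_slice_mul _ x hφi)]
  have := H.abs_slice_le (h := h - (C (h.eval 0) + ∑ j, Q j)) (M := ε / ((∫ t, |φ t|) + 1))
    (fun w hw => by
      have := happ w hw
      simp only [eval_sub, eval_add, eval_C, eval_finsetSum]
      rwa [← sub_sub]) x hφi
  simp only [eval_sub, mul_sub] at this
  refine this.trans ?_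
  rw [div_mul_eq_mul_div, div_le_iff₀ (by positivity)]
  nlinarith

/-- A signed test function is a difference of nonnegative ones: φ = (φ + MΨ) - MΨ, with Ψ a cutoff
equal to one on the support of φ and M a bound for |φ|. -/
lemma exists_essLim_smooth (H : IsEntropySolution p T u) (hp : 0 < p) (h : ℝ[X])
    {φ : ℝ → ℝ} (hφ : ContDiff ℝ ∞ φ) (hφc : HasCompactSupport φ) (hφT : tsupport φ ⊆ Ioo 0 T) :
    ∃ L, EssLimZero (fun x => ∫ t, φ t * h.eval (u (t, x))) L := by
  have hφi : Integrable φ := hφ.continuous.integrable_of_hasCompactSupport hφc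
  obtain ⟨Ψ, hΨs, hΨ1, hΨ0, hΨm, hΨc⟩ : ∃ Ψ : ℝ → ℝ, ContDiff ℝ ∞ Ψ ∧
      (∀ t ∈ tsupport φ, Ψ t = 1) ∧ (∀ t, 0 ≤ Ψ t) ∧ tsupport Ψ ⊆ Ioo 0 T ∧
      HasCompactSupport Ψ := by
    rcases (tsupport φ).eq_empty_or_nonempty with he | hne
    · exact ⟨fun _ => 0, contDiff_const, by simp [he], by simp, by simp [tsupport],
        HasCompactSupport.zero⟩
    obtain ⟨a, ha, hamin⟩ := hφc.isCompact.exists_isLeast hne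
    obtain ⟨b, hb, hbmax⟩ := hφc.isCompact.exists_isGreatest hne
    have ha' := hφT ha
    have hb' := hφT hb
    obtain ⟨Ψ, h1, h2, h3, h4, h5, h6⟩ := exists_cutoff (T := T) (δ := min a (T - b) / 5)
      (div_pos (lt_min ha'.1 (by linarith [hb'.2])) (by norm_num)) (by
        have := min_le_left a (T - b)
        have := min_le_right a (T - b)
        have := hamin hb
        linarith [ha'.1, ha'.1.trans ha'.2])
    refine ⟨Ψ, h1, fun t ht => h6 t ⟨?_, ?_⟩, h4, h3, h2⟩
    · have := min_le_left a (T - b)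
      linarith [hamin ht, ha'.1]
    · have := min_le_right a (T - b)
      linarith [hbmax ht, hb'.2]
  obtain ⟨M, hM⟩ := hφ.continuous.bounded_above_of_compact_support hφc
  have hM0 : 0 ≤ M := (norm_nonneg _).trans (hM 0)
  have hΨi : Integrable Ψ := hΨs.continuous.integrable_of_hasCompactSupport hΨc
  obtain ⟨L1, h1⟩ := H.exists_essLim_nonneg hp h (φ := fun t => φ t + M * Ψ t)
    (hφ.add (contDiff_const.mul hΨs)) (hφc.add hΨc.mul_left)
    ((tsupport_add φ (fun t => M * Ψ t)).trans
      (union_subset hφT (tsupport_mul_subset_right.trans hΨm))) (fun t => by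
      by_cases ht : t ∈ tsupport φ
      · rw [hΨ1 t ht]
        have := (abs_le.1 (hM t)).1
        linarith
      · rw [image_eq_zero_of_notMem_tsupport ht]
        have := hΨ0 t
        positivity)
  obtain ⟨L2, h2⟩ := H.exists_essLim_nonneg hp h hΨs hΨc hΨm hΨ0
  have hadd : Integrable fun t => φ t + M * Ψ t := hφi.add (hΨi.const_mul M)
  refine ⟨L1 - M * L2, (h1.sub (h2.const_mul M)).congr fun x => ?_⟩
  rw [← integral_const_mul, ← integral_sub
    (H.integrable_slice_mul h x hadd)
    ((H.integrable_slice_mul h x hΨi).const_mul M)]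
  refine integral_congr_ae (Eventually.of_forall fun t => ?_)
  simp only
  ring

/-- Slices have weak limits at the boundary. -/
lemma exists_essLim (H : IsEntropySolution p T u) (hp : 0 < p) (hT : 0 < T) (h : ℝ[X])
    {f : ℝ → ℝ} (hf : IntegrableOn f (Icc 0 T)) :
    ∃ L, EssLimZero (fun x => ∫ t in Icc 0 T, f t * h.eval (u (t, x))) L := by
  obtain ⟨M, hM0, hM⟩ := h.exists_abs_eval_le
  refine exists_tendsto_of_forall_approx fun ε hε => ?_
  obtain ⟨φ, hφ, hφc, hφT, happ⟩ := exists_smooth_approx hT hf (ε := ε / (M + 1)) (by positivity)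
  have hφi : Integrable φ := hφ.continuous.integrable_of_hasCompactSupport hφc
  obtain ⟨L, hL⟩ := H.exists_essLim_smooth hp h hφ hφc hφT
  refine ⟨_, L, hL, Eventually.of_forall fun x => ?_⟩
  have e : ∫ t, φ t * h.eval (u (t, x)) = ∫ t in Icc 0 T, φ t * h.eval (u (t, x)) := by
    rw [setIntegral_eq_integral_of_forall_compl_eq_zero]
    intro t ht
    rw [image_eq_zero_of_notMem_tsupport fun h => ht (Ioo_subset_Icc_self (hφT h)), zero_mul]
  rw [e, ← integral_sub (H.integrable_slice_mul _ x hf)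
    (H.integrable_slice_mul _ x hφi.integrableOn)]
  have := H.abs_slice_le hM x (hf.sub hφi.integrableOn)
  simp only [Pi.sub_apply, sub_mul] at this
  refine this.trans ?_
  calc M * ∫ t in Icc 0 T, |f t - φ t| ≤ M * (ε / (M + 1)) := by gcongr
    _ ≤ ε := by
      rw [mul_div_assoc', div_le_iff₀ (by positivity)]
      nlinarith

end IsEntropySolution

namespace IsEntropySolution

variable {p T : ℝ} {u : ℝ × ℝ → ℝ}

/-- Weak traces of the nonnegative moments, by the Riesz representation theorem. -/
lemma exists_weakTrace (H : IsEntropySolution p T u) (hp : 0 < p) (hT : 0 < T) (h : ℝ[X])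
    (h01 : ∀ w ∈ Icc (0 : ℝ) 1, h.eval w ∈ Icc (0 : ℝ) 1) :
    ∃ m : ℝ → ℝ, Measurable m ∧ (∀ t, m t ∈ Icc (0 : ℝ) 1) ∧
      ∀ f : ℝ → ℝ, MemLp f 2 (volume.restrict (Icc 0 T)) →
        EssLimZero (fun x => ∫ t in Icc 0 T, f t * h.eval (u (t, x)))
          (∫ t in Icc 0 T, f t * m t) := by
  set μ := volume.restrict (Icc 0 T) with hμ
  have hM : ∀ w ∈ Icc (0 : ℝ) 1, |h.eval w| ≤ 1 := fun w hw => by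
    rw [abs_le]; constructor <;> linarith [(h01 w hw).1, (h01 w hw).2]
  have hLi : ∀ f : Lp ℝ 2 μ, Integrable f μ := fun f =>
    (Lp.memLp f).integrable (by norm_num)
  -- The limit exists for each f in L². Uniqueness of limits makes it linear in f, and the finite
  -- measure of [0,T] bounds it by the L² norm, so it is an inner product with some g.
  choose Λ hΛ using fun f : Lp ℝ 2 μ => H.exists_essLim hp hT h (f := f) (hLi f)
  have huniq : ∀ {g : ℝ → ℝ} {a b : ℝ}, EssLimZero g a → EssLimZero g b → a = b :=
    fun ha hb => tendsto_nhds_unique ha hb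
  let Λl : Lp ℝ 2 μ →ₗ[ℝ] ℝ :=
    { toFun := Λ
      map_add' := fun f g => huniq (hΛ (f + g)) (((hΛ f).add (hΛ g)).congr fun x => by
        rw [← integral_add (H.integrable_slice_mul h x (hLi f))
          (H.integrable_slice_mul h x (hLi g))]
        refine integral_congr_ae ?_
        filter_upwards [Lp.coeFn_add f g] with t ht
        rw [ht, Pi.add_apply]; ring)
      map_smul' := fun c f => huniq (hΛ (c • f)) (((hΛ f).const_mul c).congr fun x => by
        rw [← integral_const_mul]
        refine integral_congr_ae ?_
        filter_upwards [Lp.coeFn_smul c f] with t ht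
        rw [ht, Pi.smul_apply, smul_eq_mul]; ring) }
  have hbound : ∀ f : Lp ℝ 2 μ, ‖Λl f‖ ≤ (μ.real univ) ^ (1 / 2 : ℝ) * ‖f‖ := by
    intro f
    have h1 : ∫ t, |f t| ∂μ ≤ (μ.real univ) ^ (1 / 2 : ℝ) * ‖f‖ := by
      have h2 := eLpNorm_le_eLpNorm_mul_rpow_measure_univ (μ := μ) (p := 1) (q := 2)
        (by norm_num) (Lp.aestronglyMeasurable f)
      have h3 : ∫ t, |f t| ∂μ = (eLpNorm f 1 μ).toReal := by
        rw [eLpNorm_one_eq_lintegral_enorm]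
        exact integral_norm_eq_lintegral_enorm (Lp.aestronglyMeasurable f)
      rw [h3, Lp.norm_def, mul_comm, measureReal_def, ENNReal.toReal_rpow, ← ENNReal.toReal_mul]
      refine ENNReal.toReal_mono ?_ (h2.trans (le_of_eq ?_))
      · refine ENNReal.mul_ne_top (Lp.eLpNorm_ne_top f) ?_
        exact ENNReal.rpow_ne_top_of_nonneg (by norm_num) (measure_ne_top _ _)
      · norm_num
    refine le_trans ?_ h1
    refine le_of_tendsto (hΛ f).abs (Eventually.of_forall fun x => ?_)
    simpa using H.abs_slice_le hM x (hLi f)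
  let Λc : Lp ℝ 2 μ →L[ℝ] ℝ := Λl.mkContinuous _ hbound
  set g : Lp ℝ 2 μ := (InnerProductSpace.toDual ℝ (Lp ℝ 2 μ)).symm Λc with hg
  have hgi : Integrable g μ := hLi g
  have hrep : ∀ f : ℝ → ℝ, MemLp f 2 μ →
      EssLimZero (fun x => ∫ t, f t * h.eval (u (t, x)) ∂μ) (∫ t, f t * g t ∂μ) := by
    intro f hf
    have h1 := hΛ hf.toLp
    have h2 : Λ hf.toLp = ∫ t, f t * g t ∂μ := by
      have h3 : Λc hf.toLp = inner ℝ g hf.toLp := by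
        rw [hg, InnerProductSpace.toDual_symm_apply]
      have h4 : Λ hf.toLp = Λc hf.toLp := rfl
      rw [h4, h3, L2.inner_def]
      refine integral_congr_ae ?_
      filter_upwards [hf.coeFn_toLp] with t ht
      simp [ht]
    rw [h2] at h1
    refine h1.congr fun x => integral_congr_ae ?_
    filter_upwards [hf.coeFn_toLp] with t ht
    rw [ht]
  have hind : ∀ s : Set ℝ, MeasurableSet s → MemLp (s.indicator fun _ => (1 : ℝ)) 2 μ :=
    fun s hs => (memLp_const (1 : ℝ)).indicator hs
  have hset : ∀ s : Set ℝ, MeasurableSet s →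
      EssLimZero (fun x => ∫ t in s, h.eval (u (t, x)) ∂μ) (∫ t in s, g t ∂μ) := by
    intro s hs
    have h1 := hrep _ (hind s hs)
    have e : ∀ k : ℝ → ℝ, ∫ t, s.indicator (fun _ => (1 : ℝ)) t * k t ∂μ = ∫ t in s, k t ∂μ := by
      intro k
      rw [← integral_indicator hs]
      refine integral_congr_ae (Eventually.of_forall fun t => ?_)
      by_cases ht : t ∈ s <;> simp [ht]
    rw [e] at h1
    exact h1.congr fun x => e _
  have hsl : ∀ x, Integrable (fun t => h.eval (u (t, x))) μ := fun x => by
    simpa using H.integrable_slice_mul h x (integrable_const (μ := μ) (1 : ℝ))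
  have hg0 : 0 ≤ᵐ[μ] g := by
    refine ae_nonneg_of_forall_setIntegral_nonneg hgi fun s hs _ => ?_
    exact ge_of_tendsto' (hset s hs) fun x => integral_nonneg fun t => (h01 _ (H.mem_Icc _)).1
  have hg1 : 0 ≤ᵐ[μ] fun t => 1 - g t := by
    refine ae_nonneg_of_forall_setIntegral_nonneg ((integrable_const 1).sub hgi) fun s hs _ => ?_
    rw [integral_sub (integrable_const _).integrableOn hgi.integrableOn]
    have : ∫ t in s, g t ∂μ ≤ ∫ t in s, (1 : ℝ) ∂μ := by
      refine le_of_tendsto' (hset s hs) fun x => ?_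
      exact integral_mono (hsl x).integrableOn (integrable_const _).integrableOn
        fun t => (h01 _ (H.mem_Icc _)).2
    linarith
  set g' : ℝ → ℝ := (Lp.aestronglyMeasurable g).mk g with hg'
  have hgm : Measurable g' := (Lp.aestronglyMeasurable g).stronglyMeasurable_mk.measurable
  -- The bounds hold only almost everywhere for g; truncating a measurable version makes them hold
  -- at every t without changing any integral.
  refine ⟨fun t => max 0 (min 1 (g' t)), measurable_const.max (measurable_const.min hgm),
    fun t => ⟨le_max_left _ _, max_le zero_le_one (min_le_left _ _)⟩, fun f hf => ?_⟩
  have h1 := hrep f hf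
  have e : ∫ t, f t * g t ∂μ = ∫ t, f t * max 0 (min 1 (g' t)) ∂μ := by
    refine integral_congr_ae ?_
    filter_upwards [hg0, hg1, (Lp.aestronglyMeasurable g).ae_eq_mk] with t h0 h1 h2
    have h0' : 0 ≤ g t := h0
    have h1' : 0 ≤ 1 - g t := h1
    rw [← hg'] at h2
    rw [← h2, min_eq_right (by linarith), max_eq_right h0']
  rwa [← e]

end IsEntropySolution

/-! ### The functional of boundary moments. -/

/-- The linear functional on polynomials with moments `m i t`. -/
noncomputable def traceFunctional (m : ℕ → ℝ → ℝ) (t : ℝ) : ℝ[X] →ₗ[ℝ] ℝ :=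
  Polynomial.lsum fun i => m i t • LinearMap.id

lemma traceFunctional_apply (m : ℕ → ℝ → ℝ) (t : ℝ) (h : ℝ[X]) :
    traceFunctional m t h = ∑ i ∈ h.support, m i t * h.coeff i := by
  simp [traceFunctional, Polynomial.sum_def]

@[simp] lemma traceFunctional_monomial (m : ℕ → ℝ → ℝ) (t : ℝ) (i : ℕ) (a : ℝ) :
    traceFunctional m t (monomial i a) = m i t * a := by
  rw [traceFunctional, lsum_apply, sum_monomial_index] <;> simp

@[simp] lemma traceFunctional_X_pow (m : ℕ → ℝ → ℝ) (t : ℝ) (i : ℕ) :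
    traceFunctional m t (X ^ i) = m i t := by
  rw [X_pow_eq_monomial, traceFunctional_monomial, mul_one]

@[simp] lemma traceFunctional_X (m : ℕ → ℝ → ℝ) (t : ℝ) : traceFunctional m t X = m 1 t := by
  rw [← monomial_one_one_eq_X, traceFunctional_monomial, mul_one]

/-- The functions `m i` are the weak traces of the powers of `u` at the boundary `x = 0`. -/
structure IsWeakTrace (T : ℝ) (u : ℝ × ℝ → ℝ) (m : ℕ → ℝ → ℝ) : Prop where
  measurable : ∀ i, Measurable (m i)
  mem_Icc : ∀ i t, m i t ∈ Icc (0 : ℝ) 1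
  zero : ∀ t, m 0 t = 1
  essLim : ∀ i (f : ℝ → ℝ), MemLp f 2 (volume.restrict (Icc 0 T)) →
    EssLimZero (fun x => ∫ t in Icc 0 T, f t * u (t, x) ^ i) (∫ t in Icc 0 T, f t * m i t)

lemma IsEntropySolution.exists_isWeakTrace {p T : ℝ} {u : ℝ × ℝ → ℝ}
    (H : IsEntropySolution p T u) (hp : 0 < p) (hT : 0 < T) : ∃ m, IsWeakTrace T u m := by
  choose m h1 h2 h3 using fun i : ℕ => H.exists_weakTrace hp hT (X ^ (i + 1)) fun w hw => by
    simp only [eval_pow, eval_X]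
    exact ⟨pow_nonneg hw.1 _, pow_le_one₀ hw.1 hw.2⟩
  refine ⟨fun i => match i with | 0 => fun _ => 1 | (i + 1) => m i, ?_, ?_, fun _ => rfl, ?_⟩
  · rintro (_ | i)
    · exact measurable_const
    · exact h1 i
  · rintro (_ | i) t
    · simp
    · exact h2 i t
  · rintro (_ | i) f hf
    · simp only [pow_zero]
      exact tendsto_const_nhds
    · simpa using h3 i f hf

namespace IsWeakTrace

variable {p T : ℝ} {u : ℝ × ℝ → ℝ} {m : ℕ → ℝ → ℝ}

lemma map_one (hm : IsWeakTrace T u m) (t : ℝ) : traceFunctional m t 1 = 1 := by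
  rw [← pow_zero X, traceFunctional_X_pow, hm.zero]

lemma measurable_trace (hm : IsWeakTrace T u m) (h : ℝ[X]) :
    Measurable fun t => traceFunctional m t h := by
  simp_rw [traceFunctional_apply]
  exact Finset.measurable_fun_sum _ fun i _ => (hm.measurable i).mul_const _

lemma exists_abs_trace_le (hm : IsWeakTrace T u m) (h : ℝ[X]) :
    ∃ B : ℝ, 0 ≤ B ∧ ∀ t, |traceFunctional m t h| ≤ B := by
  refine ⟨∑ i ∈ h.support, |h.coeff i|, Finset.sum_nonneg fun _ _ => abs_nonneg _, fun t => ?_⟩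
  rw [traceFunctional_apply]
  refine (Finset.abs_sum_le_sum_abs _ _).trans (Finset.sum_le_sum fun i _ => ?_)
  rw [abs_mul, abs_of_nonneg (hm.mem_Icc i t).1]
  exact mul_le_of_le_one_left (abs_nonneg _) (hm.mem_Icc i t).2

lemma integrable_mul_trace (hm : IsWeakTrace T u m) (h : ℝ[X]) {f : ℝ → ℝ} {μ : Measure ℝ}
    (hf : Integrable f μ) : Integrable (fun t => f t * traceFunctional m t h) μ := by
  obtain ⟨B, -, hB⟩ := hm.exists_abs_trace_le h
  exact hf.mul_bdd (c := B) (hm.measurable_trace h).aestronglyMeasurable (Eventually.of_forall hB)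

lemma essLim_eval (hm : IsWeakTrace T u m) (H : IsEntropySolution p T u) (h : ℝ[X]) {f : ℝ → ℝ}
    (hf : MemLp f 2 (volume.restrict (Icc 0 T))) :
    EssLimZero (fun x => ∫ t in Icc 0 T, f t * h.eval (u (t, x)))
      (∫ t in Icc 0 T, f t * traceFunctional m t h) := by
  have hfi : IntegrableOn f (Icc 0 T) := hf.integrable (by norm_num)
  induction h using Polynomial.induction_on' with
  | add P Q hP hQ =>
    have := hP.add hQ
    rw [← integral_add (hm.integrable_mul_trace P hfi) (hm.integrable_mul_trace Q hfi)] at this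
    simp_rw [map_add, mul_add]
    refine this.congr fun x => ?_
    rw [← integral_add (H.integrable_slice_mul P x hfi) (H.integrable_slice_mul Q x hfi)]
    simp_rw [eval_add, mul_add]
  | monomial i a =>
    have e : ∀ k : ℝ → ℝ, ∫ t in Icc 0 T, f t * (k t * a) = a * ∫ t in Icc 0 T, f t * k t := by
      intro k
      rw [← integral_const_mul]
      exact integral_congr_ae (Eventually.of_forall fun t => by simp only; ring)
    have := (hm.essLim i f hf).const_mul a
    rw [← e] at this
    simp only [traceFunctional_monomial, eval_monomial]
    refine this.congr fun x => ?_
    rw [← e]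
    simp_rw [mul_comm a]

/-- Weak limits preserve pointwise bounds: integrate over arbitrary measurable sets of times. The
exceptional null set depends on h; it is removed at Lebesgue points in `IsZoomPoint.abs_trace_le`.
-/
lemma ae_abs_trace_le (hm : IsWeakTrace T u m) (H : IsEntropySolution p T u) {h : ℝ[X]} {M : ℝ}
    (hM : ∀ w ∈ Icc (0 : ℝ) 1, |h.eval w| ≤ M) :
    ∀ᵐ t ∂(volume.restrict (Icc 0 T)), |traceFunctional m t h| ≤ M := by
  set μ := volume.restrict (Icc 0 T) with hμ
  have hti : Integrable (fun t => traceFunctional m t h) μ := by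
    simpa using hm.integrable_mul_trace h (integrable_const (μ := μ) (1 : ℝ))
  have hset : ∀ s : Set ℝ, MeasurableSet s →
      |∫ t in s, traceFunctional m t h ∂μ| ≤ ∫ t in s, M ∂μ := by
    intro s hs
    have h1 := hm.essLim_eval H h ((memLp_const (1 : ℝ)).indicator hs)
    have e : ∀ k : ℝ → ℝ, ∫ t, s.indicator (fun _ => (1 : ℝ)) t * k t ∂μ = ∫ t in s, k t ∂μ := by
      intro k
      rw [← integral_indicator hs]
      refine integral_congr_ae (Eventually.of_forall fun t => ?_)
      by_cases ht : t ∈ s <;> simp [ht]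
    rw [e] at h1
    refine le_of_tendsto h1.abs (Eventually.of_forall fun x => ?_)
    rw [e]
    exact norm_integral_le_of_norm_le (μ := μ.restrict s) (f := fun t => h.eval (u (t, x)))
      (g := fun _ => M) (integrable_const _) (Eventually.of_forall fun t => hM _ (H.mem_Icc _))
  have h1 : 0 ≤ᵐ[μ] fun t => M - traceFunctional m t h := by
    refine ae_nonneg_of_forall_setIntegral_nonneg ((integrable_const M).sub hti) fun s hs _ => ?_
    rw [integral_sub (integrable_const _).integrableOn hti.integrableOn]
    linarith [(abs_le.1 (hset s hs)).2]
  have h2 : 0 ≤ᵐ[μ] fun t => M + traceFunctional m t h := by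
    refine ae_nonneg_of_forall_setIntegral_nonneg ((integrable_const M).add hti) fun s hs _ => ?_
    rw [integral_add (integrable_const _).integrableOn hti.integrableOn]
    linarith [(abs_le.1 (hset s hs)).1]
  filter_upwards [h1, h2] with t h1 h2
  have h1' : 0 ≤ M - traceFunctional m t h := h1
  have h2' : 0 ≤ M + traceFunctional m t h := h2
  rw [abs_le]; constructor <;> linarith

end IsWeakTrace

/-! ### The entropy inequality up to the boundary. -/

/-- Concentrating kernels pick up essential limits. -/
lemma EssLimZero.tendsto_integral_kernel {g : ℝ → ℝ} {L M R : ℝ} (hg : EssLimZero g L)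
    (hgm : Measurable g) (hM : ∀ x, |g x| ≤ M) {k : ℝ → ℝ} (hk : Continuous k)
    (hkR : ∀ y, R < y → k y = 0) :
    Tendsto (fun r => ∫ x in Ioi (0 : ℝ), r⁻¹ * k (r⁻¹ * x) * g x) (𝓝[>] 0)
      (𝓝 ((∫ y in Ioi (0 : ℝ), k y) * L)) := by
  have hki : IntegrableOn k (Ioi 0) := by
    have h1 : IntegrableOn k (Icc 0 R) := hk.continuousOn.integrableOn_compact isCompact_Icc
    refine h1.of_forall_sdiff_eq_zero measurableSet_Ioi fun y hy => hkR y ?_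
    by_contra h
    exact hy.2 ⟨le_of_lt hy.1, not_lt.1 h⟩
  set B := ∫ y in Ioi (0 : ℝ), |k y| with hB
  have hB0 : 0 ≤ B := integral_nonneg fun _ => abs_nonneg _
  rw [Metric.tendsto_nhds]
  intro ε hε
  obtain ⟨δ, hδ, hgδ⟩ := hg.exists_delta (ε := ε / (B + 1)) (by positivity)
  have hev : ∀ᶠ r : ℝ in 𝓝[>] 0, r * (|R| + 1) < δ := by
    have h1 : Tendsto (fun r : ℝ => r * (|R| + 1)) (𝓝[>] 0) (𝓝 0) := by
      have := (tendsto_id (α := ℝ) (x := 𝓝 0)).mul_const (|R| + 1)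
      simp only [id, zero_mul] at this
      exact this.mono_left nhdsWithin_le_nhds
    exact h1.eventually_lt_const hδ
  filter_upwards [hev, self_mem_nhdsWithin] with r hr hr0
  have hr0' : 0 < r := hr0
  have hri : 0 < r⁻¹ := inv_pos.2 hr0'
  have hscale : ∀ f : ℝ → ℝ, ∫ x in Ioi (0 : ℝ), r⁻¹ * f (r⁻¹ * x) = ∫ y in Ioi (0 : ℝ), f y := by
    intro f
    rw [integral_const_mul, integral_comp_mul_left_Ioi f 0 hri]
    simp [hr0'.ne']
  have hkri : ∀ {f : ℝ → ℝ}, IntegrableOn f (Ioi 0) →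
      IntegrableOn (fun x => r⁻¹ * f (r⁻¹ * x)) (Ioi 0) := fun {f} hf => by
    refine Integrable.const_mul ?_ _
    have := (integrableOn_Ioi_comp_mul_left_iff f 0 hri).2 (by simpa using hf)
    exact this
  have hi1 : IntegrableOn (fun x => r⁻¹ * k (r⁻¹ * x) * g x) (Ioi 0) :=
    (hkri hki).mul_bdd (c := M) hgm.aestronglyMeasurable (Eventually.of_forall hM)
  rw [Real.dist_eq, ← hscale k, ← integral_mul_const,
    ← integral_sub hi1 ((hkri hki).mul_const L)]
  have hae : ∀ᵐ x ∂(volume.restrict (Ioi (0 : ℝ))),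
      ‖r⁻¹ * k (r⁻¹ * x) * g x - r⁻¹ * k (r⁻¹ * x) * L‖ ≤
        r⁻¹ * |k (r⁻¹ * x)| * (ε / (B + 1)) := by
    refine (ae_restrict_iff' measurableSet_Ioi).2 ?_
    filter_upwards [hgδ] with x hx hx0
    rw [← mul_sub, norm_mul, norm_mul, Real.norm_eq_abs, Real.norm_eq_abs, Real.norm_eq_abs,
      abs_of_pos hri]
    by_cases hxR : R < r⁻¹ * x
    · rw [hkR _ hxR]; simp
    · push Not at hxR
      have hxδ : x < δ := by
        have h1 : x ≤ r * R := by
          have := mul_le_mul_of_nonneg_left hxR hr0'.le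
          rwa [← mul_assoc, mul_inv_cancel₀ hr0'.ne', one_mul] at this
        have h2 : r * R ≤ r * (|R| + 1) := by gcongr; linarith [le_abs_self R]
        linarith
      exact mul_le_mul_of_nonneg_left (hx ⟨hx0, hxδ⟩) (by positivity)
  refine lt_of_le_of_lt (norm_integral_le_of_norm_le ((hkri hki.abs).mul_const _) hae) ?_
  rw [integral_mul_const, hscale fun y => |k y|, ← hB, mul_div_assoc', div_lt_iff₀ (by positivity)]
  nlinarith

lemma integral_Ioi_deriv_of_eventually_const {f : ℝ → ℝ} (hf : ContDiff ℝ ∞ f) {R c : ℝ}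
    (hc : ∀ y, R < y → f y = c) : ∫ y in Ioi (0 : ℝ), deriv f y = c - f 0 := by
  have hd0 : ∀ y, R < y → deriv f y = 0 := fun y hy => by
    have : f =ᶠ[𝓝 y] fun _ => c := by
      filter_upwards [Ioi_mem_nhds hy] with z hz using hc z hz
    rw [this.deriv_eq, deriv_const]
  have hki : IntegrableOn (deriv f) (Ioi 0) := by
    have h1 : IntegrableOn (deriv f) (Icc 0 R) :=
      (hf.continuous_deriv (by simp)).continuousOn.integrableOn_compact isCompact_Icc
    refine h1.of_forall_sdiff_eq_zero measurableSet_Ioi fun y hy => hd0 y ?_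
    by_contra h
    exact hy.2 ⟨le_of_lt hy.1, not_lt.1 h⟩
  refine integral_Ioi_of_hasDerivAt_of_tendsto' (fun x _ =>
    (hf.differentiable (by simp) x).hasDerivAt) hki ?_
  refine tendsto_const_nhds.congr' ?_
  filter_upwards [eventually_gt_atTop R] with y hy using (hc y hy).symm

lemma HasCompactSupport.slice {θ : ℝ × ℝ → ℝ} (hc : HasCompactSupport θ) (x : ℝ) :
    HasCompactSupport fun t => θ (t, x) := by
  refine HasCompactSupport.intro (hc.isCompact.image continuous_fst) fun t ht => ?_
  by_contra h
  exact ht ⟨(t, x), subset_tsupport _ h, rfl⟩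

/-- The entropy dissipation of `u` on the half plane, including the contribution of the boundary. -/
noncomputable def boundaryForm (p : ℝ) (u : ℝ × ℝ → ℝ) (m : ℕ → ℝ → ℝ) (F Q : ℝ[X])
    (θ : ℝ × ℝ → ℝ) : ℝ :=
  (∫ z in halfPlane, (F.eval (u z) * fderiv ℝ θ z (1, 0) +
    p * (Q.eval (u z) * fderiv ℝ θ z (0, 1)))) + p * ∫ t, traceFunctional m t Q * θ (t, 0)

/-- Test functions for the dissipation near the boundary `x = 0`. -/
structure IsBoundaryTest (T : ℝ) (θ : ℝ × ℝ → ℝ) : Prop where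
  contDiff : ContDiff ℝ ∞ θ
  hasCompactSupport : HasCompactSupport θ
  tsupport_subset : tsupport θ ⊆ Ioo 0 T ×ˢ Iio 1

namespace IsBoundaryTest

variable {T : ℝ} {θ θ₁ θ₂ : ℝ × ℝ → ℝ}

lemma add (h₁ : IsBoundaryTest T θ₁) (h₂ : IsBoundaryTest T θ₂) :
    IsBoundaryTest T fun z => θ₁ z + θ₂ z :=
  ⟨h₁.contDiff.add h₂.contDiff, h₁.hasCompactSupport.add h₂.hasCompactSupport,
    (tsupport_add _ _).trans (union_subset h₁.tsupport_subset h₂.tsupport_subset)⟩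

lemma const_mul (h : IsBoundaryTest T θ) (c : ℝ) : IsBoundaryTest T fun z => c * θ z :=
  ⟨contDiff_const.mul h.contDiff, h.hasCompactSupport.mul_left,
    (closure_mono fun z hz => by
      exact right_ne_zero_of_mul (show c * θ z ≠ 0 from hz)).trans h.tsupport_subset⟩

lemma eq_zero (h : IsBoundaryTest T θ) {t : ℝ} (ht : t ∉ Icc 0 T) (x : ℝ) : θ (t, x) = 0 := by
  by_contra h0
  exact ht (Ioo_subset_Icc_self (h.tsupport_subset (subset_tsupport _ h0)).1)

lemma integral_slice (h : IsBoundaryTest T θ) (f : ℝ → ℝ) (x : ℝ) :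
    ∫ t, θ (t, x) * f t = ∫ t in Icc 0 T, θ (t, x) * f t :=
  (setIntegral_eq_integral_of_forall_compl_eq_zero fun t ht => by rw [h.eq_zero ht, zero_mul]).symm

lemma tendsto_slice (h : IsBoundaryTest T θ) :
    Tendsto (fun x => ∫ t in Icc 0 T, |θ (t, x) - θ (t, 0)|) (𝓝 0) (𝓝 0) := by
  have hc : Continuous fun x => ∫ t in Icc 0 T, |θ (t, x) - θ (t, 0)| := by
    have := h.contDiff.continuous
    refine continuous_parametric_integral_of_continuous
      (f := fun x t => |θ (t, x) - θ (t, 0)|) ?_ isCompact_Icc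
    simp only [Function.uncurry_def]
    fun_prop
  simpa using hc.tendsto 0

lemma continuous_slice (h : IsBoundaryTest T θ) (x : ℝ) : Continuous fun t => θ (t, x) :=
  h.contDiff.continuous.comp (by fun_prop)

lemma integrable_slice (h : IsBoundaryTest T θ) (x : ℝ) : Integrable fun t => θ (t, x) :=
  (h.continuous_slice x).integrable_of_hasCompactSupport (h.hasCompactSupport.slice x)

end IsBoundaryTest

namespace IsWeakTrace

variable {p T : ℝ} {u : ℝ × ℝ → ℝ} {m : ℕ → ℝ → ℝ} {F Q F₁ F₂ Q₁ Q₂ : ℝ[X]} {θ θ₁ θ₂ ψ : ℝ × ℝ → ℝ}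

lemma integrable_form (H : IsEntropySolution p T u) (F Q : ℝ[X]) (hθ : IsBoundaryTest T θ) :
    Integrable (fun z => F.eval (u z) * fderiv ℝ θ z (1, 0) +
      p * (Q.eval (u z) * fderiv ℝ θ z (0, 1))) :=
  (F.integrable_eval_mul H.measurable H.mem_Icc (hθ.contDiff.continuous_fderiv_apply_const _)
    (hθ.hasCompactSupport.fderiv_apply_const _)).add
  ((Q.integrable_eval_mul H.measurable H.mem_Icc (hθ.contDiff.continuous_fderiv_apply_const _)
    (hθ.hasCompactSupport.fderiv_apply_const _)).const_mul p)

lemma integrable_trace_mul (hm : IsWeakTrace T u m) (Q : ℝ[X]) (hθ : IsBoundaryTest T θ) :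
    Integrable (fun t => traceFunctional m t Q * θ (t, 0)) := by
  simpa only [mul_comm] using hm.integrable_mul_trace Q (hθ.integrable_slice 0)

lemma boundaryForm_add_test (hm : IsWeakTrace T u m) (H : IsEntropySolution p T u) (F Q : ℝ[X])
    (h₁ : IsBoundaryTest T θ₁) (h₂ : IsBoundaryTest T θ₂) :
    boundaryForm p u m F Q (fun z => θ₁ z + θ₂ z) =
      boundaryForm p u m F Q θ₁ + boundaryForm p u m F Q θ₂ := by
  have hd : ∀ z, fderiv ℝ (fun z => θ₁ z + θ₂ z) z = fderiv ℝ θ₁ z + fderiv ℝ θ₂ z := fun z =>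
    fderiv_add (h₁.contDiff.differentiable (by simp) z) (h₂.contDiff.differentiable (by simp) z)
  have e1 := integral_add (integrable_form H F Q h₁).integrableOn
    (integrable_form H F Q h₂).integrableOn (μ := volume.restrict halfPlane)
  have e2 := integral_add (hm.integrable_trace_mul Q h₁) (hm.integrable_trace_mul Q h₂)
  simp only [boundaryForm, hd, add_apply]
  have e3 : ∀ a b c d : ℝ, a + p * b + (c + p * d) = (a + c) + p * (b + d) := by intros; ring
  rw [e3, ← e1, ← e2]
  refine congrArg₂ (· + ·) (integral_congr_ae (Eventually.of_forall fun z => ?_))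
    (congrArg (p * ·) (integral_congr_ae (Eventually.of_forall fun t => ?_))) <;> simp only <;> ring

lemma boundaryForm_const_mul_test (F Q : ℝ[X]) (hθ : IsBoundaryTest T θ) (c : ℝ) :
    boundaryForm p u m F Q (fun z => c * θ z) = c * boundaryForm p u m F Q θ := by
  have hd : ∀ z, fderiv ℝ (fun z => c * θ z) z = c • fderiv ℝ θ z := fun z =>
    fderiv_const_mul (hθ.contDiff.differentiable (by simp) z) c
  simp only [boundaryForm, hd, smul_apply, smul_eq_mul]
  rw [mul_add, mul_left_comm c p, ← integral_const_mul c, ← integral_const_mul c]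
  refine congrArg₂ (· + ·) (integral_congr_ae (Eventually.of_forall fun z => ?_))
    (congrArg (p * ·) (integral_congr_ae (Eventually.of_forall fun t => ?_))) <;> simp only <;> ring

lemma boundaryForm_add_pair (hm : IsWeakTrace T u m) (H : IsEntropySolution p T u)
    (F₁ Q₁ F₂ Q₂ : ℝ[X]) (hθ : IsBoundaryTest T θ) :
    boundaryForm p u m (F₁ + F₂) (Q₁ + Q₂) θ =
      boundaryForm p u m F₁ Q₁ θ + boundaryForm p u m F₂ Q₂ θ := by
  have e1 := integral_add (integrable_form H F₁ Q₁ hθ).integrableOn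
    (integrable_form H F₂ Q₂ hθ).integrableOn (μ := volume.restrict halfPlane)
  have e2 := integral_add (hm.integrable_trace_mul Q₁ hθ) (hm.integrable_trace_mul Q₂ hθ)
  simp only [boundaryForm, eval_add, map_add]
  have e3 : ∀ a b c d : ℝ, a + p * b + (c + p * d) = (a + c) + p * (b + d) := by intros; ring
  rw [e3, ← e1, ← e2]
  refine congrArg₂ (· + ·) (integral_congr_ae (Eventually.of_forall fun z => ?_))
    (congrArg (p * ·) (integral_congr_ae (Eventually.of_forall fun t => ?_))) <;> simp only <;> ring

lemma boundaryForm_C_mul_pair (F Q : ℝ[X]) (c : ℝ) (θ : ℝ × ℝ → ℝ) :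
    boundaryForm p u m (C c * F) (C c * Q) θ = c * boundaryForm p u m F Q θ := by
  simp only [boundaryForm, ← smul_eq_C_mul, map_smul, eval_smul, smul_eq_mul]
  rw [mul_add, mul_left_comm c p, ← integral_const_mul c, ← integral_const_mul c]
  refine congrArg₂ (· + ·) (integral_congr_ae (Eventually.of_forall fun z => ?_))
    (congrArg (p * ·) (integral_congr_ae (Eventually.of_forall fun t => ?_))) <;> simp only <;> ring

/-- Weak traces of entropy fluxes tested with smooth functions of both variables. -/
lemma essLim_test (hm : IsWeakTrace T u m) (H : IsEntropySolution p T u) (Q : ℝ[X])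
    (hθ : IsBoundaryTest T θ) :
    EssLimZero (fun x => ∫ t, Q.eval (u (t, x)) * θ (t, x))
      (∫ t, traceFunctional m t Q * θ (t, 0)) := by
  obtain ⟨M, hM0, hM⟩ := Q.exists_abs_eval_le
  have hL2 : MemLp (fun t => θ (t, 0)) 2 (volume.restrict (Icc 0 T)) :=
    ((hθ.continuous_slice 0).memLp_of_hasCompactSupport (hθ.hasCompactSupport.slice 0)).restrict _
  have h1 := hm.essLim_eval H Q hL2
  -- The test function may be frozen at x = 0: its slices converge in L¹ and Q(u) is bounded. The
  -- frozen function depends on t only, so the weak trace applies.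
  have h2 : Tendsto (fun x => ∫ t in Icc 0 T, (θ (t, x) - θ (t, 0)) * Q.eval (u (t, x)))
      (𝓝[>] (0 : ℝ) ⊓ ae volume) (𝓝 0) := by
    have h3 := (hθ.tendsto_slice.const_mul M).mono_left
      ((inf_le_left (b := ae volume)).trans (nhdsWithin_le_nhds (s := Ioi 0)))
    rw [mul_zero] at h3
    refine squeeze_zero_norm (fun x => ?_) h3
    exact H.abs_slice_le hM x ((hθ.integrable_slice x).sub (hθ.integrable_slice 0)).integrableOn
  have h3 := h2.add h1
  rw [zero_add, ← hθ.integral_slice] at h3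
  simp_rw [mul_comm (traceFunctional m _ Q)]
  refine h3.congr fun x => ?_
  simp_rw [mul_comm _ (θ (_, x))]
  rw [hθ.integral_slice, ← integral_add
    (H.integrable_slice_mul Q x (φ := fun t => θ (t, x) - θ (t, 0))
      ((hθ.integrable_slice x).sub (hθ.integrable_slice 0)).integrableOn)
    (H.integrable_slice_mul Q x (hθ.integrable_slice 0).integrableOn)]
  refine integral_congr_ae (Eventually.of_forall fun t => ?_)
  simp only; ring

lemma exists_abs_slice_test_le (H : IsEntropySolution p T u) (Q : ℝ[X])
    (hθ : IsBoundaryTest T θ) : ∃ B, ∀ x, |∫ t, Q.eval (u (t, x)) * θ (t, x)| ≤ B := by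
  obtain ⟨M, hM0, hM⟩ := Q.exists_abs_eval_le
  obtain ⟨K, hK⟩ := hθ.contDiff.continuous.bounded_above_of_compact_support hθ.hasCompactSupport
  refine ⟨M * ∫ t in Icc 0 T, K, fun x => ?_⟩
  simp_rw [mul_comm _ (θ (_, x))]
  rw [hθ.integral_slice]
  refine (H.abs_slice_le hM x (hθ.integrable_slice x).integrableOn).trans ?_
  exact mul_le_mul_of_nonneg_left (integral_mono (hθ.integrable_slice x).abs.integrableOn
    (integrable_const _) fun t => hK _) hM0

lemma measurable_slice_test (H : IsEntropySolution p T u) (Q : ℝ[X])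
    (hθ : IsBoundaryTest T θ) : Measurable fun x => ∫ t, Q.eval (u (t, x)) * θ (t, x) := by
  have : Measurable fun z : ℝ × ℝ => Q.eval (u z) * θ z :=
    (H.measurable_eval Q).mul hθ.contDiff.continuous.measurable
  exact (this.stronglyMeasurable.integral_prod_left').measurable

/-- The boundary layer produced by a cutoff at height `r`. -/
lemma tendsto_boundary_layer (hm : IsWeakTrace T u m) (H : IsEntropySolution p T u) (Q : ℝ[X])
    (hθ : IsBoundaryTest T θ) {f : ℝ → ℝ} (hf : ContDiff ℝ ∞ f) {R c : ℝ}
    (hc : ∀ y, R < y → f y = c) :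
    Tendsto (fun r => ∫ z in halfPlane, Q.eval (u z) * (θ z * (r⁻¹ * deriv f (r⁻¹ * z.2))))
      (𝓝[>] 0) (𝓝 ((c - f 0) * ∫ t, traceFunctional m t Q * θ (t, 0))) := by
  obtain ⟨B, hB⟩ := exists_abs_slice_test_le H Q hθ
  have hd0 : ∀ y, R < y → deriv f y = 0 := fun y hy => by
    have : f =ᶠ[𝓝 y] fun _ => c := by
      filter_upwards [Ioi_mem_nhds hy] with z hz using hc z hz
    rw [this.deriv_eq, deriv_const]
  have hfc := hf.continuous_deriv (by simp)
  have h := (hm.essLim_test H Q hθ).tendsto_integral_kernel (measurable_slice_test H Q hθ) hB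
    hfc hd0
  rw [integral_Ioi_deriv_of_eventually_const hf hc] at h
  refine h.congr fun r => ?_
  have hint : Integrable (fun z => Q.eval (u z) * (θ z * (r⁻¹ * deriv f (r⁻¹ * z.2)))) := by
    refine Q.integrable_eval_mul H.measurable H.mem_Icc ?_ hθ.hasCompactSupport.mul_right
    exact hθ.contDiff.continuous.mul (continuous_const.mul (hfc.comp (by fun_prop)))
  rw [setIntegral_halfPlane hint.integrableOn]
  refine integral_congr_ae (Eventually.of_forall fun x => ?_)
  simp only
  rw [← integral_const_mul]
  refine integral_congr_ae (Eventually.of_forall fun t => ?_)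
  simp only; ring

end IsWeakTrace

lemma fderiv_mul_snd {θ : ℝ × ℝ → ℝ} {g : ℝ → ℝ} (hθ : Differentiable ℝ θ)
    (hg : Differentiable ℝ g) (z : ℝ × ℝ) :
    fderiv ℝ (fun z : ℝ × ℝ => θ z * g z.2) z (1, 0) = fderiv ℝ θ z (1, 0) * g z.2 ∧
    fderiv ℝ (fun z : ℝ × ℝ => θ z * g z.2) z (0, 1) =
      fderiv ℝ θ z (0, 1) * g z.2 + θ z * deriv g z.2 := by
  have h2 : HasFDerivAt (fun z : ℝ × ℝ => g z.2) _ z :=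
    (hg z.2).hasDerivAt.hasFDerivAt.comp z hasFDerivAt_snd
  have h4 : fderiv ℝ (fun z : ℝ × ℝ => θ z * g z.2) z = _ := ((hθ z).hasFDerivAt.mul h2).fderiv
  constructor <;> simp [h4] <;> ring

/-- A smooth function vanishing on `(-∞, 1]` and equal to one on `[2, ∞)`. -/
lemma exists_smooth_step : ∃ f : ℝ → ℝ, ContDiff ℝ ∞ f ∧ (∀ y, y ≤ 1 → f y = 0) ∧
    (∀ y, 2 ≤ y → f y = 1) ∧ ∀ y, f y ∈ Icc (0 : ℝ) 1 :=
  ⟨fun y => Real.smoothTransition (y - 1),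
    Real.smoothTransition.contDiff.comp (contDiff_id.sub contDiff_const),
    fun _ hy => Real.smoothTransition.zero_of_nonpos (by linarith),
    fun _ hy => Real.smoothTransition.one_of_one_le (by linarith),
    fun _ => ⟨Real.smoothTransition.nonneg _, Real.smoothTransition.le_one _⟩⟩

namespace IsWeakTrace

variable {p T : ℝ} {u : ℝ × ℝ → ℝ} {m : ℕ → ℝ → ℝ} {F Q : ℝ[X]} {θ ψ : ℝ × ℝ → ℝ}

/-- The entropy inequality up to the boundary. -/
lemma boundaryForm_nonneg (hm : IsWeakTrace T u m) (H : IsEntropySolution p T u)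
    (hFQ : derivative Q = (1 - 2 * X) * derivative F)
    (hconv : ∀ w ∈ Icc (0 : ℝ) 1, 0 ≤ (derivative (derivative F)).eval w)
    (hθ : IsBoundaryTest T θ) (hθ0 : ∀ z, 0 ≤ θ z) : 0 ≤ boundaryForm p u m F Q θ := by
  -- Multiplying θ by f(x/r) moves its support into the open strip. As r → 0 the derivative of the
  -- cutoff concentrates at x = 0 and produces the boundary term.
  obtain ⟨f, hf, hf0, hf1, hf01⟩ := exists_smooth_step
  have hlayer := hm.tendsto_boundary_layer H Q hθ hf (R := 2) (c := 1) fun y hy => hf1 y hy.le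
  rw [hf0 0 zero_le_one, sub_zero, one_mul] at hlayer
  have hform := (integrable_form H F Q hθ).integrableOn (s := halfPlane)
  set Φ : ℝ × ℝ → ℝ := fun z => F.eval (u z) * fderiv ℝ θ z (1, 0) +
    p * (Q.eval (u z) * fderiv ℝ θ z (0, 1)) with hΦ
  have hmain : Tendsto (fun r => ∫ z in halfPlane, Φ z * f (r⁻¹ * z.2)) (𝓝[>] 0)
      (𝓝 (∫ z in halfPlane, Φ z)) := by
    refine tendsto_integral_filter_of_dominated_convergence (fun z => |Φ z|)
      (Eventually.of_forall fun r => hform.aestronglyMeasurable.mul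
        (hf.continuous.comp (by fun_prop)).aestronglyMeasurable)
      (Eventually.of_forall fun r => Eventually.of_forall fun z => ?_) hform.abs ?_
    · rw [norm_mul, Real.norm_eq_abs, Real.norm_eq_abs, abs_of_nonneg (hf01 _).1]
      exact mul_le_of_le_one_right (abs_nonneg _) (hf01 _).2
    · refine (ae_restrict_iff' measurableSet_halfPlane).2 (Eventually.of_forall fun z hz => ?_)
      have hz' : 0 < z.2 := hz
      refine tendsto_const_nhds.congr' ?_
      filter_upwards [(tendsto_inv_nhdsGT_zero.atTop_mul_const hz').eventually_ge_atTop 2] with r hr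
      rw [hf1 _ hr, mul_one]
  refine ge_of_tendsto (hmain.add (hlayer.const_mul p)) ?_
  filter_upwards [self_mem_nhdsWithin] with r hr
  have hr0 : 0 < r := hr
  set g : ℝ → ℝ := fun x => f (r⁻¹ * x) with hg
  have hgs : ContDiff ℝ ∞ g := hf.comp (contDiff_const.mul contDiff_id)
  have hgd : ∀ x, deriv g x = r⁻¹ * deriv f (r⁻¹ * x) := fun x => by
    simpa using deriv_comp_mul_left r⁻¹ f x
  have hd := fderiv_mul_snd (hθ.contDiff.differentiable (by simp)) (hgs.differentiable (by simp))
  have hg0 : ∀ x, x ≤ r → g x = 0 := fun x hx => hf0 _ (by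
    rw [inv_mul_le_iff₀ hr0]; simpa using hx)
  have hs : ContDiff ℝ ∞ fun z : ℝ × ℝ => θ z * g z.2 :=
    hθ.contDiff.mul (hgs.comp contDiff_snd)
  have hc : HasCompactSupport fun z : ℝ × ℝ => θ z * g z.2 := hθ.hasCompactSupport.mul_right
  have hsupp : tsupport (fun z : ℝ × ℝ => θ z * g z.2) ⊆ Ioo 0 T ×ˢ Ioo 0 1 := by
    have h1 : tsupport (fun z : ℝ × ℝ => θ z * g z.2) ⊆ tsupport θ :=
      closure_mono fun z hz => left_ne_zero_of_mul (show θ z * g z.2 ≠ 0 from hz)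
    have h2 : tsupport (fun z : ℝ × ℝ => θ z * g z.2) ⊆ {z | r ≤ z.2} :=
      closure_minimal (fun z hz => by
        by_contra h
        exact right_ne_zero_of_mul (show θ z * g z.2 ≠ 0 from hz) (hg0 _ (not_le.1 h).le))
        (isClosed_le continuous_const continuous_snd)
    intro z hz
    have h3 := hθ.tsupport_subset (h1 hz)
    exact ⟨h3.1, hr0.trans_le (h2 hz), h3.2⟩
  have h := H.entropy F Q hFQ hconv _ hs hc hsupp fun z => mul_nonneg (hθ0 z) (hf01 _).1
  have hcompl : ∀ z ∉ halfPlane, F.eval (u z) * fderiv ℝ (fun z : ℝ × ℝ => θ z * g z.2) z (1, 0) +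
      p * (Q.eval (u z) * fderiv ℝ (fun z : ℝ × ℝ => θ z * g z.2) z (0, 1)) = 0 := by
    intro z hz
    have hz' : z.2 ≤ 0 := not_lt.1 hz
    have hdz : deriv g z.2 = 0 := by
      have : g =ᶠ[𝓝 z.2] fun _ => 0 := by
        filter_upwards [Iio_mem_nhds (hz'.trans_lt hr0)] with x hx using hg0 x (le_of_lt hx)
      rw [this.deriv_eq, deriv_const]
    rw [(hd z).1, (hd z).2, hdz, hg0 _ (hz'.trans hr0.le)]
    simp
  rw [← setIntegral_eq_integral_of_forall_compl_eq_zero hcompl] at h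
  refine h.trans (le_of_eq ?_)
  have hi1 : IntegrableOn (fun z => Φ z * g z.2) halfPlane := by
    refine hform.mul_bdd (c := 1) (hgs.continuous.comp continuous_snd).aestronglyMeasurable
      (Eventually.of_forall fun z => ?_)
    rw [Real.norm_eq_abs, abs_of_nonneg (hf01 _).1]; exact (hf01 _).2
  have hi2 : IntegrableOn (fun z => Q.eval (u z) * (θ z * (r⁻¹ * deriv f (r⁻¹ * z.2)))) halfPlane := by
    refine (Q.integrable_eval_mul H.measurable H.mem_Icc ?_ hθ.hasCompactSupport.mul_right)
    exact hθ.contDiff.continuous.mul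
      (continuous_const.mul ((hf.continuous_deriv (by simp)).comp (by fun_prop)))
  rw [← integral_const_mul, ← integral_add hi1 (hi2.const_mul p)]
  refine integral_congr_ae (Eventually.of_forall fun z => ?_)
  simp only [(hd z).1, (hd z).2, hgd, hΦ]
  ring

/-- The dissipation of any entropy is controlled by that of the square. -/
lemma abs_boundaryForm_le (hm : IsWeakTrace T u m) (H : IsEntropySolution p T u) {M : ℝ}
    (hFQ : derivative Q = (1 - 2 * X) * derivative F)
    (hM : ∀ w ∈ Icc (0 : ℝ) 1, |(derivative (derivative F)).eval w| ≤ 2 * M)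
    (hθ : IsBoundaryTest T θ) (hψ : IsBoundaryTest T ψ) (hle : ∀ z, |θ z| ≤ ψ z) :
    |boundaryForm p u m F Q θ| ≤ M * boundaryForm p u m (X ^ 2) (X ^ 2 - C (4 / 3) * X ^ 3) ψ := by
  -- For each choice of signs the entropy M w² + aF is convex and the test ψ + bθ is nonnegative.
  -- Adding the inequalities for (1,1) and (-1,-1), and those for (1,-1) and (-1,1), isolates ±2
  -- times the dissipation of F against θ.
  have key : ∀ a b : ℝ, |a| = 1 → |b| = 1 → 0 ≤ M * (boundaryForm p u m (X ^ 2)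
      (X ^ 2 - C (4 / 3) * X ^ 3) ψ + b * boundaryForm p u m (X ^ 2)
      (X ^ 2 - C (4 / 3) * X ^ 3) θ) + a * (boundaryForm p u m F Q ψ +
        b * boundaryForm p u m F Q θ) := by
    intro a b ha hb
    have hb' : IsBoundaryTest T fun z => ψ z + b * θ z := hψ.add (hθ.const_mul b)
    have h := hm.boundaryForm_nonneg H (F := C M * X ^ 2 + C a * F)
      (Q := C M * (X ^ 2 - C (4 / 3) * X ^ 3) + C a * Q) (by
        rw [derivative_add, derivative_C_mul, derivative_C_mul, derivative_square_flux, hFQ,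
          derivative_add, derivative_C_mul, derivative_C_mul]; ring)
      (fun w hw => by
        have h1 : |a * (derivative (derivative F)).eval w| ≤ 2 * M := by
          rw [abs_mul, ha, one_mul]; exact hM w hw
        have := (abs_le.1 h1).1
        simp
        linarith) hb' (fun z => by
        have h1 : |b * θ z| ≤ ψ z := by rw [abs_mul, hb, one_mul]; exact hle z
        linarith [(abs_le.1 h1).1])
    rwa [hm.boundaryForm_add_pair H _ _ _ _ hb', boundaryForm_C_mul_pair, boundaryForm_C_mul_pair,
      hm.boundaryForm_add_test H _ _ hψ (hθ.const_mul b),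
      hm.boundaryForm_add_test H _ _ hψ (hθ.const_mul b),
      boundaryForm_const_mul_test _ _ hθ, boundaryForm_const_mul_test _ _ hθ] at h
  have h1 := key 1 1 (by simp) (by simp)
  have h2 := key (-1) (-1) (by simp) (by simp)
  have h3 := key 1 (-1) (by simp) (by simp)
  have h4 := key (-1) 1 (by simp) (by simp)
  rw [abs_le]
  constructor <;> linarith

end IsWeakTrace

/-! ### Scaling and localisation of the dissipation. -/

/-- Scaling of the dissipation around a boundary point. -/
lemma boundaryForm_comp_scale (p : ℝ) (u : ℝ × ℝ → ℝ) (m : ℕ → ℝ → ℝ) (F Q : ℝ[X])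
    {θ : ℝ × ℝ → ℝ} (hθ : Differentiable ℝ θ) (t₀ : ℝ) {ε : ℝ} (hε : 0 < ε) :
    boundaryForm p u m F Q (fun z => θ (ε⁻¹ * (z.1 - t₀), ε⁻¹ * z.2)) =
      ε * boundaryForm p (fun z => u (t₀ + ε * z.1, ε * z.2)) (fun i s => m i (t₀ + ε * s)) F Q θ := by
  set θε : ℝ × ℝ → ℝ := fun z => θ (ε⁻¹ * (z.1 - t₀), ε⁻¹ * z.2) with hθε
  have hd : ∀ w v : ℝ × ℝ, fderiv ℝ θε (t₀ + ε * w.1, ε * w.2) v = ε⁻¹ * fderiv ℝ θ w v := by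
    intro w v
    have h1 : θε = fun z => θ (ε⁻¹ • (z - (t₀, 0))) := by
      ext z; simp [hθε, Prod.smul_def]
    have h2 : HasFDerivAt (fun z : ℝ × ℝ => ε⁻¹ • (z - (t₀, 0)))
        (ε⁻¹ • ContinuousLinearMap.id ℝ (ℝ × ℝ)) (t₀ + ε * w.1, ε * w.2) :=
      ((hasFDerivAt_id _).sub_const ((t₀, 0) : ℝ × ℝ)).const_smul ε⁻¹
    have e : ε⁻¹ • ((t₀ + ε * w.1, ε * w.2) - ((t₀, 0) : ℝ × ℝ)) = w := by
      ext <;> simp [hε.ne']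
    have h3 := HasFDerivAt.comp (g := θ) (f := fun z : ℝ × ℝ => ε⁻¹ • (z - (t₀, 0)))
      (t₀ + ε * w.1, ε * w.2)
      (hθ (ε⁻¹ • ((t₀ + ε * w.1, ε * w.2) - ((t₀, 0) : ℝ × ℝ)))).hasFDerivAt h2
    rw [e] at h3
    rw [h1]
    change fderiv ℝ (θ ∘ fun z : ℝ × ℝ => ε⁻¹ • (z - (t₀, 0))) _ v = _
    rw [h3.fderiv]; simp
  -- Area scales by ε² and derivatives by 1/ε, while the boundary integral scales by ε; both terms
  -- of the form thus carry a single factor ε.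
  have hI : ∀ G : ℝ × ℝ → ℝ, ∫ z in halfPlane, G z =
      ε ^ 2 * ∫ w in halfPlane, G (t₀ + ε * w.1, ε * w.2) := by
    intro G
    rw [← integral_indicator measurableSet_halfPlane, ← integral_indicator measurableSet_halfPlane,
      ← integral_add_left_eq_self _ ((t₀, 0) : ℝ × ℝ)]
    have h1 := Measure.integral_comp_smul (volume : Measure (ℝ × ℝ))
      (fun z => halfPlane.indicator G ((t₀, 0) + z)) ε
    have hfr : Module.finrank ℝ (ℝ × ℝ) = 2 := by simp
    rw [hfr, abs_of_pos (by positivity), smul_eq_mul] at h1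
    have h2 : ∫ x : ℝ × ℝ, halfPlane.indicator G ((t₀, 0) + ε • x) =
        ∫ w, halfPlane.indicator (fun w : ℝ × ℝ => G (t₀ + ε * w.1, ε * w.2)) w := by
      refine integral_congr_ae (Eventually.of_forall fun w => ?_)
      have e : ((t₀, 0) : ℝ × ℝ) + ε • w = (t₀ + ε * w.1, ε * w.2) := by ext <;> simp
      simp only [e, indicator_apply, halfPlane, mem_ofPred_eq, mul_pos_iff_of_pos_left hε]
    rw [← h2, h1]
    field_simp
  have hB : ∀ g : ℝ → ℝ, ∫ t, g t = ε * ∫ s, g (t₀ + ε * s) := by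
    intro g
    have h1 := Measure.integral_comp_mul_left (fun s => g (t₀ + s)) ε
    rw [integral_add_left_eq_self g t₀, abs_of_pos (inv_pos.2 hε), smul_eq_mul] at h1
    rw [h1, ← mul_assoc, mul_inv_cancel₀ hε.ne', one_mul]
  simp only [boundaryForm]
  rw [hI, hB, mul_add]
  congr 1
  · rw [pow_two, mul_assoc, ← integral_const_mul ε]
    congr 1
    refine integral_congr_ae (Eventually.of_forall fun w => ?_)
    simp only [hd]
    field_simp
  · rw [mul_left_comm]
    congr 2
    refine integral_congr_ae (Eventually.of_forall fun s => ?_)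
    have : ε⁻¹ * (t₀ + ε * s - t₀) = s := by field_simp; ring
    simp only [hθε, this, mul_zero]
    rfl

/-- The inner integral is the convolution of f with the reflected kernel, and the integral of a
convolution is the product of the integrals. -/
lemma integral_integral_mul_translate {f k : ℝ → ℝ} (hf : Integrable f) (hk : Integrable k) :
    Integrable (fun s => ∫ t, f t * k (t - s)) ∧
      ∫ s, ∫ t, f t * k (t - s) = (∫ t, f t) * ∫ t, k t := by
  have hk' : Integrable fun t => k (-t) := hk.comp_neg
  have e : (fun s => ∫ t, f t * k (t - s)) =
      MeasureTheory.convolution f (fun t => k (-t)) (ContinuousLinearMap.lsmul ℝ ℝ) volume := by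
    ext s
    simp [MeasureTheory.convolution]
  rw [e]
  refine ⟨hf.integrable_convolution _ hk', ?_⟩
  rw [integral_convolution _ hf hk', integral_neg_eq_self k]
  simp

lemma fderiv_mul_fst {θ : ℝ × ℝ → ℝ} {g : ℝ → ℝ} (hθ : Differentiable ℝ θ)
    (hg : Differentiable ℝ g) (z : ℝ × ℝ) :
    fderiv ℝ (fun z : ℝ × ℝ => θ z * g z.1) z (1, 0) =
      fderiv ℝ θ z (1, 0) * g z.1 + θ z * deriv g z.1 ∧
    fderiv ℝ (fun z : ℝ × ℝ => θ z * g z.1) z (0, 1) = fderiv ℝ θ z (0, 1) * g z.1 := by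
  have h2 : HasFDerivAt (fun z : ℝ × ℝ => g z.1) _ z :=
    (hg z.1).hasDerivAt.hasFDerivAt.comp z hasFDerivAt_fst
  have h4 : fderiv ℝ (fun z : ℝ × ℝ => θ z * g z.1) z = _ := ((hθ z).hasFDerivAt.mul h2).fderiv
  constructor <;> simp [h4] <;> ring

namespace IsBoundaryTest

variable {T : ℝ} {θ : ℝ × ℝ → ℝ}

lemma mul_right (h : IsBoundaryTest T θ) {g : ℝ × ℝ → ℝ} (hg : ContDiff ℝ ∞ g) :
    IsBoundaryTest T fun z => θ z * g z :=
  ⟨h.contDiff.mul hg, h.hasCompactSupport.mul_right,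
    (closure_mono fun z hz => by
      exact left_ne_zero_of_mul (show θ z * g z ≠ 0 from hz)).trans h.tsupport_subset⟩

end IsBoundaryTest

namespace IsWeakTrace

variable {p T : ℝ} {u : ℝ × ℝ → ℝ} {m : ℕ → ℝ → ℝ} {F Q : ℝ[X]} {θ ψ : ℝ × ℝ → ℝ}

/-- Averaging the dissipation over translated time cutoffs. -/
lemma integral_boundaryForm_translate (hm : IsWeakTrace T u m) (H : IsEntropySolution p T u)
    (F Q : ℝ[X]) (hθ : IsBoundaryTest T θ) {k : ℝ → ℝ} (hk : ContDiff ℝ ∞ k)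
    (hkc : HasCompactSupport k) :
    Integrable (fun s => boundaryForm p u m F Q fun z => θ z * k (z.1 - s)) ∧
      ∫ s, boundaryForm p u m F Q (fun z => θ z * k (z.1 - s)) =
        (∫ t, k t) * boundaryForm p u m F Q θ := by
  have hki : Integrable k := hk.continuous.integrable_of_hasCompactSupport hkc
  have hk'c : Continuous (deriv k) := hk.continuous_deriv (by simp)
  have hk'i : Integrable (deriv k) := hk'c.integrable_of_hasCompactSupport hkc.deriv
  have hk'0 : ∫ t, deriv k t = 0 :=
    integral_eq_zero_of_hasDerivAt_of_integrable
      (fun t => (hk.differentiable (by simp) t).hasDerivAt) hk'i hki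
  set Φ : ℝ × ℝ → ℝ := fun z => F.eval (u z) * fderiv ℝ θ z (1, 0) +
    p * (Q.eval (u z) * fderiv ℝ θ z (0, 1)) with hΦ
  have hΦi : Integrable Φ (volume.prod (volume.restrict (Ioi (0 : ℝ)))) := by
    rw [← restrict_halfPlane]; exact (integrable_form H F Q hθ).integrableOn
  have hΘi : Integrable (fun z => F.eval (u z) * θ z)
      (volume.prod (volume.restrict (Ioi (0 : ℝ)))) := by
    rw [← restrict_halfPlane]
    exact F.integrable_eval_mul H.measurable H.mem_Icc hθ.contDiff.continuous hθ.hasCompactSupport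
  have htr := hm.integrable_trace_mul Q hθ
  -- The form with time cutoff is an A-term against k plus an A'-term against k'. Integrated over
  -- all translates, the second disappears because k' has zero integral.
  set A : ℝ → ℝ := fun t => (∫ x in Ioi (0 : ℝ), Φ (t, x)) + p * (traceFunctional m t Q * θ (t, 0))
    with hA
  set A' : ℝ → ℝ := fun t => ∫ x in Ioi (0 : ℝ), F.eval (u (t, x)) * θ (t, x) with hA'
  have hAi : Integrable A := hΦi.integral_prod_left.add (htr.const_mul p)
  have hA'i : Integrable A' := hΘi.integral_prod_left
  have hbdd : ∀ {g : ℝ → ℝ}, Continuous g → HasCompactSupport g → ∃ B, ∀ t, ‖g t‖ ≤ B :=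
    fun hg hgc => hg.bounded_above_of_compact_support hgc
  obtain ⟨B, hB⟩ := hbdd hk.continuous hkc
  obtain ⟨B', hB'⟩ := hbdd hk'c hkc.deriv
  have e : ∀ s, boundaryForm p u m F Q (fun z => θ z * k (z.1 - s)) =
      (∫ t, A t * k (t - s)) + ∫ t, A' t * deriv k (t - s) := by
    intro s
    have hks : ContDiff ℝ ∞ fun t => k (t - s) := hk.comp (contDiff_id.sub contDiff_const)
    have hd := fderiv_mul_fst (hθ.contDiff.differentiable (by simp)) (hks.differentiable (by simp))
    simp only [deriv_comp_sub_const] at hd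
    have hi1 : Integrable (fun z => Φ z * k (z.1 - s))
        (volume.prod (volume.restrict (Ioi (0 : ℝ)))) :=
      hΦi.mul_bdd (c := B) (hk.continuous.comp (by fun_prop)).aestronglyMeasurable
        (Eventually.of_forall fun z => hB _)
    have hi2 : Integrable (fun z => F.eval (u z) * θ z * deriv k (z.1 - s))
        (volume.prod (volume.restrict (Ioi (0 : ℝ)))) :=
      hΘi.mul_bdd (c := B') (hk'c.comp (by fun_prop)).aestronglyMeasurable
        (Eventually.of_forall fun z => hB' _)
    have hi3 : Integrable fun t => traceFunctional m t Q * θ (t, 0) * k (t - s) :=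
      htr.mul_bdd (c := B) (hk.continuous.comp (by fun_prop)).aestronglyMeasurable
        (Eventually.of_forall fun z => hB _)
    have e1 : ∫ z in halfPlane, (F.eval (u z) * fderiv ℝ (fun z : ℝ × ℝ => θ z * k (z.1 - s)) z (1, 0)
        + p * (Q.eval (u z) * fderiv ℝ (fun z : ℝ × ℝ => θ z * k (z.1 - s)) z (0, 1))) =
        (∫ t, (∫ x in Ioi (0 : ℝ), Φ (t, x)) * k (t - s)) + ∫ t, A' t * deriv k (t - s) := by
      have e2 : ∫ t, (∫ x in Ioi (0 : ℝ), Φ (t, x)) * k (t - s) =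
          ∫ z, Φ z * k (z.1 - s) ∂(volume.prod (volume.restrict (Ioi (0 : ℝ)))) := by
        rw [integral_prod _ hi1]
        simp only [integral_mul_const]
      have e3 : ∫ t, A' t * deriv k (t - s) = ∫ z, F.eval (u z) * θ z * deriv k (z.1 - s)
          ∂(volume.prod (volume.restrict (Ioi (0 : ℝ)))) := by
        rw [integral_prod _ hi2]
        simp only [hA', integral_mul_const]
      rw [e2, e3, ← integral_add hi1 hi2, restrict_halfPlane]
      refine integral_congr_ae (Eventually.of_forall fun z => ?_)
      simp only [(hd z).1, (hd z).2, hΦ]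
      ring
    have e4 : ∫ t, A t * k (t - s) = (∫ t, (∫ x in Ioi (0 : ℝ), Φ (t, x)) * k (t - s)) +
        p * ∫ t, traceFunctional m t Q * (θ (t, 0) * k (t - s)) := by
      have hi4 : Integrable fun t => (∫ x in Ioi (0 : ℝ), Φ (t, x)) * k (t - s) :=
        hΦi.integral_prod_left.mul_bdd (c := B) (hk.continuous.comp (by fun_prop)).aestronglyMeasurable
          (Eventually.of_forall fun z => hB _)
      simp_rw [← mul_assoc]
      rw [← integral_const_mul, ← integral_add hi4 (hi3.const_mul p)]
      refine integral_congr_ae (Eventually.of_forall fun t => ?_)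
      simp only [hA]; ring
    rw [boundaryForm, e1, e4]
    ring
  obtain ⟨h1, h1'⟩ := integral_integral_mul_translate hAi hki
  obtain ⟨h2, h2'⟩ := integral_integral_mul_translate hA'i hk'i
  simp_rw [e]
  refine ⟨h1.add h2, ?_⟩
  rw [integral_add h1 h2, h1', h2', hk'0, mul_zero, add_zero, mul_comm]
  congr 1
  rw [hA, integral_add hΦi.integral_prod_left (htr.const_mul p), integral_const_mul, boundaryForm,
    restrict_halfPlane, integral_prod _ hΦi]

/-- The dissipation near the boundary is small. -/
lemma tendsto_boundaryForm_layer (hm : IsWeakTrace T u m) (H : IsEntropySolution p T u)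
    (F Q : ℝ[X]) (hθ : IsBoundaryTest T θ) {f : ℝ → ℝ} (hf : ContDiff ℝ ∞ f) (hf1 : f 0 = 1)
    {R : ℝ} (hfR : ∀ y, R < y → f y = 0) (hf01 : ∀ y, f y ∈ Icc (0 : ℝ) 1) :
    Tendsto (fun r => boundaryForm p u m F Q fun z => θ z * f (r⁻¹ * z.2)) (𝓝[>] 0) (𝓝 0) := by
  have hlayer := hm.tendsto_boundary_layer H Q hθ hf hfR
  have hform := (integrable_form H F Q hθ).integrableOn (s := halfPlane)
  set Φ : ℝ × ℝ → ℝ := fun z => F.eval (u z) * fderiv ℝ θ z (1, 0) +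
    p * (Q.eval (u z) * fderiv ℝ θ z (0, 1)) with hΦ
  have hmain : Tendsto (fun r => ∫ z in halfPlane, Φ z * f (r⁻¹ * z.2)) (𝓝[>] 0)
      (𝓝 (∫ z in halfPlane, 0)) := by
    refine tendsto_integral_filter_of_dominated_convergence (fun z => |Φ z|)
      (Eventually.of_forall fun r => hform.aestronglyMeasurable.mul
        (hf.continuous.comp (by fun_prop)).aestronglyMeasurable)
      (Eventually.of_forall fun r => Eventually.of_forall fun z => ?_) hform.abs ?_
    · rw [norm_mul, Real.norm_eq_abs, Real.norm_eq_abs, abs_of_nonneg (hf01 _).1]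
      exact mul_le_of_le_one_right (abs_nonneg _) (hf01 _).2
    · refine (ae_restrict_iff' measurableSet_halfPlane).2 (Eventually.of_forall fun z hz => ?_)
      have hz' : 0 < z.2 := hz
      refine tendsto_const_nhds.congr' ?_
      filter_upwards [(tendsto_inv_nhdsGT_zero.atTop_mul_const hz').eventually_gt_atTop R] with r hr
      rw [hfR _ hr, mul_zero]
  -- The interior part vanishes with the height of the layer. Since f drops from 1 to 0, the
  -- concentrating derivative contributes minus the trace term, which cancels the boundary integral
  -- in the form.
  have hlim := (hmain.add (hlayer.const_mul p)).add_const (p * ∫ t, traceFunctional m t Q * θ (t, 0))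
  rw [integral_zero, hf1] at hlim
  have e0 : ∀ L : ℝ, 0 + p * ((0 - 1) * L) + p * L = 0 := by intro L; ring
  rw [e0] at hlim
  refine hlim.congr fun r => ?_
  have hgs : ContDiff ℝ ∞ fun x => f (r⁻¹ * x) := hf.comp (contDiff_const.mul contDiff_id)
  have hgd : ∀ x, deriv (fun x => f (r⁻¹ * x)) x = r⁻¹ * deriv f (r⁻¹ * x) := fun x => by
    simpa using deriv_comp_mul_left r⁻¹ f x
  have hd := fderiv_mul_snd (hθ.contDiff.differentiable (by simp)) (hgs.differentiable (by simp))
  have hi1 : IntegrableOn (fun z => Φ z * f (r⁻¹ * z.2)) halfPlane := by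
    refine hform.mul_bdd (c := 1) (hgs.continuous.comp continuous_snd).aestronglyMeasurable
      (Eventually.of_forall fun z => ?_)
    rw [Real.norm_eq_abs, abs_of_nonneg (hf01 _).1]; exact (hf01 _).2
  have hi2 : IntegrableOn (fun z => Q.eval (u z) * (θ z * (r⁻¹ * deriv f (r⁻¹ * z.2)))) halfPlane := by
    refine (Q.integrable_eval_mul H.measurable H.mem_Icc ?_ hθ.hasCompactSupport.mul_right)
    exact hθ.contDiff.continuous.mul
      (continuous_const.mul ((hf.continuous_deriv (by simp)).comp (by fun_prop)))
  rw [← integral_const_mul, ← integral_add hi1 (hi2.const_mul p), boundaryForm]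
  congr 1
  · refine integral_congr_ae (Eventually.of_forall fun z => ?_)
    simp only [(hd z).1, (hd z).2, hgd, hΦ]
    ring
  · simp [hf1]

end IsWeakTrace

/-- A smooth bump equal to one on `[-1, 1]` and supported in `[-2, 2]`. -/
noncomputable def unitBump : ContDiffBump (0 : ℝ) := ⟨1, 2, one_pos, one_lt_two⟩

lemma unitBump_eq_one {y : ℝ} (hy : |y| ≤ 1) : unitBump y = 1 :=
  unitBump.one_of_mem_closedBall (by simpa [unitBump] using hy)

lemma unitBump_eq_zero {y : ℝ} (hy : 2 ≤ |y|) : unitBump y = 0 :=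
  unitBump.zero_of_le_dist (by simpa [unitBump] using hy)

/-- A test function localized at scale `r` around the boundary point `(s, 0)`. -/
noncomputable def zoomTest (κ : ℝ × ℝ → ℝ) (r s : ℝ) (z : ℝ × ℝ) : ℝ :=
  κ z * unitBump (r⁻¹ * z.2) * unitBump (r⁻¹ * (z.1 - s))

/-- The quadratic dissipation around the boundary point `(s, 0)` at scale `r`. -/
noncomputable def zoomDissipation (p : ℝ) (u : ℝ × ℝ → ℝ) (m : ℕ → ℝ → ℝ) (κ : ℝ × ℝ → ℝ)
    (r s : ℝ) : ℝ :=
  boundaryForm p u m (X ^ 2) (X ^ 2 - C (4 / 3) * X ^ 3) (zoomTest κ r s)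

lemma zoomTest_nonneg {κ : ℝ × ℝ → ℝ} (hκ0 : ∀ z, 0 ≤ κ z) (r s : ℝ) (z : ℝ × ℝ) :
    0 ≤ zoomTest κ r s z :=
  mul_nonneg (mul_nonneg (hκ0 z) unitBump.nonneg) unitBump.nonneg

lemma IsBoundaryTest.mul_layer {T : ℝ} {κ : ℝ × ℝ → ℝ} (hκ : IsBoundaryTest T κ) (r : ℝ) :
    IsBoundaryTest T fun z => κ z * unitBump (r⁻¹ * z.2) :=
  hκ.mul_right (unitBump.contDiff.comp (contDiff_const.mul contDiff_snd))

lemma IsBoundaryTest.zoomTest {T : ℝ} {κ : ℝ × ℝ → ℝ} (hκ : IsBoundaryTest T κ) (r s : ℝ) :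
    IsBoundaryTest T (zoomTest κ r s) :=
  (hκ.mul_layer r).mul_right
    (unitBump.contDiff.comp (contDiff_const.mul (contDiff_fst.sub contDiff_const)))

namespace IsWeakTrace

variable {p T : ℝ} {u : ℝ × ℝ → ℝ} {m : ℕ → ℝ → ℝ} {κ : ℝ × ℝ → ℝ}

lemma zoomDissipation_nonneg (hm : IsWeakTrace T u m) (H : IsEntropySolution p T u)
    (hκ : IsBoundaryTest T κ) (hκ0 : ∀ z, 0 ≤ κ z) (r s : ℝ) :
    0 ≤ zoomDissipation p u m κ r s :=
  hm.boundaryForm_nonneg H derivative_square_flux (fun w _ => by simp) (hκ.zoomTest r s)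
    (zoomTest_nonneg hκ0 r s)

/-- Integrating over the centre s averages out the time cutoff: it contributes r times the mass of
the bump and leaves the dissipation of the whole layer of height r. This gains one power of r at a
typical boundary point. -/
lemma integral_zoomDissipation (hm : IsWeakTrace T u m) (H : IsEntropySolution p T u)
    (hκ : IsBoundaryTest T κ) {r : ℝ} (hr : 0 < r) :
    Integrable (zoomDissipation p u m κ r) ∧
      ∫ s, zoomDissipation p u m κ r s = r * (∫ y, unitBump y) *
        boundaryForm p u m (X ^ 2) (X ^ 2 - C (4 / 3) * X ^ 3)
          (fun z => κ z * unitBump (r⁻¹ * z.2)) := by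
  have hk : ContDiff ℝ ∞ fun t : ℝ => unitBump (r⁻¹ * t) :=
    unitBump.contDiff.comp (contDiff_const.mul contDiff_id)
  have hkc : HasCompactSupport fun t : ℝ => unitBump (r⁻¹ * t) := by
    refine HasCompactSupport.intro (isCompact_Icc (a := -(2 * r)) (b := 2 * r)) fun t ht => ?_
    refine unitBump_eq_zero ?_
    by_contra h
    rw [not_le, abs_mul, abs_of_pos (inv_pos.2 hr), inv_mul_lt_iff₀ hr, mul_comm r, abs_lt] at h
    exact ht ⟨h.1.le, h.2.le⟩
  obtain ⟨h1, h2⟩ := hm.integral_boundaryForm_translate H (X ^ 2) (X ^ 2 - C (4 / 3) * X ^ 3)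
    (hκ.mul_layer r) hk hkc
  refine ⟨h1, h2.trans ?_⟩
  rw [Measure.integral_comp_mul_left (fun t => unitBump t) r⁻¹]
  simp [abs_of_pos hr]

/-- Scales along which the dissipation vanishes at almost every boundary point. -/
lemma exists_scales (hm : IsWeakTrace T u m) (H : IsEntropySolution p T u)
    (hκ : IsBoundaryTest T κ) (hκ0 : ∀ z, 0 ≤ κ z) :
    ∃ r ε : ℕ → ℝ, (∀ n, 0 < ε n) ∧ Tendsto r atTop (𝓝 0) ∧ (∀ R, ∀ᶠ n in atTop, R * ε n ≤ r n) ∧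
      ∀ᵐ s, Tendsto (fun n => (ε n)⁻¹ * zoomDissipation p u m κ (r n) s) atTop (𝓝 0) := by
  have hlayer := hm.tendsto_boundaryForm_layer H (X ^ 2) (X ^ 2 - C (4 / 3) * X ^ 3) hκ
    unitBump.contDiff (unitBump_eq_one (by simp)) (R := 2)
    (fun y hy => unitBump_eq_zero (hy.le.trans (le_abs_self y)))
    (fun y => ⟨unitBump.nonneg, unitBump.le_one⟩)
  have hlim := (hlayer.const_mul (∫ y, unitBump y))
  rw [mul_zero] at hlim
  -- The layer dissipation is made smaller than 1/(n+1)² so that it survives division by a blow-up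
  -- scale smaller than r: with ε = r/(n+1) the average of the rescaled dissipation is at most
  -- 1/(n+1), while r/ε tends to infinity.
  have hex : ∀ n : ℕ, ∃ r : ℝ, 0 < r ∧ r < 1 / ((n : ℝ) + 1) ∧ (∫ y, unitBump y) *
      boundaryForm p u m (X ^ 2) (X ^ 2 - C (4 / 3) * X ^ 3) (fun z => κ z * unitBump (r⁻¹ * z.2)) <
        (1 / ((n : ℝ) + 1)) ^ 2 := by
    intro n
    have hpos : (0 : ℝ) < 1 / ((n : ℝ) + 1) := Nat.one_div_pos_of_nat
    obtain ⟨r, h1, h2⟩ := ((hlim.eventually_lt_const (pow_pos hpos 2)).and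
      (Ioo_mem_nhdsGT hpos)).exists
    exact ⟨r, h2.1, h2.2, h1⟩
  choose r hr0 hr1 hr2 using hex
  set f : ℕ → ℝ → ℝ := fun n s => (r n / ((n : ℝ) + 1))⁻¹ * zoomDissipation p u m κ (r n) s with hf
  have hfi : ∀ n, Integrable (f n) := fun n =>
    (hm.integral_zoomDissipation H hκ (hr0 n)).1.const_mul _
  have hf0 : ∀ n s, 0 ≤ f n s := fun n s =>
    mul_nonneg (inv_nonneg.2 (div_nonneg (hr0 n).le (by positivity)))
      (hm.zoomDissipation_nonneg H hκ hκ0 _ _)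
  have hfI : ∀ n, ∫ s, f n s ≤ 1 / ((n : ℝ) + 1) := by
    intro n
    have hn : (0 : ℝ) < (n : ℝ) + 1 := by positivity
    simp only [hf]
    rw [integral_const_mul, (hm.integral_zoomDissipation H hκ (hr0 n)).2, mul_assoc (r n)]
    have e : ∀ a : ℝ, (r n / ((n : ℝ) + 1))⁻¹ * (r n * a) = ((n : ℝ) + 1) * a := by
      intro a
      have := (hr0 n).ne'
      field_simp
    rw [e]
    refine (mul_le_mul_of_nonneg_left (hr2 n).le hn.le).trans (le_of_eq ?_)
    field_simp
  -- The rescaled dissipations are nonnegative with integrals tending to zero, so they converge in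
  -- measure and a subsequence converges almost everywhere.
  have hmeas : TendstoInMeasure volume f atTop (fun _ => (0 : ℝ)) := by
    refine tendstoInMeasure_of_tendsto_eLpNorm (p := 1) one_ne_zero
      (fun n => (hfi n).aestronglyMeasurable) aestronglyMeasurable_const ?_
    have h1 : ∀ n, eLpNorm (f n - fun _ => (0 : ℝ)) 1 volume = ENNReal.ofReal (∫ s, f n s) := by
      intro n
      have : (f n - fun _ => (0 : ℝ)) = f n := by ext s; simp
      rw [this, eLpNorm_one_eq_lintegral_enorm, ← ofReal_integral_norm_eq_lintegral_enorm (hfi n)]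
      congr 1
      refine integral_congr_ae (Eventually.of_forall fun s => ?_)
      simp [abs_of_nonneg (hf0 n s)]
    simp_rw [h1]
    rw [← ENNReal.ofReal_zero]
    refine ENNReal.tendsto_ofReal ?_
    exact squeeze_zero (fun n => integral_nonneg (hf0 n)) hfI tendsto_one_div_add_atTop_nhds_zero_nat
  obtain ⟨ns, hns, hae⟩ := hmeas.exists_seq_tendsto_ae
  refine ⟨fun n => r (ns n), fun n => r (ns n) / ((ns n : ℝ) + 1), fun n =>
    div_pos (hr0 _) (by positivity), ?_, fun R => ?_, hae⟩
  · have h1 : Tendsto r atTop (𝓝 0) := squeeze_zero (fun n => (hr0 n).le) (fun n => (hr1 n).le)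
      tendsto_one_div_add_atTop_nhds_zero_nat
    exact h1.comp hns.tendsto_atTop
  · have h1 : Tendsto (fun n => (ns n : ℝ)) atTop atTop :=
      tendsto_natCast_atTop_atTop.comp hns.tendsto_atTop
    filter_upwards [h1.eventually_ge_atTop R] with n hn
    have h2 : (0 : ℝ) < (ns n : ℝ) + 1 := by positivity
    rw [mul_div_assoc', div_le_iff₀ h2, mul_comm]
    exact mul_le_mul_of_nonneg_left (by linarith) (hr0 _).le

end IsWeakTrace

/-- Lebesgue points, in blow-up coordinates. -/
lemma ae_tendsto_integral_abs_sub_zoom {f : ℝ → ℝ} (hf : LocallyIntegrable f) :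
    ∀ᵐ t, ∀ ε : ℕ → ℝ, (∀ n, 0 < ε n) → Tendsto ε atTop (𝓝 0) → ∀ R : ℝ,
      Tendsto (fun n => ∫ s in Icc (-R) R, |f (t + ε n * s) - f t|) atTop (𝓝 0) := by
  filter_upwards [IsUnifLocDoublingMeasure.ae_tendsto_average_norm_sub (μ := volume) hf 1]
    with t ht ε hε0 hε R
  rcases le_or_gt R 0 with hR | hR
  · have h0 : volume (Icc (-R) R) = 0 := by
      rw [Real.volume_Icc, ENNReal.ofReal_eq_zero]; linarith
    simp [Measure.restrict_eq_zero.2 h0]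
  · have hδ : Tendsto (fun n => R * ε n) atTop (𝓝[>] 0) := by
      refine tendsto_nhdsWithin_iff.2 ⟨by simpa using hε.const_mul R,
        Eventually.of_forall fun n => mul_pos hR (hε0 n)⟩
    have h1 := (ht (fun _ => t) _ hδ (Eventually.of_forall fun n => by
      have := mul_pos hR (hε0 n)
      simp [this.le])).const_mul (2 * R)
    rw [mul_zero] at h1
    refine h1.congr fun n => ?_
    have hRε := mul_pos hR (hε0 n)
    have h2 := intervalIntegral.integral_comp_add_mul (a := -R) (b := R)
      (fun y => |f y - f t|) (hε0 n).ne' t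
    rw [setAverage_eq, Real.closedBall_eq_Icc, Real.volume_real_Icc_of_le (by linarith),
      integral_Icc_eq_integral_Ioc, integral_Icc_eq_integral_Ioc,
      ← intervalIntegral.integral_of_le (by linarith),
      ← intervalIntegral.integral_of_le (by linarith), h2]
    have e1 : t + ε n * -R = t - R * ε n := by ring
    have e2 : t + ε n * R = t + R * ε n := by ring
    simp only [Real.norm_eq_abs, smul_eq_mul, e1, e2]
    have := (hε0 n).ne'
    rw [← mul_assoc]
    congr 1
    field_simp
    ring

/-! ### Blow-up at almost every boundary point. -/

/-- Data at a boundary point `(t₀, 0)` at which the blow-up procedure works: the dissipation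
vanishes along the scales `ε`, and `t₀` is a Lebesgue point of all weak traces. -/
structure IsZoomPoint (p T : ℝ) (u : ℝ × ℝ → ℝ) (m : ℕ → ℝ → ℝ) (κ : ℝ × ℝ → ℝ) (r ε : ℕ → ℝ)
    (t₀ : ℝ) : Prop where
  mem_Ioo : t₀ ∈ Ioo 0 T
  cutoff : ∃ ρ > 0, ∀ z : ℝ × ℝ, |z.1 - t₀| ≤ ρ → |z.2| ≤ ρ → κ z = 1
  pos : ∀ n, 0 < ε n
  tendsto_scale : Tendsto r atTop (𝓝 0)
  scale : ∀ R, ∀ᶠ n in atTop, R * ε n ≤ r n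
  dissipation : Tendsto (fun n => (ε n)⁻¹ * zoomDissipation p u m κ (r n) t₀) atTop (𝓝 0)
  lebesgue : ∀ i R, Tendsto (fun n => ∫ s in Icc (-R) R, |m i (t₀ + ε n * s) - m i t₀|) atTop (𝓝 0)

namespace IsZoomPoint

variable {p T : ℝ} {u : ℝ × ℝ → ℝ} {m : ℕ → ℝ → ℝ} {κ : ℝ × ℝ → ℝ} {r ε : ℕ → ℝ} {t₀ : ℝ}

lemma tendsto_eps (h : IsZoomPoint p T u m κ r ε t₀) : Tendsto ε atTop (𝓝 0) := by
  refine squeeze_zero' (Eventually.of_forall fun n => (h.pos n).le) ?_ h.tendsto_scale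
  filter_upwards [h.scale 1] with n hn
  simpa using hn

/-- Rescaled test functions are admissible and dominated by the localized cutoffs. -/
lemma eventually_test (h : IsZoomPoint p T u m κ r ε t₀) (hκ0 : ∀ z, 0 ≤ κ z) {K : Set (ℝ × ℝ)}
    (hK : IsCompact K) :
    ∀ᶠ n in atTop, ∀ θ : ℝ × ℝ → ℝ, ContDiff ℝ ∞ θ → tsupport θ ⊆ K →
      IsBoundaryTest T (fun z => θ ((ε n)⁻¹ * (z.1 - t₀), (ε n)⁻¹ * z.2)) ∧
      ∀ B, (∀ z, |θ z| ≤ B) → ∀ z, |θ ((ε n)⁻¹ * (z.1 - t₀), (ε n)⁻¹ * z.2)| ≤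
        B * zoomTest κ (r n) t₀ z := by
  obtain ⟨ρ, hρ, hκ1⟩ := h.cutoff
  obtain ⟨R', hR'⟩ := hK.isBounded.subset_closedBall (0 : ℝ × ℝ)
  set R := |R'| with hR
  have hlim : Tendsto (fun n => R * ε n) atTop (𝓝 0) := by simpa using h.tendsto_eps.const_mul R
  have hmin : 0 < min (min t₀ (T - t₀)) (min 1 ρ) :=
    lt_min (lt_min h.mem_Ioo.1 (by linarith [h.mem_Ioo.2])) (lt_min one_pos hρ)
  filter_upwards [h.scale R, hlim.eventually_lt_const hmin] with n hn1 hn2 θ hθ hθK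
  have hε := h.pos n
  have h1 : R * ε n < t₀ := hn2.trans_le ((min_le_left _ _).trans (min_le_left _ _))
  have h2 : R * ε n < T - t₀ := hn2.trans_le ((min_le_left _ _).trans (min_le_right _ _))
  have h3 : R * ε n < 1 := hn2.trans_le ((min_le_right _ _).trans (min_le_left _ _))
  have h4 : R * ε n < ρ := hn2.trans_le ((min_le_right _ _).trans (min_le_right _ _))
  have hsupp : ∀ z : ℝ × ℝ, θ ((ε n)⁻¹ * (z.1 - t₀), (ε n)⁻¹ * z.2) ≠ 0 →
      |z.1 - t₀| ≤ R * ε n ∧ |z.2| ≤ R * ε n := by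
    intro z hz
    have h5 := hR' (hθK (subset_tsupport _ hz))
    rw [mem_closedBall_zero_iff, Prod.norm_def, max_le_iff] at h5
    simp only [Real.norm_eq_abs, abs_mul, abs_of_pos (inv_pos.2 hε)] at h5
    have h6 : R' ≤ R := le_abs_self R'
    rw [inv_mul_le_iff₀ hε, inv_mul_le_iff₀ hε] at h5
    have h7 : ε n * R' ≤ R * ε n := by rw [mul_comm]; gcongr
    exact ⟨h5.1.trans h7, h5.2.trans h7⟩
  have htsupp : tsupport (fun z : ℝ × ℝ => θ ((ε n)⁻¹ * (z.1 - t₀), (ε n)⁻¹ * z.2)) ⊆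
      Metric.closedBall (t₀, 0) (R * ε n) := by
    refine closure_minimal (fun z hz => ?_) Metric.isClosed_closedBall
    have h5 := hsupp z hz
    rw [Metric.mem_closedBall, Prod.dist_eq, max_le_iff, Real.dist_eq, Real.dist_eq, sub_zero]
    exact h5
  refine ⟨⟨hθ.comp (by fun_prop), (isCompact_closedBall _ _).of_isClosed_subset
    (isClosed_tsupport _) htsupp, htsupp.trans fun z hz => ?_⟩, fun B hB z => ?_⟩
  · rw [Metric.mem_closedBall, Prod.dist_eq, max_le_iff, Real.dist_eq, Real.dist_eq, sub_zero] at hz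
    have h5 := abs_le.1 hz.1
    have h6 := abs_le.1 hz.2
    refine ⟨⟨?_, ?_⟩, ?_⟩
    · linarith [h5.1]
    · linarith [h5.2]
    · exact h6.2.trans_lt h3
  · by_cases hz : θ ((ε n)⁻¹ * (z.1 - t₀), (ε n)⁻¹ * z.2) = 0
    · rw [hz, abs_zero]
      exact mul_nonneg ((abs_nonneg _).trans (hB 0)) (zoomTest_nonneg hκ0 _ _ _)
    · obtain ⟨h5, h6⟩ := hsupp z hz
      have hR0 : 0 ≤ R * ε n := mul_nonneg (abs_nonneg _) hε.le
      have hrr : ∀ y, |y| ≤ R * ε n → |(r n)⁻¹ * y| ≤ 1 := by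
        intro y hy
        -- Positivity of `r n` is not part of the data; when it is zero, its inverse is zero and the
        -- bound is trivial.
        rcases (hR0.trans hn1).eq_or_lt with h0 | h0
        · rw [← h0]; simp
        · rw [abs_mul, abs_of_pos (inv_pos.2 h0), inv_mul_le_iff₀ h0, mul_one]
          exact hy.trans hn1
      rw [zoomTest, hκ1 z (h5.trans h4.le) (h6.trans h4.le), unitBump_eq_one (hrr _ h5),
        unitBump_eq_one (hrr _ h6), mul_one, mul_one, mul_one]
      exact hB _

/-- Domination by the localized cutoff lets the quadratic dissipation at scale r control every
entropy at scale ε. The index from which this holds depends only on the compact set K, not on the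
test or the entropy. -/
lemma eventually_abs_boundaryForm_le (h : IsZoomPoint p T u m κ r ε t₀) (hm : IsWeakTrace T u m)
    (H : IsEntropySolution p T u) (hκ : IsBoundaryTest T κ) (hκ0 : ∀ z, 0 ≤ κ z)
    {K : Set (ℝ × ℝ)} (hK : IsCompact K) :
    ∀ᶠ n in atTop, ∀ θ : ℝ × ℝ → ℝ, ContDiff ℝ ∞ θ → tsupport θ ⊆ K →
      ∀ B, (∀ z, |θ z| ≤ B) → ∀ (F Q : ℝ[X]) (M : ℝ),
        derivative Q = (1 - 2 * X) * derivative F →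
        (∀ w ∈ Icc (0 : ℝ) 1, |(derivative (derivative F)).eval w| ≤ 2 * M) →
        |boundaryForm p (fun z => u (t₀ + ε n * z.1, ε n * z.2)) (fun i s => m i (t₀ + ε n * s))
          F Q θ| ≤ M * (B * ((ε n)⁻¹ * zoomDissipation p u m κ (r n) t₀)) := by
  filter_upwards [h.eventually_test hκ0 hK] with n hn θ hθ hθK B hB F Q M hFQ hM
  obtain ⟨h1, h2⟩ := hn θ hθ hθK
  have hε := h.pos n
  have h3 := hm.abs_boundaryForm_le H hFQ hM h1 ((hκ.zoomTest (r n) t₀).const_mul B) (h2 B hB)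
  rw [boundaryForm_comp_scale p u m F Q (hθ.differentiable (by simp)) t₀ hε,
    IsWeakTrace.boundaryForm_const_mul_test _ _ (hκ.zoomTest (r n) t₀), abs_mul,
    abs_of_pos hε] at h3
  have h4 := mul_le_mul_of_nonneg_left h3 (inv_nonneg.2 hε.le)
  rw [← mul_assoc, inv_mul_cancel₀ hε.ne', one_mul] at h4
  refine h4.trans (le_of_eq ?_)
  rw [zoomDissipation]; ring

lemma eventually_boundaryForm_nonneg (h : IsZoomPoint p T u m κ r ε t₀) (hm : IsWeakTrace T u m)
    (H : IsEntropySolution p T u) (hκ0 : ∀ z, 0 ≤ κ z) {K : Set (ℝ × ℝ)} (hK : IsCompact K) :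
    ∀ᶠ n in atTop, ∀ θ : ℝ × ℝ → ℝ, ContDiff ℝ ∞ θ → tsupport θ ⊆ K → (∀ z, 0 ≤ θ z) →
      0 ≤ boundaryForm p (fun z => u (t₀ + ε n * z.1, ε n * z.2)) (fun i s => m i (t₀ + ε n * s))
        (X ^ 2) (X ^ 2 - C (4 / 3) * X ^ 3) θ := by
  filter_upwards [h.eventually_test hκ0 hK] with n hn θ hθ hθK hθ0
  have hε := h.pos n
  have h1 := hm.boundaryForm_nonneg H derivative_square_flux (fun w _ => by simp)
    (hn θ hθ hθK).1 fun z => hθ0 _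
  rw [boundaryForm_comp_scale p u m _ _ (hθ.differentiable (by simp)) t₀ hε] at h1
  exact nonneg_of_mul_nonneg_right h1 hε

/-- The functional evaluated at a fixed polynomial is a finite combination of moments, and t₀ is a
Lebesgue point of each of them. -/
lemma lebesgue_trace (h : IsZoomPoint p T u m κ r ε t₀) (hm : IsWeakTrace T u m) (Q : ℝ[X])
    (R : ℝ) : Tendsto (fun n => ∫ s in Icc (-R) R,
      |traceFunctional m (t₀ + ε n * s) Q - traceFunctional m t₀ Q|) atTop (𝓝 0) := by
  have h1 := tendsto_finsetSum Q.support fun i _ => (h.lebesgue i R).const_mul |Q.coeff i|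
  simp only [mul_zero, Finset.sum_const_zero] at h1
  refine squeeze_zero (fun n => integral_nonneg fun _ => abs_nonneg _) (fun n => ?_) h1
  have hi : ∀ i, IntegrableOn (fun s => |Q.coeff i| * |m i (t₀ + ε n * s) - m i t₀|)
      (Icc (-R) R) := by
    intro i
    refine Integrable.const_mul ?_ _
    have hmeas : Measurable fun s => |m i (t₀ + ε n * s) - m i t₀| :=
      (((hm.measurable i).comp (by fun_prop)).sub_const _).abs
    refine Integrable.of_bound (C := 1) hmeas.aestronglyMeasurable (Eventually.of_forall fun s => ?_)
    rw [Real.norm_eq_abs, abs_abs, abs_le]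
    have a1 := hm.mem_Icc i (t₀ + ε n * s)
    have a2 := hm.mem_Icc i t₀
    constructor <;> linarith [a1.1, a1.2, a2.1, a2.2]
  simp_rw [← integral_const_mul]
  rw [← integral_finsetSum _ fun i _ => hi i]
  refine integral_mono_of_nonneg (Eventually.of_forall fun _ => abs_nonneg _)
    (integrable_finsetSum _ fun i _ => hi i) (Eventually.of_forall fun s => ?_)
  simp only [traceFunctional_apply]
  rw [← Finset.sum_sub_distrib]
  refine (Finset.abs_sum_le_sum_abs _ _).trans (Finset.sum_le_sum fun i _ => ?_)
  rw [← sub_mul, abs_mul, mul_comm]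

/-- Lebesgue points in weak form. -/
lemma tendsto_integral_trace (h : IsZoomPoint p T u m κ r ε t₀) (hm : IsWeakTrace T u m) (Q : ℝ[X])
    {g : ℝ → ℝ} {B R : ℝ} (hg : Measurable g) (hB : ∀ s, |g s| ≤ B)
    (hR : ∀ s, s ∉ Icc (-R) R → g s = 0) :
    Tendsto (fun n => ∫ s, traceFunctional m (t₀ + ε n * s) Q * g s) atTop
      (𝓝 (traceFunctional m t₀ Q * ∫ s, g s)) := by
  have hgi : Integrable g := by
    have h1 : IntegrableOn g (Icc (-R) R) := Integrable.of_bound (C := B) hg.aestronglyMeasurable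
      (Eventually.of_forall hB)
    rwa [integrableOn_iff_integrable_of_support_subset fun s hs => by
      by_contra hs'; exact hs (hR s hs')] at h1
  obtain ⟨M, -, hM⟩ := hm.exists_abs_trace_le Q
  have hmeas : ∀ n, Measurable fun s => traceFunctional m (t₀ + ε n * s) Q := fun n =>
    (hm.measurable_trace Q).comp (by fun_prop)
  rw [tendsto_iff_dist_tendsto_zero]
  have h1 := (h.lebesgue_trace hm Q R).mul_const B
  rw [zero_mul] at h1
  refine squeeze_zero (fun n => dist_nonneg) (fun n => ?_) h1
  rw [Real.dist_eq, ← integral_const_mul, ← integral_sub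
    (hgi.bdd_mul (c := M) (hmeas n).aestronglyMeasurable (Eventually.of_forall fun s => hM _))
    (hgi.const_mul _), ← setIntegral_eq_integral_of_forall_compl_eq_zero (s := Icc (-R) R)
    fun s hs => by rw [hR s hs]; simp, ← integral_mul_const]
  refine abs_integral_le_integral_abs.trans (integral_mono_of_nonneg
    (Eventually.of_forall fun _ => abs_nonneg _) ?_ (Eventually.of_forall fun s => ?_))
  · refine Integrable.mul_const ?_ B
    refine Integrable.of_bound (C := M + M) ((hmeas n).sub_const _).abs.aestronglyMeasurable
      (Eventually.of_forall fun s => ?_)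
    rw [Real.norm_eq_abs, abs_abs]
    exact (abs_sub _ _).trans (add_le_add (hM _) (hM _))
  · simp only [← sub_mul, abs_mul]
    exact mul_le_mul_of_nonneg_left (hB s) (abs_nonneg _)

/-- The almost-everywhere bound holds for averages over (t₀ - ε, t₀ + ε), and these averages
converge to the value at t₀. Hence one zoom point serves all polynomials at once. -/
lemma abs_trace_le (h : IsZoomPoint p T u m κ r ε t₀) (hm : IsWeakTrace T u m)
    (H : IsEntropySolution p T u) {Q : ℝ[X]} {M : ℝ} (hM : ∀ w ∈ Icc (0 : ℝ) 1, |Q.eval w| ≤ M) :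
    |traceFunctional m t₀ Q| ≤ M := by
  have h1 := h.tendsto_integral_trace hm Q (g := (Icc (-1 : ℝ) 1).indicator fun _ => 1) (B := 1)
    (R := 1) (measurable_const.indicator measurableSet_Icc)
    (fun s => by by_cases hs : s ∈ Icc (-1 : ℝ) 1 <;> simp [hs]) (fun s hs => by simp [hs])
  have e : ∫ s, (Icc (-1 : ℝ) 1).indicator (fun _ => (1 : ℝ)) s = 2 := by
    rw [integral_indicator measurableSet_Icc]; norm_num
  rw [e] at h1
  have h2 : |traceFunctional m t₀ Q * 2| ≤ M * 2 := by
    refine le_of_tendsto h1.abs ?_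
    have hev : ∀ᶠ n in atTop, ε n < min t₀ (T - t₀) :=
      h.tendsto_eps.eventually_lt_const (lt_min h.mem_Ioo.1 (by linarith [h.mem_Ioo.2]))
    filter_upwards [hev] with n hn
    have hε := h.pos n
    have e1 : ∫ s, traceFunctional m (t₀ + ε n * s) Q * (Icc (-1 : ℝ) 1).indicator (fun _ => 1) s =
        (ε n)⁻¹ * ∫ t in (t₀ + ε n * -1)..(t₀ + ε n * 1), traceFunctional m t Q := by
      rw [← smul_eq_mul, ← intervalIntegral.integral_comp_add_mul
        (fun t => traceFunctional m t Q) hε.ne' t₀, intervalIntegral.integral_of_le (by norm_num),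
        ← integral_Icc_eq_integral_Ioc, ← integral_indicator measurableSet_Icc]
      refine integral_congr_ae (Eventually.of_forall fun s => ?_)
      by_cases hs : s ∈ Icc (-1 : ℝ) 1 <;> simp [hs]
    have h3 : ‖∫ t in (t₀ + ε n * -1)..(t₀ + ε n * 1), traceFunctional m t Q‖ ≤
        M * |(t₀ + ε n * 1) - (t₀ + ε n * -1)| := by
      refine intervalIntegral.norm_integral_le_of_norm_le_const_ae ?_
      have h4 := (ae_restrict_iff' measurableSet_Icc).1 (hm.ae_abs_trace_le H hM)
      filter_upwards [h4] with t ht hts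
      rw [uIoc_of_le (by linarith)] at hts
      have a1 := hn.trans_le (min_le_left _ _)
      have a2 := hn.trans_le (min_le_right _ _)
      exact ht ⟨by linarith [hts.1], by linarith [hts.2]⟩
    have e2 : (t₀ + ε n * 1) - (t₀ + ε n * -1) = 2 * ε n := by ring
    rw [e2, abs_of_pos (by positivity), Real.norm_eq_abs] at h3
    rw [e1, abs_mul, abs_of_pos (inv_pos.2 hε), inv_mul_le_iff₀ hε]
    linarith
  rw [abs_mul, abs_two] at h2
  linarith

/-- Zooming in at such a point produces a blow-up sequence. -/
lemma isBlowUp (h : IsZoomPoint p T u m κ r ε t₀) (hm : IsWeakTrace T u m)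
    (H : IsEntropySolution p T u) (hκ : IsBoundaryTest T κ) (hκ0 : ∀ z, 0 ≤ κ z) :
    IsBlowUp p (fun n z => u (t₀ + ε n * z.1, ε n * z.2))
      (fun n s => traceFunctional m (t₀ + ε n * s) (X - X ^ 2)) (traceFunctional m t₀) where
  measurable n := H.measurable.comp (by fun_prop)
  mem_Icc n z := H.mem_Icc _
  measurable_flux n := (hm.measurable_trace _).comp (by fun_prop)
  abs_flux_le n s := by
    rw [map_sub, traceFunctional_X, traceFunctional_X_pow, abs_le]
    have a1 := hm.mem_Icc 1 (t₀ + ε n * s)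
    have a2 := hm.mem_Icc 2 (t₀ + ε n * s)
    constructor <;> linarith [a1.1, a1.2, a2.1, a2.2]
  map_one := hm.map_one t₀
  abs_map_le Q M hM := h.abs_trace_le hm H hM
  tendsto_flux R := h.lebesgue_trace hm _ R
  -- The rescaled form tends to zero because the dissipation does; the Lebesgue point property
  -- replaces the moving boundary trace of Q by its value at t₀.
  transport F Q hFQ θ hθ hθc := by
    obtain ⟨B, hB⟩ := hθ.continuous.bounded_above_of_compact_support hθc
    obtain ⟨M, -, hM⟩ := (derivative (derivative F)).exists_abs_eval_le
    obtain ⟨R, hR⟩ := (hθc.slice 0).isCompact.isBounded.subset_closedBall (0 : ℝ)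
    have h1 : Tendsto (fun n => boundaryForm p (fun z => u (t₀ + ε n * z.1, ε n * z.2))
        (fun i s => m i (t₀ + ε n * s)) F Q θ) atTop (𝓝 0) := by
      have h2 := (h.dissipation.const_mul B).const_mul (M / 2)
      simp only [mul_zero] at h2
      refine squeeze_zero_norm' ?_ h2
      filter_upwards [h.eventually_abs_boundaryForm_le hm H hκ hκ0 hθc.isCompact] with n hn
      exact hn θ hθ Subset.rfl B hB F Q (M / 2) hFQ fun w hw => by linarith [hM w hw]
    have h2 := h.tendsto_integral_trace hm Q (g := fun s => θ (s, 0)) (B := B) (R := R)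
      (hθ.continuous.comp (by fun_prop)).measurable (fun s => hB _) fun s hs => by
        by_contra h0
        have := hR (subset_tsupport _ h0)
        rw [Real.closedBall_eq_Icc, zero_sub, zero_add] at this
        exact hs this
    have h3 := h1.sub (h2.const_mul p)
    rw [zero_sub] at h3
    refine h3.congr fun n => ?_
    simp only [boundaryForm]
    exact add_sub_cancel_right _ _
  -- The entropy X has zero second derivative, so the domination holds with M = 0 and gives an exact
  -- identity for large n.
  conservation K hK := by
    filter_upwards [h.eventually_abs_boundaryForm_le hm H hκ hκ0 hK] with n hn θ hθ hθc hθK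
    obtain ⟨B, hB⟩ := hθ.continuous.bounded_above_of_compact_support hθc
    have h1 := hn θ hθ hθK B hB X (X - X ^ 2) 0 (by simp; norm_num) fun w _ => by simp
    rw [zero_mul] at h1
    have h2 := abs_eq_zero.1 (le_antisymm h1 (abs_nonneg _))
    simp only [boundaryForm, eval_X, eval_sub, eval_pow] at h2
    exact eq_neg_of_add_eq_zero_left h2
  entropy K hK hKhp := by
    filter_upwards [h.eventually_boundaryForm_nonneg hm H hκ0 hK] with n hn θ hθ hθc hθK hθ0
    have h1 := hn θ hθ hθK hθ0
    have h2 : ∀ s, θ (s, 0) = 0 := fun s => by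
      by_contra h0
      exact lt_irrefl (0 : ℝ) (hKhp (hθK (subset_tsupport _ h0)))
    simpa [boundaryForm, h2] using h1

end IsZoomPoint

/-! ### From weak to strong traces. -/

/-- At almost every time the weak traces of `u` and `u ^ 2` are compatible. -/
lemma IsWeakTrace.ae_eq_sq {p T : ℝ} {u : ℝ × ℝ → ℝ} {m : ℕ → ℝ → ℝ} (hm : IsWeakTrace T u m)
    (H : IsEntropySolution p T u) (hp : 0 < p) (hT : 0 < T) :
    ∀ᵐ t ∂(volume.restrict (Icc 0 T)), m 2 t = m 1 t ^ 2 := by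
  have hleb : ∀ᵐ t, ∀ i, ∀ ε : ℕ → ℝ, (∀ n, 0 < ε n) → Tendsto ε atTop (𝓝 0) → ∀ R : ℝ,
      Tendsto (fun n => ∫ s in Icc (-R) R, |m i (t + ε n * s) - m i t|) atTop (𝓝 0) := by
    refine ae_all_iff.2 fun i => ae_tendsto_integral_abs_sub_zoom ?_
    refine (locallyIntegrable_const (1 : ℝ)).mono (hm.measurable i).aestronglyMeasurable
      (Eventually.of_forall fun t => ?_)
    rw [Real.norm_eq_abs, abs_of_nonneg (hm.mem_Icc i t).1]
    simpa using (hm.mem_Icc i t).2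
  -- The cutoff must have compact support in (0,T) yet equal one near the blow-up point. Countably
  -- many inner intervals exhaust (0,T), each with its own cutoff and scales.
  have hloc : ∀ k : ℕ, ∀ᵐ t, t ∈ Ioo (2 * (T / 8 * (1 / ((k : ℝ) + 1))))
      (T - 2 * (T / 8 * (1 / ((k : ℝ) + 1)))) → m 2 t = m 1 t ^ 2 := by
    intro k
    set δ := T / 8 * (1 / ((k : ℝ) + 1)) with hδ
    have hk : (0 : ℝ) < 1 / ((k : ℝ) + 1) := Nat.one_div_pos_of_nat
    have hk1 : 1 / ((k : ℝ) + 1) ≤ 1 := by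
      rw [div_le_one (by positivity)]; linarith [Nat.cast_nonneg (α := ℝ) k]
    have hδ0 : 0 < δ := by positivity
    have hδT : 4 * δ < T := by rw [hδ]; nlinarith
    obtain ⟨Ψ, hΨs, hΨc, hΨT, hΨ0, -, hΨ1⟩ := exists_cutoff hδ0 hδT
    -- The factor 3 keeps the support in [-2/3, 2/3], below the opposite boundary x = 1, while χ = 1
    -- for |x| ≤ 1/3.
    set χ : ℝ → ℝ := fun x => unitBump (3 * x) with hχ
    have hχz : ∀ x, x ∉ Icc (-(2 / 3) : ℝ) (2 / 3) → χ x = 0 := fun x hx => by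
      refine unitBump_eq_zero ?_
      by_contra h0
      rw [not_le, abs_lt] at h0
      exact hx ⟨by linarith [h0.1], by linarith [h0.2]⟩
    have hχsupp : tsupport χ ⊆ Icc (-(2 / 3) : ℝ) (2 / 3) :=
      closure_minimal (fun x hx => by by_contra h0; exact hx (hχz x h0)) isClosed_Icc
    have hχc : HasCompactSupport χ := isCompact_Icc.of_isClosed_subset (isClosed_tsupport _) hχsupp
    have hχs : ContDiff ℝ ∞ χ := unitBump.contDiff.comp (contDiff_const.mul contDiff_id)
    obtain ⟨hc, hsub⟩ := hasCompactSupport_mul_prod hΨc hχc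
    have hκ : IsBoundaryTest T fun z => Ψ z.1 * χ z.2 :=
      ⟨(hΨs.comp contDiff_fst).mul (hχs.comp contDiff_snd), hc,
        hsub.trans (prod_mono hΨT (hχsupp.trans fun x hx => by
          have := hx.2
          simp only [mem_Iio]; linarith))⟩
    have hκ0 : ∀ z : ℝ × ℝ, 0 ≤ Ψ z.1 * χ z.2 := fun z => mul_nonneg (hΨ0 _) unitBump.nonneg
    obtain ⟨r, ε, hε0, hr, hscale, hae⟩ := hm.exists_scales H hκ hκ0
    filter_upwards [hleb, hae] with t h1 h2 ht
    have hε : Tendsto ε atTop (𝓝 0) := by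
      refine squeeze_zero' (Eventually.of_forall fun n => (hε0 n).le) ?_ hr
      filter_upwards [hscale 1] with n hn
      simpa using hn
    have hpt : IsZoomPoint p T u m (fun z => Ψ z.1 * χ z.2) r ε t := by
      refine ⟨⟨by linarith [ht.1], by linarith [ht.2]⟩, ?_, hε0, hr, hscale, h2,
        fun i => h1 i ε hε0 hε⟩
      refine ⟨min (1 / 3) (min (t - 2 * δ) (T - 2 * δ - t)), lt_min (by norm_num)
        (lt_min (by linarith [ht.1]) (by linarith [ht.2])), fun z hz1 hz2 => ?_⟩
      have a1 := abs_le.1 (hz1.trans ((min_le_right _ _).trans (min_le_left _ _)))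
      have a2 := abs_le.1 (hz1.trans ((min_le_right _ _).trans (min_le_right _ _)))
      have a3 := hz2.trans (min_le_left _ _)
      rw [hΨ1 z.1 ⟨by linarith [a1.1], by linarith [a2.2]⟩, one_mul]
      refine unitBump_eq_one ?_
      rw [abs_mul, abs_of_pos (by norm_num)]
      linarith
    have h3 := (hpt.isBlowUp hm H hκ hκ0).map_X_sq hp
    rwa [traceFunctional_X_pow, traceFunctional_X] at h3
  rw [← restrict_Ioo_eq_restrict_Icc]
  refine (ae_restrict_iff' measurableSet_Ioo).2 ?_
  filter_upwards [ae_all_iff.2 hloc] with t ht ht0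
  have hlim : Tendsto (fun k : ℕ => 2 * (T / 8 * (1 / ((k : ℝ) + 1)))) atTop (𝓝 0) := by
    simpa using (tendsto_one_div_add_atTop_nhds_zero_nat (𝕜 := ℝ)).const_mul (T / 8) |>.const_mul 2
  obtain ⟨k, hk⟩ := (hlim.eventually_lt_const
    (lt_min ht0.1 (show 0 < T - t by linarith [ht0.2]))).exists
  exact ht k ⟨hk.trans_le (min_le_left _ _), by
    have := hk.trans_le (min_le_right _ _)
    linarith⟩

/-- Entropy solutions have strong traces at `x = 0`. -/
lemma IsEntropySolution.exists_strongTrace {p T : ℝ} {u : ℝ × ℝ → ℝ} (H : IsEntropySolution p T u)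
    (hp : 0 < p) (hT : 0 < T) : ∃ w : ℝ → ℝ, Measurable w ∧ (∀ t, w t ∈ Icc (0 : ℝ) 1) ∧
      EssLimZero (fun x => ∫ t in Icc 0 T, |u (t, x) - w t|) 0 := by
  obtain ⟨m, hm⟩ := H.exists_isWeakTrace hp hT
  have hsq := hm.ae_eq_sq H hp hT
  refine ⟨m 1, hm.measurable 1, hm.mem_Icc 1, ?_⟩
  set μ := volume.restrict (Icc 0 T) with hμ
  have hus : ∀ x, Measurable fun t => u (t, x) := fun x => H.measurable.comp (by fun_prop)
  have hbd : ∀ {f : ℝ → ℝ}, Measurable f → (∀ t, f t ∈ Icc (-1 : ℝ) 1) → Integrable f μ := by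
    intro f hf h
    exact Integrable.of_bound (C := 1) hf.aestronglyMeasurable
      (Eventually.of_forall fun t => abs_le.2 (h t))
  have hw2 : MemLp (m 1) 2 μ := MemLp.of_bound (hm.measurable 1).aestronglyMeasurable 1
    (Eventually.of_forall fun t => by
      rw [Real.norm_eq_abs, abs_of_nonneg (hm.mem_Icc 1 t).1]; exact (hm.mem_Icc 1 t).2)
  have h1 := hm.essLim 2 (fun _ => 1) (memLp_const _)
  have h2 := hm.essLim 1 (m 1) hw2
  -- Expanding the square gives the limit ∫ m2 - 2∫ m1² + ∫ m1², which vanishes by m2 = m1².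
  have h3 := (h1.sub (h2.const_mul 2)).add_const (∫ t, m 1 t ^ 2 ∂μ)
  have e1 : (∫ t in Icc 0 T, 1 * m 2 t) = ∫ t, m 1 t ^ 2 ∂μ :=
    integral_congr_ae (by filter_upwards [hsq] with t ht; rw [one_mul, ht])
  have e2 : (∫ t in Icc 0 T, m 1 t * m 1 t) = ∫ t, m 1 t ^ 2 ∂μ :=
    integral_congr_ae (Eventually.of_forall fun t => by simp only; ring)
  rw [e1, e2] at h3
  have e3 : ∀ a : ℝ, a - 2 * a + a = 0 := by intro a; ring
  rw [e3] at h3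
  have hdiff : ∀ x, Integrable (fun t => u (t, x) - m 1 t) μ := fun x =>
    hbd ((hus x).sub (hm.measurable 1)) fun t => by
      have a1 := H.mem_Icc (t, x)
      have a2 := hm.mem_Icc 1 t
      constructor <;> linarith [a1.1, a1.2, a2.1, a2.2]
  have hint : ∀ x, Integrable (fun t => (u (t, x) - m 1 t) ^ 2) μ := fun x =>
    hbd (((hus x).sub (hm.measurable 1)).pow_const 2) fun t => by
      have a1 := H.mem_Icc (t, x)
      have a2 := hm.mem_Icc 1 t
      constructor <;> nlinarith [a1.1, a1.2, a2.1, a2.2]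
  have h4 : EssLimZero (fun x => ∫ t, (u (t, x) - m 1 t) ^ 2 ∂μ) 0 := by
    refine h3.congr fun x => ?_
    have i1 : Integrable (fun t => 1 * u (t, x) ^ 2) μ :=
      hbd (((hus x).pow_const 2).const_mul 1) fun t => by
        have a1 := H.mem_Icc (t, x)
        constructor <;> nlinarith [a1.1, a1.2]
    have i2 : Integrable (fun t => m 1 t * u (t, x) ^ 1) μ :=
      hbd ((hm.measurable 1).mul ((hus x).pow_const 1)) fun t => by
        have a1 := H.mem_Icc (t, x)
        have a2 := hm.mem_Icc 1 t
        rw [pow_one]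
        constructor <;> nlinarith [a1.1, a1.2, a2.1, a2.2, mul_nonneg a1.1 a2.1]
    have i3 : Integrable (fun t => m 1 t ^ 2) μ := hbd ((hm.measurable 1).pow_const 2) fun t => by
        have a2 := hm.mem_Icc 1 t
        constructor <;> nlinarith [a2.1, a2.2]
    rw [← integral_const_mul, ← integral_sub i1 (i2.const_mul 2),
      ← integral_add (f := fun t => 1 * u (t, x) ^ 2 - 2 * (m 1 t * u (t, x) ^ 1))
        (i1.sub (i2.const_mul 2)) i3]
    refine integral_congr_ae (Eventually.of_forall fun t => ?_)
    simp only; ring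
  rw [EssLimZero, Metric.tendsto_nhds]
  intro e he
  set η := e / (T + 1) with hη
  have hη0 : 0 < η := by positivity
  filter_upwards [h4.eventually_lt_const (pow_pos hη0 2)] with x hx
  rw [Real.dist_eq, sub_zero, abs_of_nonneg (integral_nonneg fun _ => abs_nonneg _)]
  -- Young's inequality |a| ≤ η/2 + a²/(2η) passes from L² to L¹ on the bounded interval.
  have h5 : ∫ t, |u (t, x) - m 1 t| ∂μ ≤ ∫ t, (η / 2 + (2 * η)⁻¹ * (u (t, x) - m 1 t) ^ 2) ∂μ := by
    refine integral_mono (hdiff x).abs ((integrable_const _).add ((hint x).const_mul _)) fun t => ?_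
    simp only
    rw [← sq_abs (u (t, x) - m 1 t)]
    have : η / 2 + (2 * η)⁻¹ * |u (t, x) - m 1 t| ^ 2 - |u (t, x) - m 1 t| =
        (2 * η)⁻¹ * (|u (t, x) - m 1 t| - η) ^ 2 := by field_simp; ring
    have h6 : 0 ≤ (2 * η)⁻¹ * (|u (t, x) - m 1 t| - η) ^ 2 := by positivity
    linarith
  rw [integral_add (integrable_const _) ((hint x).const_mul _), integral_const_mul] at h5
  have h6 : (2 * η)⁻¹ * ∫ t, (u (t, x) - m 1 t) ^ 2 ∂μ ≤ η / 2 := by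
    rw [inv_mul_le_iff₀ (by positivity)]
    linarith [sq η]
  have h7 : ∫ t, η / 2 ∂μ = T * (η / 2) := by
    rw [hμ]; simp [hT.le]
  have h8 : T * η + η = e := by rw [hη]; field_simp
  rw [h7] at h5
  linarith

lemma Polynomial.isLaxPair_eval {F Q : ℝ[X]} (hFQ : derivative Q = (1 - 2 * X) * derivative F)
    (hconv : ∀ w ∈ Icc (0 : ℝ) 1, 0 ≤ (derivative (derivative F)).eval w) :
    IsLaxPair (fun w => F.eval w) (fun w => Q.eval w) := by
  have hd : ∀ (G : ℝ[X]), ∀ w ∈ Icc (0 : ℝ) 1,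
      derivWithin (fun w => G.eval w) (Icc 0 1) w = (derivative G).eval w := fun G w hw =>
    (G.hasDerivAt w).hasDerivWithinAt.derivWithin (uniqueDiffOn_Icc one_pos w hw)
  have hs : ∀ G : ℝ[X], ContDiffOn ℝ 2 (fun w => G.eval w) (Icc 0 1) := fun G => by
    simpa using (G.contDiff_aeval (𝕜 := ℝ) 2).contDiffOn
  refine ⟨hs F, hs Q, fun w hw => ?_, fun w hw => ?_⟩
  · rw [hd _ w hw, hd _ w hw, hFQ]; simp
  · rw [iteratedDerivWithin_succ, iteratedDerivWithin_one, derivWithin_congr (hd F) (hd F w hw),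
      hd _ w hw]
    exact hconv w hw

/-- A bounded measurable representative. -/
lemma EntropyInequality.exists_isEntropySolution {p T : ℝ} {u : ℝ → ℝ → ℝ}
    (hent : EntropyInequality p T u)
    (hu : AEStronglyMeasurable (Function.uncurry u) (volume.restrict (Icc 0 T ×ˢ Icc 0 1)))
    (hu01 : ∀ᵐ z ∂(volume.restrict (Icc (0 : ℝ) T ×ˢ Icc (0 : ℝ) 1)), u z.1 z.2 ∈ Icc (0 : ℝ) 1) :
    ∃ v : ℝ × ℝ → ℝ, IsEntropySolution p T v ∧
      ∀ᵐ x, x ∈ Ioo (0 : ℝ) 1 → ∀ᵐ t ∂(volume.restrict (Icc 0 T)), u t x = v (t, x) := by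
  set v : ℝ × ℝ → ℝ := fun z => max 0 (min 1 (hu.mk (Function.uncurry u) z)) with hv
  have hae : ∀ᵐ z ∂(volume.restrict (Icc (0 : ℝ) T ×ˢ Icc (0 : ℝ) 1)), u z.1 z.2 = v z := by
    filter_upwards [hu.ae_eq_mk, hu01] with z h1 h2
    have h3 : u z.1 z.2 = hu.mk (Function.uncurry u) z := h1
    simp only [hv]
    rw [← h3, min_eq_right h2.2, max_eq_right h2.1]
  refine ⟨v, ⟨measurable_const.max (measurable_const.min hu.stronglyMeasurable_mk.measurable),
    fun z => ⟨le_max_left _ _, max_le zero_le_one (min_le_left _ _)⟩, ?_⟩, ?_⟩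
  · intro F Q hFQ hconv θ hθ hθc hθT hθ0
    have h := hent _ _ (isLaxPair_eval hFQ hconv) θ hθ hθc hθT hθ0
    have hz : ∀ z ∉ Ioo 0 T ×ˢ Ioo (0 : ℝ) 1, fderiv ℝ θ z = 0 := fun z hz =>
      image_eq_zero_of_notMem_tsupport fun hz' => hz (hθT (tsupport_fderiv_subset ℝ hz'))
    rw [← setIntegral_eq_integral_of_forall_compl_eq_zero (s := Ioo 0 T ×ˢ Ioo (0 : ℝ) 1)
      fun z hz' => by simp [hz z hz']]
    refine h.trans (le_of_eq (integral_congr_ae ?_))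
    filter_upwards [ae_restrict_of_ae_restrict_of_subset
      (prod_mono Ioo_subset_Icc_self Ioo_subset_Icc_self) hae] with z hz
    simp only [hz]
  · rw [Measure.volume_eq_prod, ← Measure.prod_restrict] at hae
    have h1 := Measure.ae_ae_of_ae_prod (Measure.measurePreserving_swap.quasiMeasurePreserving.ae hae)
    rw [← restrict_Ioo_eq_restrict_Icc (μ := volume) (a := (0 : ℝ)) (b := 1)] at h1
    exact (ae_restrict_iff' measurableSet_Ioo).1 h1

lemma EntropyInequality.exists_isTraceZero {p T : ℝ} (hp : 0 < p) (hT : 0 < T) {u : ℝ → ℝ → ℝ}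
    (hent : EntropyInequality p T u)
    (hu : AEStronglyMeasurable (Function.uncurry u) (volume.restrict (Icc 0 T ×ˢ Icc 0 1)))
    (hu01 : ∀ᵐ z ∂(volume.restrict (Icc (0 : ℝ) T ×ˢ Icc (0 : ℝ) 1)), u z.1 z.2 ∈ Icc (0 : ℝ) 1) :
    ∃ w, IsTraceZero T u w := by
  obtain ⟨v, H, hv⟩ := hent.exists_isEntropySolution hu hu01
  obtain ⟨w, hw, hw01, hlim⟩ := H.exists_strongTrace hp hT
  refine ⟨w, memLp_top_of_bound hw.aestronglyMeasurable 1 (Eventually.of_forall fun t => ?_), ?_⟩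
  · rw [Real.norm_eq_abs, abs_of_nonneg (hw01 t).1]; exact (hw01 t).2
  · refine hlim.congr' (eventually_essLimZero_of_ae ?_)
    filter_upwards [hv] with x hx hx01
    refine integral_congr_ae ?_
    filter_upwards [hx hx01] with t ht
    rw [ht]

/-! ### Reflection of the problem from x = 1 to x = 0. -/

open scoped Pointwise in
lemma vadd_neg_Icc_zero_one : ((1 : ℝ) +ᵥ -Icc (0 : ℝ) 1) = Icc 0 1 := by
  ext x
  simp only [Set.mem_vadd_set, Set.mem_neg, mem_Icc, vadd_eq_add]
  constructor
  · rintro ⟨y, hy, rfl⟩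
    constructor <;> linarith [hy.1, hy.2]
  · intro hx
    exact ⟨x - 1, ⟨by linarith [hx.2], by linarith [hx.1]⟩, by ring⟩

lemma one_sub_mem_Icc {w : ℝ} (hw : w ∈ Icc (0 : ℝ) 1) : 1 - w ∈ Icc (0 : ℝ) 1 :=
  ⟨by linarith [hw.2], by linarith [hw.1]⟩

/-- The reflection `w ↦ 1 - w` acts on Lax entropy flux pairs. -/
lemma IsLaxPair.reflect {F Q : ℝ → ℝ} (h : IsLaxPair F Q) :
    IsLaxPair (fun w => F (1 - w)) (fun w => -Q (1 - w)) := by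
  have hc : ContDiffOn ℝ 2 (fun w : ℝ => 1 - w) (Icc 0 1) := by fun_prop
  have hmaps : MapsTo (fun w : ℝ => 1 - w) (Icc 0 1) (Icc 0 1) := fun w hw => one_sub_mem_Icc hw
  refine ⟨h.contDiffOn_entropy.comp hc hmaps, (h.contDiffOn_flux.comp hc hmaps).neg,
    fun w hw => ?_, fun w hw => ?_⟩
  · rw [derivWithin.fun_neg, derivWithin_comp_const_sub, derivWithin_comp_const_sub,
      vadd_neg_Icc_zero_one, h.deriv_flux _ (one_sub_mem_Icc hw)]
    ring
  · rw [iteratedDerivWithin_comp_const_sub, vadd_neg_Icc_zero_one]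
    simpa using h.convex _ (one_sub_mem_Icc hw)

lemma IsBoundaryPair.reflect {F Q : ℝ → ℝ → ℝ} (h : IsBoundaryPair F Q) :
    IsBoundaryPair (fun w v => F (1 - w) (1 - v)) (fun w v => -Q (1 - w) (1 - v)) := by
  have hc : ContinuousOn (fun z : ℝ × ℝ => (1 - z.1, 1 - z.2)) (Icc 0 1 ×ˢ Icc 0 1) := by fun_prop
  have hmaps : MapsTo (fun z : ℝ × ℝ => (1 - z.1, 1 - z.2)) (Icc 0 1 ×ˢ Icc 0 1)
      (Icc 0 1 ×ˢ Icc 0 1) := fun z hz => ⟨one_sub_mem_Icc hz.1, one_sub_mem_Icc hz.2⟩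
  refine ⟨h.continuousOn_entropy.comp hc hmaps, (h.continuousOn_flux.comp hc hmaps).neg,
    fun v hv => (h.lax _ (one_sub_mem_Icc hv)).reflect,
    fun v hv => h.entropy_diag _ (one_sub_mem_Icc hv), fun v hv => ?_, fun v hv => ?_⟩
  · rw [derivWithin_comp_const_sub (fun w => F w (1 - v)), vadd_neg_Icc_zero_one,
      h.deriv_entropy_diag _ (one_sub_mem_Icc hv), neg_zero]
  · rw [h.flux_diag _ (one_sub_mem_Icc hv), neg_zero]

/-- The reflection `(t, x) ↦ (t, 1 - x)` of the plane. -/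
def reflectEquiv : ℝ × ℝ ≃ᵐ ℝ × ℝ where
  toFun z := (z.1, 1 - z.2)
  invFun z := (z.1, 1 - z.2)
  left_inv z := by simp
  right_inv z := by simp
  measurable_toFun := by simp only [Equiv.coe_fn_mk]; fun_prop
  measurable_invFun := by simp only [Equiv.coe_fn_symm_mk]; fun_prop

lemma reflectEquiv_apply (z : ℝ × ℝ) : reflectEquiv z = (z.1, 1 - z.2) := rfl

lemma measurePreserving_reflectEquiv : MeasurePreserving reflectEquiv volume volume := by
  rw [Measure.volume_eq_prod]
  exact (MeasurePreserving.id volume).prod (Measure.measurePreserving_sub_left volume (1 : ℝ))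

lemma preimage_reflectEquiv_prod_Ioo (s : Set ℝ) :
    reflectEquiv ⁻¹' (s ×ˢ Ioo (0 : ℝ) 1) = s ×ˢ Ioo (0 : ℝ) 1 := by
  ext z
  simp only [mem_preimage, reflectEquiv_apply, mem_prod, mem_Ioo, sub_pos, sub_lt_self_iff]
  tauto

lemma preimage_reflectEquiv_prod_Icc (s : Set ℝ) :
    reflectEquiv ⁻¹' (s ×ˢ Icc (0 : ℝ) 1) = s ×ˢ Icc (0 : ℝ) 1 := by
  ext z
  simp only [mem_preimage, reflectEquiv_apply, mem_prod, mem_Icc, sub_nonneg, sub_le_self_iff]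
  tauto

lemma measurePreserving_reflectEquiv_restrict (T : ℝ) :
    MeasurePreserving reflectEquiv (volume.restrict (Icc 0 T ×ˢ Icc 0 1))
      (volume.restrict (Icc 0 T ×ˢ Icc 0 1)) := by
  have := measurePreserving_reflectEquiv.restrict_preimage_emb reflectEquiv.measurableEmbedding
    (Icc 0 T ×ˢ Icc (0 : ℝ) 1)
  rwa [preimage_reflectEquiv_prod_Icc] at this

lemma fderiv_comp_reflectEquiv {θ : ℝ × ℝ → ℝ} (hθ : Differentiable ℝ θ) (z : ℝ × ℝ) :
    fderiv ℝ (fun z : ℝ × ℝ => θ (z.1, 1 - z.2)) z (1, 0) = fderiv ℝ θ (z.1, 1 - z.2) (1, 0) ∧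
    fderiv ℝ (fun z : ℝ × ℝ => θ (z.1, 1 - z.2)) z (0, 1) = -fderiv ℝ θ (z.1, 1 - z.2) (0, 1) := by
  have h1 : HasFDerivAt (fun z : ℝ × ℝ => ((z.1, 1 - z.2) : ℝ × ℝ))
      ((ContinuousLinearMap.fst ℝ ℝ ℝ).prod (-ContinuousLinearMap.snd ℝ ℝ ℝ)) z :=
    hasFDerivAt_fst.prodMk (hasFDerivAt_snd.const_sub 1)
  have h2 : fderiv ℝ (fun z : ℝ × ℝ => θ (z.1, 1 - z.2)) z = _ :=
    ((hθ (z.1, 1 - z.2)).hasFDerivAt.comp z h1).fderiv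
  rw [h2]
  constructor
  · simp
  · simp only [ContinuousLinearMap.comp_apply, ContinuousLinearMap.prod_apply,
      ContinuousLinearMap.coe_fst', neg_apply, ContinuousLinearMap.coe_snd']
    rw [← map_neg]; simp

/-- The entropy inequality is invariant under `u (t, x) ↦ 1 - u (t, 1 - x)`. -/
lemma EntropyInequality.reflect {p T : ℝ} {u : ℝ → ℝ → ℝ} (h : EntropyInequality p T u) :
    EntropyInequality p T fun t x => 1 - u t (1 - x) := by
  intro F Q hFQ θ hθ hθc hθT hθ0
  have hs : ContDiff ℝ ∞ fun z : ℝ × ℝ => θ (z.1, 1 - z.2) := hθ.comp (by fun_prop)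
  have hsub : tsupport (fun z : ℝ × ℝ => θ (z.1, 1 - z.2)) ⊆ reflectEquiv ⁻¹' tsupport θ :=
    closure_minimal (fun z hz => subset_tsupport θ hz)
      ((isClosed_tsupport θ).preimage (by
        change Continuous fun z : ℝ × ℝ => ((z.1, 1 - z.2) : ℝ × ℝ)
        fun_prop))
  have himg : reflectEquiv ⁻¹' tsupport θ = (fun z : ℝ × ℝ => ((z.1, 1 - z.2) : ℝ × ℝ)) '' tsupport θ :=
    (reflectEquiv.toEquiv.image_symm_eq_preimage _).symm
  have hc : HasCompactSupport fun z : ℝ × ℝ => θ (z.1, 1 - z.2) := by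
    refine IsCompact.of_isClosed_subset ?_ (isClosed_tsupport _) hsub
    rw [himg]
    exact hθc.isCompact.image (by fun_prop)
  have h1 := h _ _ hFQ.reflect _ hs hc
    (hsub.trans ((preimage_mono hθT).trans (preimage_reflectEquiv_prod_Ioo _).subset))
    fun z => hθ0 _
  refine h1.trans (le_of_eq ?_)
  have h2 := measurePreserving_reflectEquiv.setIntegral_preimage_emb
    reflectEquiv.measurableEmbedding (fun z : ℝ × ℝ => F (1 - u z.1 (1 - z.2)) * fderiv ℝ θ z (1, 0) +
      p * (Q (1 - u z.1 (1 - z.2)) * fderiv ℝ θ z (0, 1))) (Ioo 0 T ×ˢ Ioo (0 : ℝ) 1)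
  rw [preimage_reflectEquiv_prod_Ioo] at h2
  rw [← h2]
  refine integral_congr_ae (Eventually.of_forall fun z => ?_)
  have hd := fderiv_comp_reflectEquiv (hθ.differentiable (by simp)) z
  simp only [hd.1, hd.2, reflectEquiv_apply, sub_sub_cancel]
  ring

lemma tendsto_one_sub_ae : Tendsto (fun x : ℝ => 1 - x) (ae volume) (ae volume) :=
  (Measure.measurePreserving_sub_left volume (1 : ℝ)).quasiMeasurePreserving.tendsto_ae

lemma tendsto_one_sub_nhdsGT : Tendsto (fun x : ℝ => 1 - x) (𝓝[>] 0 ⊓ ae volume)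
    (𝓝[<] 1 ⊓ ae volume) := by
  refine Tendsto.inf ?_ tendsto_one_sub_ae
  refine tendsto_nhdsWithin_iff.2 ⟨?_, ?_⟩
  · have : Tendsto (fun x : ℝ => 1 - x) (𝓝 0) (𝓝 (1 - 0)) :=
      tendsto_const_nhds.sub tendsto_id
    rw [sub_zero] at this
    exact this.mono_left nhdsWithin_le_nhds
  · filter_upwards [self_mem_nhdsWithin] with x hx
    have : 0 < x := hx
    simp [this]

lemma tendsto_one_sub_nhdsLT : Tendsto (fun x : ℝ => 1 - x) (𝓝[<] 1 ⊓ ae volume)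
    (𝓝[>] 0 ⊓ ae volume) := by
  refine Tendsto.inf ?_ tendsto_one_sub_ae
  refine tendsto_nhdsWithin_iff.2 ⟨?_, ?_⟩
  · have : Tendsto (fun x : ℝ => 1 - x) (𝓝 1) (𝓝 (1 - 1)) :=
      tendsto_const_nhds.sub tendsto_id
    rw [sub_self] at this
    exact this.mono_left nhdsWithin_le_nhds
  · filter_upwards [self_mem_nhdsWithin] with x hx
    have : x < 1 := hx
    simp [this]

lemma essLimOne_iff {g : ℝ → ℝ} {L : ℝ} : EssLimOne g L ↔ EssLimZero (fun x => g (1 - x)) L := by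
  refine ⟨fun h => Tendsto.comp h tendsto_one_sub_nhdsGT, fun h => ?_⟩
  have := Tendsto.comp h tendsto_one_sub_nhdsLT
  refine Tendsto.congr (fun x => ?_) this
  simp

/-- Traces at `x = 1` are traces at `x = 0` of the reflected function. -/
lemma isTraceOne_iff {T : ℝ} {u : ℝ → ℝ → ℝ} {w : ℝ → ℝ} :
    IsTraceOne T u w ↔ IsTraceZero T (fun t x => 1 - u t (1 - x)) (fun t => 1 - w t) := by
  have e : ∀ x t, |1 - u t (1 - x) - (1 - w t)| = |u t (1 - x) - w t| := fun x t => by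
    rw [← abs_neg]; congr 1; ring
  simp only [IsTraceOne, IsTraceZero, essLimOne_iff, e]
  refine and_congr_left fun _ => ⟨fun h => (memLp_const 1).sub h, fun h => ?_⟩
  have h1 : w = (fun _ => 1) - fun t => 1 - w t := by ext t; simp
  rw [h1]
  exact (memLp_const 1).sub h

/-! ### Boundary entropy fluxes and the admissible set. -/

lemma isLaxPair_of_hasDerivAt {F Q f f' : ℝ → ℝ} (hF : ∀ w, HasDerivAt F (f w) w)
    (hf : ∀ w, HasDerivAt f (f' w) w) (hc : Continuous f')
    (hQ : ∀ w, HasDerivAt Q ((1 - 2 * w) * f w) w) (h0 : ∀ w, 0 ≤ f' w) : IsLaxPair F Q := by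
  have hf1 : ContDiff ℝ 1 f := by
    rw [contDiff_one_iff_deriv, show deriv f = f' from funext fun w => (hf w).deriv]
    exact ⟨fun w => (hf w).differentiableAt, hc⟩
  have hs : ∀ {G g : ℝ → ℝ}, (∀ w, HasDerivAt G (g w) w) → ContDiff ℝ 1 g → ContDiff ℝ 2 G := by
    intro G g hG hg
    rw [← one_add_one_eq_two, contDiff_succ_iff_deriv,
      show deriv G = g from funext fun w => (hG w).deriv]
    exact ⟨fun w => (hG w).differentiableAt, by simp, hg⟩
  have hd : ∀ {G g : ℝ → ℝ}, (∀ w, HasDerivAt G (g w) w) → ∀ w ∈ Icc (0 : ℝ) 1,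
      derivWithin G (Icc 0 1) w = g w := fun hG w hw =>
    (hG w).hasDerivWithinAt.derivWithin (uniqueDiffOn_Icc one_pos w hw)
  refine ⟨(hs hF hf1).contDiffOn, (hs hQ ?_).contDiffOn, fun w hw => ?_, fun w hw => ?_⟩
  · exact (contDiff_const.sub (contDiff_const.mul contDiff_id)).mul hf1
  · rw [hd hQ w hw, hd hF w hw]
  · rw [iteratedDerivWithin_succ, iteratedDerivWithin_one, derivWithin_congr (hd hF) (hd hF w hw),
      hd hf w hw]
    exact h0 w

/-- The flux of the boundary entropy with second derivative `g`. -/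
noncomputable def kernelFlux (g : ℝ → ℝ) (w v : ℝ) : ℝ :=
  (w - w ^ 2) * ((∫ s in (0 : ℝ)..w, g s) - ∫ s in (0 : ℝ)..v, g s) -
    ((∫ s in (0 : ℝ)..w, g s * (s - s ^ 2)) - ∫ s in (0 : ℝ)..v, g s * (s - s ^ 2))

/-- This form exposes the sign: the flux weighs J(w) - J(s), for s between v and w, with the
arbitrary nonnegative density g. The definition by primitives from 0 is the one suited to continuity
and differentiation. -/
lemma kernelFlux_eq {g : ℝ → ℝ} (hg : Continuous g) (w v : ℝ) :
    kernelFlux g w v = ∫ s in v..w, g s * ((w - w ^ 2) - (s - s ^ 2)) := by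
  have h1 : ∀ {h : ℝ → ℝ}, Continuous h → ∀ a b, IntervalIntegrable h volume a b :=
    fun hh a b => hh.intervalIntegrable a b
  have hg2 : Continuous fun s => g s * (s - s ^ 2) := by fun_prop
  rw [kernelFlux, intervalIntegral.integral_interval_sub_left (h1 hg _ _) (h1 hg _ _),
    intervalIntegral.integral_interval_sub_left (h1 hg2 _ _) (h1 hg2 _ _),
    ← intervalIntegral.integral_const_mul, ← intervalIntegral.integral_sub
      ((h1 hg _ _).const_mul _) (h1 hg2 _ _)]
  refine intervalIntegral.integral_congr fun s _ => ?_
  ring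

/-- Every continuous nonnegative function is the second derivative of a boundary entropy. -/
lemma exists_isBoundaryPair_kernelFlux {g : ℝ → ℝ} (hg : Continuous g) (hg0 : ∀ s, 0 ≤ g s) :
    ∃ F, IsBoundaryPair F (kernelFlux g) := by
  have hprim : ∀ {h : ℝ → ℝ}, Continuous h → ∀ w, HasDerivAt (fun w => ∫ s in (0 : ℝ)..w, h s)
      (h w) w := fun hh w => (hh.integral_hasStrictDerivAt 0 w).hasDerivAt
  have hcp : ∀ {h : ℝ → ℝ}, Continuous h → Continuous fun w => ∫ s in (0 : ℝ)..w, h s :=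
    fun hh => continuous_iff_continuousAt.2 fun w => (hprim hh w).continuousAt
  set G : ℝ → ℝ := fun w => ∫ s in (0 : ℝ)..w, g s with hG
  have hGc : Continuous G := hcp hg
  set G2 : ℝ → ℝ := fun w => ∫ s in (0 : ℝ)..w, G s with hG2
  have hG2c : Continuous G2 := hcp hGc
  have hg2 : Continuous fun s => g s * (s - s ^ 2) := by fun_prop
  have hPc := hcp hg2
  have hF : ∀ v w, HasDerivAt (fun w => G2 w - G2 v - G v * (w - v)) (G w - G v) w := by
    intro v w
    have := ((hprim hGc w).sub_const (G2 v)).sub (((hasDerivAt_id w).sub_const v).const_mul (G v))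
    rw [mul_one] at this
    exact this
  have hf : ∀ v w, HasDerivAt (fun w => G w - G v) (g w) w := fun v w => (hprim hg w).sub_const _
  have hQ : ∀ v w, HasDerivAt (fun w => kernelFlux g w v) ((1 - 2 * w) * (G w - G v)) w := by
    intro v w
    have h1 : HasDerivAt (fun w : ℝ => w - w ^ 2) (1 - 2 * w) w := by
      convert! (hasDerivAt_id w).sub (hasDerivAt_pow 2 w) using 1
      simp
    have h2 := (h1.mul (hf v w)).sub ((hprim hg2 w).sub_const (∫ s in (0 : ℝ)..v, g s * (s - s ^ 2)))
    convert! h2 using 1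
    ring
  refine ⟨fun w v => G2 w - G2 v - G v * (w - v), ?_, ?_, fun v _ =>
    isLaxPair_of_hasDerivAt (hF v) (hf v) hg (hQ v) hg0, fun v _ => by simp, fun v hv => ?_,
    fun v _ => by simp [kernelFlux]⟩
  · simp only [Function.uncurry_def]
    exact Continuous.continuousOn (by fun_prop)
  · simp only [Function.uncurry_def, kernelFlux]
    refine Continuous.continuousOn ?_
    have := hPc.comp (continuous_fst (X := ℝ) (Y := ℝ))
    have := hPc.comp (continuous_snd (X := ℝ) (Y := ℝ))
    have := hGc.comp (continuous_fst (X := ℝ) (Y := ℝ))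
    have := hGc.comp (continuous_snd (X := ℝ) (Y := ℝ))
    simp only [Function.comp_def, hG] at *
    fun_prop
  · rw [(hF v v).hasDerivWithinAt.derivWithin (uniqueDiffOn_Icc one_pos v hv), sub_self]

/-- Tents with rational centre and width form a countable family that can be placed inside any
interval. Countability allows the almost-everywhere sign conditions to be imposed simultaneously. -/
lemma exists_rat_bump_integral_pos {a b c : ℝ} (hac : a < c) (hcb : c ≤ b) {h : ℝ → ℝ}
    (hh : Continuous h) (hpos : ∀ s ∈ Ioo a c, 0 < h s) :
    ∃ q r : ℚ, 0 < ∫ s in a..b, max 0 ((r : ℝ) - |s - q|) * h s := by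
  obtain ⟨q, hq1, hq2⟩ := exists_rat_btwn hac
  obtain ⟨r, hr0, hr⟩ := exists_rat_btwn (lt_min (sub_pos.2 hq1) (sub_pos.2 hq2))
  have h1 := hr.trans_le (min_le_left _ _)
  have h2 := hr.trans_le (min_le_right _ _)
  refine ⟨q, r, intervalIntegral.integral_pos (hac.trans_le hcb) (by fun_prop) (fun s _ => ?_)
    ⟨q, ⟨hq1.le, hq2.le.trans hcb⟩, ?_⟩⟩
  · rcases le_or_gt ((r : ℝ) - |s - q|) 0 with hs | hs
    · rw [max_eq_left hs, zero_mul]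
    · have := abs_lt.1 (sub_pos.1 hs)
      exact mul_nonneg (le_max_left _ _) (hpos s ⟨by linarith [this.1], by linarith [this.2]⟩).le
  · refine mul_pos ?_ (hpos q ⟨hq1, hq2⟩)
    simp only [sub_self, abs_zero, sub_zero]
    exact lt_max_of_lt_right hr0

/-- The sign conditions for countably many boundary fluxes determine the admissible set. -/
lemma mem_of_forall_kernelFlux_nonpos {w v : ℝ} (hw : w ∈ Icc (0 : ℝ) 1)
    (h : ∀ q r : ℚ, kernelFlux (fun s => max 0 ((r : ℝ) - |s - q|)) w v ≤ 0) :
    w ∈ {v} ∪ Icc (1 - min (1 / 2) v) 1 := by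
  have hc : ∀ q r : ℚ, Continuous fun s : ℝ => max 0 ((r : ℝ) - |s - q|) := fun q r => by fun_prop
  by_contra hcon
  rw [mem_union, not_or, mem_singleton_iff, mem_Icc, not_and_or, not_le, not_le] at hcon
  obtain ⟨hne, hlt⟩ := hcon
  have hlt : w < 1 - min (1 / 2) v := hlt.resolve_right (by linarith [hw.2])
  -- J(w) - J(s) changes sign at s = w and at the mirror state s = 1 - w; the tent is therefore
  -- placed between the smaller of v and w and min(larger of the two, 1 - w).
  have hfac : ∀ s : ℝ, (w - w ^ 2) - (s - s ^ 2) = (w - s) * (1 - w - s) := fun s => by ring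
  rcases lt_or_gt_of_ne hne with hwv | hwv
  · have hw2 : w < 1 / 2 := by
      rcases min_cases (1 / 2 : ℝ) v with ⟨h1, h2⟩ | ⟨h1, h2⟩ <;> rw [h1] at hlt <;> linarith
    obtain ⟨q, r, hqr⟩ := exists_rat_bump_integral_pos (a := w) (b := v) (c := min v (1 - w))
      (lt_min hwv (by linarith)) (min_le_left _ _)
      (h := fun s => -((w - w ^ 2) - (s - s ^ 2))) (by fun_prop) (fun s hs => by
        have h2 := hs.2.trans_le (min_le_right _ _)
        rw [hfac]
        nlinarith [mul_pos (sub_pos.2 hs.1) (show 0 < 1 - w - s by linarith)])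
    have h1 := h q r
    rw [kernelFlux_eq (hc q r), intervalIntegral.integral_symm,
      ← intervalIntegral.integral_neg] at h1
    simp only [mul_neg] at hqr
    linarith
  · have hw2 : v < 1 - w := by
      rcases min_cases (1 / 2 : ℝ) v with ⟨h1, h2⟩ | ⟨h1, h2⟩ <;> rw [h1] at hlt <;> linarith
    obtain ⟨q, r, hqr⟩ := exists_rat_bump_integral_pos (a := v) (b := w) (c := min w (1 - w))
      (lt_min hwv hw2) (min_le_left _ _)
      (h := fun s => (w - w ^ 2) - (s - s ^ 2)) (by fun_prop) (fun s hs => by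
        have h2 := hs.2.trans_le (min_le_right _ _)
        have h3 := hs.2.trans_le (min_le_left _ _)
        rw [hfac]
        exact mul_pos (by linarith) (by linarith))
    have h1 := h q r
    rw [kernelFlux_eq (hc q r)] at h1
    linarith

/-- Boundary fluxes are nonpositive on the admissible set. -/
lemma IsBoundaryPair.flux_nonpos {F Q : ℝ → ℝ → ℝ} (hFQ : IsBoundaryPair F Q) {w v : ℝ}
    (hw : w ∈ Icc (0 : ℝ) 1) (hv : v ∈ Icc (0 : ℝ) 1)
    (h : w ∈ {v} ∪ Icc (1 - min (1 / 2) v) 1) : Q w v ≤ 0 := by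
  have hlax := hFQ.lax v hv
  set f : ℝ → ℝ := derivWithin (fun u => F u v) (Icc 0 1) with hf
  have hfv : f v = 0 := hFQ.deriv_entropy_diag v hv
  have hu : UniqueDiffOn ℝ (Icc (0 : ℝ) 1) := uniqueDiffOn_Icc one_pos
  have hfd : ContDiffOn ℝ 1 f (Icc 0 1) :=
    hlax.contDiffOn_entropy.derivWithin hu (by norm_num)
  have hmono : MonotoneOn f (Icc 0 1) := by
    refine monotoneOn_of_deriv_nonneg (convex_Icc 0 1) hfd.continuousOn
      ((hfd.differentiableOn one_ne_zero).mono interior_subset) fun s hs => ?_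
    have hs' := interior_subset hs
    have h1 := hlax.convex s hs'
    rw [iteratedDerivWithin_succ, iteratedDerivWithin_one] at h1
    rwa [← derivWithin_of_mem_nhds (mem_interior_iff_mem_nhds.1 hs)]
  have hQc : ContinuousOn (fun s => Q s v) (Icc 0 1) := hlax.contDiffOn_flux.continuousOn
  have hQd : ∀ s ∈ Ioo (0 : ℝ) 1, HasDerivAt (fun s => Q s v) ((1 - 2 * s) * f s) s := by
    intro s hs
    have hs' := Ioo_subset_Icc_self hs
    have h1 := (hlax.contDiffOn_flux.differentiableOn two_ne_zero s hs').hasDerivWithinAt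
    rw [hlax.deriv_flux s hs'] at h1
    exact h1.hasDerivAt (Icc_mem_nhds hs.1 hs.2)
  have hQv : Q v v = 0 := hFQ.flux_diag v hv
  rcases h with h | h
  · rw [mem_singleton_iff.1 h, hQv]
  have hmin : min (1 / 2) v ≤ 1 / 2 := min_le_left _ _
  have hw2 : 1 / 2 ≤ w := by linarith [h.1]
  rcases le_or_gt w v with hwv | hwv
  · have hsub : Icc w v ⊆ Icc 0 1 := Icc_subset_Icc hw.1 hv.2
    have hsub' : Ioo w v ⊆ Ioo 0 1 := Ioo_subset_Ioo hw.1 hv.2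
    have h1 : MonotoneOn (fun s => Q s v) (Icc w v) := by
      refine monotoneOn_of_deriv_nonneg (convex_Icc w v) (hQc.mono hsub) ?_ ?_
      · rw [interior_Icc]
        exact fun s hs => (hQd s (hsub' hs)).differentiableAt.differentiableWithinAt
      · rw [interior_Icc]
        intro s hs
        rw [(hQd s (hsub' hs)).deriv]
        have h2 := hmono (hsub (Ioo_subset_Icc_self hs)) hv hs.2.le
        rw [hfv] at h2
        exact mul_nonneg_of_nonpos_of_nonpos (by linarith [hs.1]) h2
    have := h1 (left_mem_Icc.2 hwv) (right_mem_Icc.2 hwv) hwv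
    simpa [hQv] using this
  · have hsub : Icc v w ⊆ Icc 0 1 := Icc_subset_Icc hv.1 hw.2
    have hsub' : Ioo v w ⊆ Ioo 0 1 := Ioo_subset_Ioo hv.1 hw.2
    -- Compare Q(·,v) with cJ: the difference has derivative (1-2s)(f(s) - c), where f is the
    -- derivative of the entropy, and J(w) - J(v) = (w-v)(1-w-v).
    have hanti : ∀ c : ℝ, (∀ s ∈ Ioo v w, (1 - 2 * s) * (f s - c) ≤ 0) →
        Q w v ≤ c * ((w - v) * (1 - w - v)) := by
      intro c hc
      have hJ : ∀ s : ℝ, HasDerivAt (fun s : ℝ => c * (s - s ^ 2)) (c * (1 - 2 * s)) s := fun s => by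
        convert! ((hasDerivAt_id s).sub (hasDerivAt_pow 2 s)).const_mul c using 1
        simp
      have hD : ∀ s ∈ Ioo v w, HasDerivAt (fun s => Q s v - c * (s - s ^ 2))
          ((1 - 2 * s) * (f s - c)) s := fun s hs => by
        convert! (hQd s (hsub' hs)).sub (hJ s) using 1
        ring
      have h1 : AntitoneOn (fun s => Q s v - c * (s - s ^ 2)) (Icc v w) := by
        refine antitoneOn_of_deriv_nonpos (convex_Icc v w)
          ((hQc.mono hsub).sub (by fun_prop)) ?_ ?_
        · rw [interior_Icc]
          exact fun s hs => (hD s hs).differentiableAt.differentiableWithinAt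
        · rw [interior_Icc]
          intro s hs
          rw [(hD s hs).deriv]
          exact hc s hs
      have h2 := h1 (left_mem_Icc.2 hwv.le) (right_mem_Icc.2 hwv.le) hwv.le
      simp only [hQv] at h2
      nlinarith
    rcases le_or_gt (1 / 2) v with hv2 | hv2
    · have := hanti 0 fun s hs => by
        have h2 := hmono hv (hsub (Ioo_subset_Icc_self hs)) hs.1.le
        rw [hfv] at h2
        rw [sub_zero]
        exact mul_nonpos_of_nonpos_of_nonneg (by linarith [hs.1]) h2
      simpa using this
    · have hhalf : (1 / 2 : ℝ) ∈ Icc (0 : ℝ) 1 := by norm_num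
      -- With c = f(1/2), monotonicity of f makes (1-2s)(f(s) - c) ≤ 0 on both sides of 1/2. Then c
      -- ≥ f(v) = 0 and w ≥ 1 - v conclude.
      have h1 := hanti (f (1 / 2)) fun s hs => by
        have hs' := hsub (Ioo_subset_Icc_self hs)
        rcases le_or_gt s (1 / 2) with h2 | h2
        · exact mul_nonpos_of_nonneg_of_nonpos (by linarith) (by linarith [hmono hs' hhalf h2])
        · exact mul_nonpos_of_nonpos_of_nonneg (by linarith) (by linarith [hmono hhalf hs' h2.le])
      have h2 := hmono hv hhalf hv2.le
      rw [hfv] at h2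
      rw [min_eq_right hv2.le] at h
      refine h1.trans (mul_nonpos_of_nonneg_of_nonpos h2
        (mul_nonpos_of_nonneg_of_nonpos (by linarith) (by linarith [h.1])))

/-! ### Equivalence of the boundary conditions at x = 0. -/

/-- Almost every slice of `u` is a measurable function with values in `[0,1]`. -/
def HasRegularSlices (T : ℝ) (u : ℝ → ℝ → ℝ) : Prop :=
  ∀ᶠ x in 𝓝[>] (0 : ℝ) ⊓ ae volume, AEStronglyMeasurable (fun t => u t x) (volume.restrict (Icc 0 T)) ∧
    ∀ᵐ t ∂(volume.restrict (Icc 0 T)), u t x ∈ Icc (0 : ℝ) 1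

lemma EntropyInequality.hasRegularSlices {p T : ℝ} {u : ℝ → ℝ → ℝ}
    (hent : EntropyInequality p T u)
    (hu : AEStronglyMeasurable (Function.uncurry u) (volume.restrict (Icc 0 T ×ˢ Icc 0 1)))
    (hu01 : ∀ᵐ z ∂(volume.restrict (Icc (0 : ℝ) T ×ˢ Icc (0 : ℝ) 1)), u z.1 z.2 ∈ Icc (0 : ℝ) 1) :
    HasRegularSlices T u := by
  obtain ⟨v, H, hv⟩ := hent.exists_isEntropySolution hu hu01
  refine eventually_essLimZero_of_ae ?_
  filter_upwards [hv] with x hx hx01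
  refine ⟨?_, (hx hx01).mono fun t ht => ht ▸ H.mem_Icc _⟩
  have h1 : Measurable fun t => v (t, x) := H.measurable.comp (by fun_prop)
  exact h1.aestronglyMeasurable.congr ((hx hx01).mono fun t ht => ht.symm)

/-- Clamping to the unit interval. -/
noncomputable def clamp (a : ℝ) : ℝ := max 0 (min 1 a)

lemma clamp_mem (a : ℝ) : clamp a ∈ Icc (0 : ℝ) 1 :=
  ⟨le_max_left _ _, max_le zero_le_one (min_le_left _ _)⟩

lemma clamp_eq {a : ℝ} (ha : a ∈ Icc (0 : ℝ) 1) : clamp a = a := by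
  rw [clamp, min_eq_right ha.2, max_eq_right ha.1]

lemma continuous_clamp : Continuous clamp := by unfold clamp; fun_prop

/-- The clamp is the nearest point of the unit interval. This is used to bound how far a trace can
leave the range of the slices. -/
lemma abs_sub_clamp_le {a b : ℝ} (hb : b ∈ Icc (0 : ℝ) 1) : |a - clamp a| ≤ |b - a| := by
  rcases le_or_gt a 0 with ha | ha
  · have : clamp a = 0 := by rw [clamp, min_eq_right (by linarith), max_eq_left ha]
    rw [this, sub_zero, abs_of_nonpos ha, abs_of_nonneg (by linarith [hb.1])]; linarith [hb.1]
  rcases le_or_gt a 1 with ha1 | ha1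
  · rw [clamp_eq ⟨ha.le, ha1⟩, sub_self, abs_zero]; exact abs_nonneg _
  · have : clamp a = 1 := by rw [clamp, min_eq_left ha1.le, max_eq_right zero_le_one]
    rw [this, abs_of_nonneg (by linarith), abs_of_nonpos (by linarith [hb.2])]; linarith [hb.2]

/-- A quantitative form of uniform continuity of boundary fluxes in the state. -/
lemma ContinuousOn.exists_abs_sub_le {Q : ℝ → ℝ → ℝ}
    (hQ : ContinuousOn (Function.uncurry Q) (Icc 0 1 ×ˢ Icc 0 1)) {η : ℝ} (hη : 0 < η) :
    ∃ K, 0 ≤ K ∧ ∀ a ∈ Icc (0 : ℝ) 1, ∀ b ∈ Icc (0 : ℝ) 1, ∀ v ∈ Icc (0 : ℝ) 1,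
      |Q a v - Q b v| ≤ η + K * |a - b| := by
  have hcomp : IsCompact (Icc (0 : ℝ) 1 ×ˢ Icc (0 : ℝ) 1) := isCompact_Icc.prod isCompact_Icc
  obtain ⟨M, hM⟩ := hcomp.exists_bound_of_continuousOn hQ
  have huc := hcomp.uniformContinuousOn_of_continuous hQ
  obtain ⟨δ, hδ, h⟩ := Metric.uniformContinuousOn_iff.1 huc η hη
  have hM0 : 0 ≤ M := (norm_nonneg _).trans (hM (0, 0) (by simp))
  refine ⟨2 * M / δ, by positivity, fun a ha b hb v hv => ?_⟩
  rcases lt_or_ge |a - b| δ with hab | hab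
  · have h1 := h (a, v) ⟨ha, hv⟩ (b, v) ⟨hb, hv⟩ (by
      rw [Prod.dist_eq, dist_self, max_lt_iff, Real.dist_eq]; exact ⟨hab, hδ⟩)
    rw [Real.dist_eq] at h1
    have : 0 ≤ 2 * M / δ * |a - b| := by positivity
    exact h1.le.trans (by linarith)
  · have h1 : |Q a v| ≤ M := hM (a, v) ⟨ha, hv⟩
    have h2 : |Q b v| ≤ M := hM (b, v) ⟨hb, hv⟩
    have h3 : 2 * M ≤ 2 * M / δ * |a - b| := by
      rw [div_mul_eq_mul_div, le_div_iff₀ hδ]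
      exact mul_le_mul_of_nonneg_left hab (by positivity)
    have := abs_sub (Q a v) (Q b v)
    linarith

lemma aestronglyMeasurable_boundaryFlux {μ : Measure ℝ} {Q : ℝ → ℝ → ℝ}
    (hQ : ContinuousOn (Function.uncurry Q) (Icc 0 1 ×ˢ Icc 0 1)) {a v : ℝ → ℝ}
    (ha : AEStronglyMeasurable a μ) (ha01 : ∀ᵐ t ∂μ, a t ∈ Icc (0 : ℝ) 1)
    (hv : AEStronglyMeasurable v μ) (hv01 : ∀ᵐ t ∂μ, v t ∈ Icc (0 : ℝ) 1) :
    AEStronglyMeasurable (fun t => Q (a t) (v t)) μ := by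
  have hc : Continuous fun z : ℝ × ℝ => Function.uncurry Q (clamp z.1, clamp z.2) :=
    hQ.comp_continuous ((continuous_clamp.comp continuous_fst).prodMk
      (continuous_clamp.comp continuous_snd)) fun z => ⟨clamp_mem _, clamp_mem _⟩
  refine (hc.comp_aestronglyMeasurable (ha.prodMk hv)).congr ?_
  filter_upwards [ha01, hv01] with t h1 h2
  simp only [clamp_eq h1, clamp_eq h2, Function.uncurry_apply_pair]

namespace IsTraceZero

variable {T : ℝ} {u : ℝ → ℝ → ℝ} {w v : ℝ → ℝ}

lemma integrable_abs_sub {μ : Measure ℝ} [IsFiniteMeasure μ] {a b : ℝ → ℝ}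
    (ha : AEStronglyMeasurable a μ) (ha01 : ∀ᵐ t ∂μ, a t ∈ Icc (0 : ℝ) 1) (hb : Integrable b μ) :
    Integrable (fun t => |a t - b t|) μ := by
  have h1 : Integrable a μ := Integrable.of_bound (C := 1) ha (by
    filter_upwards [ha01] with t ht
    rw [Real.norm_eq_abs, abs_of_nonneg ht.1]; exact ht.2)
  exact (h1.sub hb).abs

/-- A trace is only assumed to be in L^∞. Its distance to the unit interval is at most its distance
to any slice with values there, and the L¹ norm of the latter tends to zero. -/
lemma ae_mem_Icc (hw : IsTraceZero T u w) (hu : HasRegularSlices T u) :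
    ∀ᵐ t ∂(volume.restrict (Icc 0 T)), w t ∈ Icc (0 : ℝ) 1 := by
  set μ := volume.restrict (Icc 0 T) with hμ
  have hwi : Integrable w μ := hw.1.integrable le_top
  have hci : Integrable (fun t => |w t - clamp (w t)|) μ := by
    refine (hwi.sub (Integrable.of_bound (C := 1)
      (continuous_clamp.comp_aestronglyMeasurable hwi.aestronglyMeasurable)
      (Eventually.of_forall fun t => ?_))).abs
    rw [Real.norm_eq_abs, abs_of_nonneg (clamp_mem _).1]
    exact (clamp_mem _).2
  have h0 : ∫ t, |w t - clamp (w t)| ∂μ ≤ 0 := by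
    refine ge_of_tendsto hw.2 ?_
    filter_upwards [hu] with x hx
    refine integral_mono_ae hci (integrable_abs_sub hx.1 hx.2 hwi) ?_
    filter_upwards [hx.2] with t ht using abs_sub_clamp_le ht
  have h1 := (integral_eq_zero_iff_of_nonneg (fun _ => abs_nonneg _) hci).1
    (le_antisymm h0 (integral_nonneg fun _ => abs_nonneg _))
  filter_upwards [h1] with t ht
  have h2 : w t - clamp (w t) = 0 := abs_eq_zero.1 ht
  rw [sub_eq_zero.1 h2]
  exact clamp_mem _

/-- Boundary fluxes pass to the limit. -/
lemma essLim_flux (hw : IsTraceZero T u w) (hu : HasRegularSlices T u) (hT : 0 < T)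
    (hv : AEStronglyMeasurable v (volume.restrict (Icc 0 T)))
    (hv01 : ∀ᵐ t ∂(volume.restrict (Icc 0 T)), v t ∈ Icc (0 : ℝ) 1) {F Q : ℝ → ℝ → ℝ}
    (hFQ : IsBoundaryPair F Q) {φ : ℝ → ℝ} (hφ : ContinuousOn φ (Icc 0 T)) :
    EssLimZero (fun x => ∫ t in Icc 0 T, φ t * Q (u t x) (v t))
      (∫ t in Icc 0 T, φ t * Q (w t) (v t)) := by
  have hw01 := hw.ae_mem_Icc hu
  set μ := volume.restrict (Icc 0 T) with hμ
  have hwi : Integrable w μ := hw.1.integrable le_top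
  obtain ⟨B', hB'⟩ := isCompact_Icc.exists_bound_of_continuousOn hφ
  set B := |B'| with hBdef
  have hB : ∀ᵐ t ∂μ, |φ t| ≤ B := (ae_restrict_iff' measurableSet_Icc).2
    (Eventually.of_forall fun t ht => (hB' t ht).trans (le_abs_self _))
  have hφm : AEStronglyMeasurable φ μ := hφ.aestronglyMeasurable measurableSet_Icc
  have hcomp : IsCompact (Icc (0 : ℝ) 1 ×ˢ Icc (0 : ℝ) 1) := isCompact_Icc.prod isCompact_Icc
  obtain ⟨M, hM⟩ := hcomp.exists_bound_of_continuousOn hFQ.continuousOn_flux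
  have hint : ∀ {a : ℝ → ℝ}, AEStronglyMeasurable a μ → (∀ᵐ t ∂μ, a t ∈ Icc (0 : ℝ) 1) →
      Integrable (fun t => φ t * Q (a t) (v t)) μ := by
    intro a ha ha01
    refine Integrable.of_bound (C := B * M)
      (hφm.mul (aestronglyMeasurable_boundaryFlux hFQ.continuousOn_flux ha ha01 hv hv01)) ?_
    filter_upwards [hB, ha01, hv01] with t h1 h2 h3
    rw [norm_mul]
    exact mul_le_mul h1 (hM (a t, v t) ⟨h2, h3⟩) (norm_nonneg _) (abs_nonneg _)
  rw [EssLimZero, Metric.tendsto_nhds]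
  intro e he
  -- The uniform-continuity error contributes B T η < e in the limit; the linear part K|u - w|
  -- vanishes because the trace is strong.
  set η := e / (2 * (B * T + 1)) with hη
  have hB0 : 0 ≤ B := abs_nonneg _
  have hη0 : 0 < η := by positivity
  obtain ⟨K, hK0, hK⟩ := hFQ.continuousOn_flux.exists_abs_sub_le hη0
  have hlim : EssLimZero (fun x => B * (T * η + K * ∫ t in Icc 0 T, |u t x - w t|))
      (B * (T * η + K * 0)) := ((hw.2.const_mul K).const_add _).const_mul B
  have hlt : B * (T * η + K * 0) < e := by
    have h1 : B * (T * η + K * 0) = e * (B * T / (2 * (B * T + 1))) := by rw [hη]; ring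
    have h2 : B * T / (2 * (B * T + 1)) < 1 := by
      have : 0 ≤ B * T := by positivity
      rw [div_lt_one (by positivity)]; linarith
    rw [h1]
    nlinarith
  filter_upwards [hlim.eventually_lt_const hlt, hu] with x hx hux
  refine lt_of_le_of_lt ?_ hx
  rw [Real.dist_eq, ← integral_sub (hint hux.1 hux.2) (hint hwi.aestronglyMeasurable hw01)]
  have habs := integrable_abs_sub hux.1 hux.2 hwi
  have h1 : |∫ t, (φ t * Q (u t x) (v t) - φ t * Q (w t) (v t)) ∂μ| ≤
      ∫ t, B * (η + K * |u t x - w t|) ∂μ := by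
    rw [← Real.norm_eq_abs]
    refine norm_integral_le_of_norm_le
      (((integrable_const η).add (habs.const_mul K)).const_mul B) ?_
    filter_upwards [hB, hux.2, hw01, hv01] with t h1 h2 h3 h4
    rw [← mul_sub, norm_mul]
    exact mul_le_mul h1 (hK _ h2 _ h3 _ h4) (norm_nonneg _) hB0
  refine h1.trans (le_of_eq ?_)
  rw [integral_const_mul, integral_add (integrable_const η) (habs.const_mul K), integral_const_mul]
  simp [hT.le]

end IsTraceZero

/-- Indicators of measurable sets are L¹ limits of smooth functions. Passing to positive parts keeps
the tests nonnegative and does not increase the distance to the indicator. -/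
lemma ae_nonpos_of_forall_continuous {T : ℝ} (hT : 0 < T) {g : ℝ → ℝ} {M : ℝ}
    (hg : AEStronglyMeasurable g (volume.restrict (Icc 0 T)))
    (hM : ∀ᵐ t ∂(volume.restrict (Icc 0 T)), |g t| ≤ M)
    (h : ∀ φ : ℝ → ℝ, Continuous φ → (∀ t, 0 ≤ φ t) → ∫ t in Icc 0 T, φ t * g t ≤ 0) :
    ∀ᵐ t ∂(volume.restrict (Icc 0 T)), g t ≤ 0 := by
  set μ := volume.restrict (Icc 0 T) with hμ
  have hgi : Integrable g μ := Integrable.of_bound (C := M) hg hM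
  suffices h1 : ∀ s : Set ℝ, MeasurableSet s → μ s < ⊤ → 0 ≤ ∫ t in s, -g t ∂μ by
    filter_upwards [ae_nonneg_of_forall_setIntegral_nonneg hgi.neg h1] with t ht
    have : 0 ≤ -g t := ht
    linarith
  intro s hs _
  rw [integral_neg, neg_nonneg]
  refine le_of_forall_pos_le_add fun e he => ?_
  have hsi : IntegrableOn (s.indicator fun _ => (1 : ℝ)) (Icc 0 T) :=
    (integrable_const (1 : ℝ)).indicator hs
  obtain ⟨ψ, hψ, -, -, happ⟩ := exists_smooth_approx hT hsi (ε := e / (|M| + 1)) (by positivity)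
  have hψc := hψ.continuous
  have hφc : Continuous fun t => max (ψ t) 0 := hψc.max continuous_const
  have hint : ∀ {k : ℝ → ℝ}, Continuous k → Integrable k μ := fun hk =>
    hk.continuousOn.integrableOn_compact isCompact_Icc
  have hmul : ∀ {k : ℝ → ℝ}, Integrable k μ → Integrable (fun t => k t * g t) μ := fun hk =>
    hk.mul_bdd (c := M) hg hM
  have e1 : ∫ t in s, g t ∂μ = ∫ t, s.indicator (fun _ => (1 : ℝ)) t * g t ∂μ := by
    rw [← integral_indicator hs]
    refine integral_congr_ae (Eventually.of_forall fun t => ?_)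
    by_cases ht : t ∈ s <;> simp [ht]
  have h1 := h _ hφc fun t => le_max_right _ _
  have h2 : ∫ t, s.indicator (fun _ => (1 : ℝ)) t * g t ∂μ - ∫ t, max (ψ t) 0 * g t ∂μ ≤ e := by
    rw [← integral_sub (hmul hsi) (hmul (hint hφc))]
    have h3 : ∫ t, (s.indicator (fun _ => (1 : ℝ)) t * g t - max (ψ t) 0 * g t) ∂μ ≤
        ∫ t, |s.indicator (fun _ => (1 : ℝ)) t - ψ t| * |M| ∂μ := by
      refine integral_mono_ae ((hmul hsi).sub (hmul (hint hφc)))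
        ((hsi.sub (hint hψc)).abs.mul_const _) ?_
      filter_upwards [hM] with t ht
      rw [← sub_mul]
      refine (le_abs_self _).trans ?_
      rw [abs_mul]
      refine mul_le_mul ?_ (ht.trans (le_abs_self M)) (abs_nonneg _) (abs_nonneg _)
      have h5 := abs_max_sub_max_le_abs (s.indicator (fun _ => (1 : ℝ)) t) (ψ t) 0
      rwa [max_eq_left (indicator_nonneg (fun _ _ => zero_le_one) t)] at h5
    rw [integral_mul_const] at h3
    refine h3.trans ((mul_le_mul_of_nonneg_right happ (abs_nonneg M)).trans ?_)
    rw [div_mul_eq_mul_div, div_le_iff₀ (by positivity)]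
    nlinarith [abs_nonneg M]
  rw [e1]
  linarith

/-- The boundary condition at `x = 0` alone. -/
def OttoConditionZero (T : ℝ) (u : ℝ → ℝ → ℝ) (v : ℝ → ℝ) : Prop :=
  ∀ F Q : ℝ → ℝ → ℝ, IsBoundaryPair F Q →
    ∀ φ : ℝ → ℝ, ContinuousOn φ (Icc 0 T) → (∀ t ∈ Icc 0 T, 0 ≤ φ t) →
      ∃ L, EssLimZero (fun x => ∫ t in Icc 0 T, φ t * Q (u t x) (v t)) L ∧ L ≤ 0

/-- The reflected boundary pair carries a minus sign on the flux, which turns the condition ≥ 0 at x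
= 1 into the condition ≤ 0 at x = 0. -/
lemma ottoBoundaryCondition_iff {T : ℝ} {u : ℝ → ℝ → ℝ} {vm vp : ℝ → ℝ} :
    OttoBoundaryCondition T u vm vp ↔ OttoConditionZero T u vm ∧
      OttoConditionZero T (fun t x => 1 - u t (1 - x)) (fun t => 1 - vp t) := by
  constructor
  · intro h
    refine ⟨fun F Q hFQ φ hφ hφ0 => (h F Q hFQ φ hφ hφ0).1, fun F Q hFQ φ hφ hφ0 => ?_⟩
    obtain ⟨L, hL, hL0⟩ := (h _ _ hFQ.reflect φ hφ hφ0).2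
    refine ⟨-L, ?_, by linarith⟩
    refine (essLimOne_iff.1 hL).neg.congr fun x => ?_
    simp only [mul_neg, integral_neg, neg_neg]
  · rintro ⟨h1, h2⟩ F Q hFQ φ hφ hφ0
    refine ⟨h1 F Q hFQ φ hφ hφ0, ?_⟩
    obtain ⟨L, hL, hL0⟩ := h2 _ _ hFQ.reflect φ hφ hφ0
    refine ⟨-L, essLimOne_iff.2 ?_, by linarith⟩
    refine Tendsto.congr (fun x => ?_) hL.neg
    simp only [mul_neg, integral_neg, neg_neg, sub_sub_cancel]

/-- Characterization of the boundary condition at `x = 0` by the strong trace. -/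
lemma IsTraceZero.ottoConditionZero_iff {T : ℝ} {u : ℝ → ℝ → ℝ} {w v : ℝ → ℝ}
    (hw : IsTraceZero T u w) (hu : HasRegularSlices T u) (hT : 0 < T)
    (hv : AEStronglyMeasurable v (volume.restrict (Icc 0 T)))
    (hv01 : ∀ᵐ t ∂(volume.restrict (Icc 0 T)), v t ∈ Icc (0 : ℝ) 1) :
    OttoConditionZero T u v ↔ ∀ᵐ t ∂(volume.restrict (Icc 0 T)),
      w t ∈ {v t} ∪ Icc (1 - min (1 / 2) (v t)) 1 := by
  have hw01 := hw.ae_mem_Icc hu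
  constructor
  · intro h
    -- By uniqueness of the limit, the Otto condition gives a sign for integrals of each flux
    -- against every φ ≥ 0, hence almost everywhere. Restricting to rational tents keeps the
    -- exceptional set null.
    have hcount : ∀ q r : ℚ, ∀ᵐ t ∂(volume.restrict (Icc 0 T)),
        kernelFlux (fun s => max 0 ((r : ℝ) - |s - q|)) (w t) (v t) ≤ 0 := by
      intro q r
      obtain ⟨F, hF⟩ := exists_isBoundaryPair_kernelFlux
        (g := fun s => max 0 ((r : ℝ) - |s - q|)) (by fun_prop) fun s => le_max_left _ _
      have hcomp : IsCompact (Icc (0 : ℝ) 1 ×ˢ Icc (0 : ℝ) 1) := isCompact_Icc.prod isCompact_Icc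
      obtain ⟨M, hM⟩ := hcomp.exists_bound_of_continuousOn hF.continuousOn_flux
      refine ae_nonpos_of_forall_continuous hT (M := M) (aestronglyMeasurable_boundaryFlux
        hF.continuousOn_flux hw.1.aestronglyMeasurable hw01 hv hv01) ?_ fun φ hφ hφ0 => ?_
      · filter_upwards [hw01, hv01] with t h1 h2 using hM (w t, v t) ⟨h1, h2⟩
      · obtain ⟨L, hL, hL0⟩ := h _ _ hF φ hφ.continuousOn fun t _ => hφ0 t
        rw [← tendsto_nhds_unique hL (hw.essLim_flux hu hT hv hv01 hF hφ.continuousOn)]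
        exact hL0
    filter_upwards [ae_all_iff.2 fun q => ae_all_iff.2 (hcount q), hw01] with t h1 h2
    exact mem_of_forall_kernelFlux_nonpos h2 h1
  · intro h F Q hFQ φ hφ hφ0
    refine ⟨_, hw.essLim_flux hu hT hv hv01 hFQ hφ, integral_nonpos_of_ae ?_⟩
    filter_upwards [h, hw01, hv01, ae_restrict_mem measurableSet_Icc] with t h1 h2 h3 h4
    exact mul_nonpos_of_nonneg_of_nonpos (hφ0 t h4) (hFQ.flux_nonpos h2 h3 h1)

lemma one_sub_mem_admissible_iff {a v : ℝ} :
    1 - a ∈ {1 - v} ∪ Icc (1 - min (1 / 2) (1 - v)) 1 ↔ a ∈ Icc 0 (1 - max (1 / 2) v) ∪ {v} := by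
  have h1 : min (1 / 2) (1 - v) = 1 - max (1 / 2) v := by
    rw [← min_sub_sub_left]; norm_num
  rw [h1, union_comm]
  simp only [mem_union, mem_singleton_iff, mem_Icc, sub_right_inj]
  refine or_congr_left ⟨fun h => ⟨by linarith [h.2], by linarith [h.1]⟩,
    fun h => ⟨by linarith [h.2], by linarith [h.1]⟩⟩

theorem proposition2p5 (p T : ℝ) (hp : 0 < p) (hT : 0 < T)
    (u : ℝ → ℝ → ℝ) (vm vp : ℝ → ℝ)
    (hu : AEStronglyMeasurable (Function.uncurry u) (volume.restrict (Icc 0 T ×ˢ Icc 0 1)))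
    (hu01 : ∀ᵐ z ∂(volume.restrict (Icc (0 : ℝ) T ×ˢ Icc (0 : ℝ) 1)), u z.1 z.2 ∈ Icc (0 : ℝ) 1)
    (hvm : AEStronglyMeasurable vm (volume.restrict (Icc 0 T)))
    (hvm01 : ∀ᵐ t ∂(volume.restrict (Icc 0 T)), vm t ∈ Icc (0 : ℝ) 1)
    (hvp : AEStronglyMeasurable vp (volume.restrict (Icc 0 T)))
    (hvp01 : ∀ᵐ t ∂(volume.restrict (Icc 0 T)), vp t ∈ Icc (0 : ℝ) 1)
    (hent : EntropyInequality p T u) :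
    (∃ um up : ℝ → ℝ, IsTraceZero T u um ∧ IsTraceOne T u up) ∧
    ∀ um up : ℝ → ℝ, IsTraceZero T u um → IsTraceOne T u up →
      (OttoBoundaryCondition T u vm vp ↔
        ∀ᵐ t ∂(volume.restrict (Icc 0 T)),
          um t ∈ {vm t} ∪ Icc (1 - min (1 / 2) (vm t)) 1 ∧
          up t ∈ Icc 0 (1 - max (1 / 2) (vp t)) ∪ {vp t}) := by
  -- Measurability and bounds of the reflected function follow from measure preservation; afterwards
  -- each statement at x = 1 is the one at x = 0 applied to it.
  have hmp := measurePreserving_reflectEquiv_restrict T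
  have hu' : AEStronglyMeasurable (Function.uncurry fun t x => 1 - u t (1 - x))
      (volume.restrict (Icc 0 T ×ˢ Icc 0 1)) :=
    aestronglyMeasurable_const.sub (hu.comp_measurePreserving hmp)
  have hu01' : ∀ᵐ z ∂(volume.restrict (Icc (0 : ℝ) T ×ˢ Icc (0 : ℝ) 1)),
      1 - u z.1 (1 - z.2) ∈ Icc (0 : ℝ) 1 :=
    (hmp.quasiMeasurePreserving.ae hu01).mono fun z hz => one_sub_mem_Icc hz
  refine ⟨?_, fun um up hum hup => ?_⟩
  · obtain ⟨um, hum⟩ := hent.exists_isTraceZero hp hT hu hu01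
    obtain ⟨w, hw⟩ := hent.reflect.exists_isTraceZero hp hT hu' hu01'
    refine ⟨um, fun t => 1 - w t, hum, isTraceOne_iff.2 ?_⟩
    simpa only [sub_sub_cancel] using hw
  · rw [ottoBoundaryCondition_iff,
      hum.ottoConditionZero_iff (hent.hasRegularSlices hu hu01) hT hvm hvm01,
      (isTraceOne_iff.1 hup).ottoConditionZero_iff (v := fun t => 1 - vp t)
        (hent.reflect.hasRegularSlices hu' hu01') hT
        (aestronglyMeasurable_const.sub hvp) (hvp01.mono fun t ht => one_sub_mem_Icc ht),
      ← eventually_and]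
    simp only [one_sub_mem_admissible_iff]
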